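/- Let $n\ge 2$ and let $W$ be the Coxeter group of type $\tilde A_{n-1}$, realized as the group of permutations $w$ of $\mathbb Z$ such that $w(x+n)=w(x)+n$ for all $x\in\mathbb Z$ and $\sum_{x=1}^n (w(x)-x)=0$, with Coxeter generators $s_1,\dots,s_n$, where $s_i$ exchanges $i+kn$ and $i+1+kn$ for all $k\in\mathbb Z$ and fixes the other integers. Let $R$ be the set of reflections of $W$ (the conjugates of the $s_i$), and let $l_R(w)$ be the least number of factors in a decomposition of $w$ as a product of reflections. For a Coxeter element $c$ (a product of $s_1,\dots,s_n$ in some order) let $P_c$ be the set of $p\in W$ such that $c=pp'$ with $l_R(c)=l_R(p)+l_R(p')$. The dual monoid $M(P_c)$ is the monoid generated by symbols $\underline p$ ($p\in P_c$) with relations $\underline 1=1$ and $\underline{w}\,\underline{w'}=\underline{ww'}$ whenever $w,w',ww'\in P_c$ and $l_R(ww')=l_R(w)+l_R(w')$. A monoid $M$ is called quasi-Garside with Garside element $\Delta\in M$ if: (i) for every $m\in M$ the number of factors $\ne 1$ in a product equal to $m$ is bounded; (ii) $M$ is left and right cancellative; (iii) left divisibility and right divisibility are both lattice orders on $M$; (iv)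 the set of left divisors of $\Delta$ equals its set of right divisors and generates $M$. For every Coxeter element $c$ there is a unique partition $\mathbb Z=X\sqcup\Xi$ into two non-empty sets invariant under translation by $n$ such that $c$ maps each element of $X$ to the next larger element of $X$ and each element of $\Xi$ to the next smaller element of $\Xi$. The following conditions are equivalent: 1. $M(P_c)$ is a lattice for left divisibility; 2. $M(P_c)$ is a lattice for right divisibility; 3. $M(P_c)$ is quasi-Garside with some Garside element; 4. $M(P_c)$ is quasi-Garside with Garside element $\underline c$; 5. $X$ or $\Xi$ has exactly one class modulo $n$. Up to diagram automorphism, exactly one Coxeter element has these properties, namely $s_1s_2\cdots s_n$: the monoid $M(P_{s_1\cdots s_n})$ is quasi-Garside with Garside element $\underline{s_1\cdots s_n}$, and, for a Coxeter element $c$, the monoid $M(P_c)$ is quasi-Garside if and only if $c$ is the image of $s_1\cdots s_n$ under an automorphism of $W$ that permutes the Coxeter generators. -/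

import Mathlib

/-! ### The dual monoid of a positively generated group -/

/-- The length `l_R(g)`: the least number of factors in a decomposition of `g` as a product of
elements of `R`. -/
noncomputable def reflLength {G : Type*} [Group G] (R : Set G) (g : G) : ℕ :=
  sInf {k : ℕ | ∃ l : List G, l.length = k ∧ (∀ r ∈ l, r ∈ R) ∧ l.prod = g}

/-- The set `P_c` of divisors of `c`: those `p` with `c = p p'` and
`l_R(c) = l_R(p) + l_R(p')` for some `p'`. -/
def divisorSet {G : Type*} [Group G] (R : Set G) (c : G) : Set G :=
  {p | ∃ p' : G, c = p * p' ∧ reflLength R c = reflLength R p + reflLength R p'}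

theorem reflLength_one {G : Type*} [Group G] (R : Set G) : reflLength R (1 : G) = 0 := by
  unfold reflLength
  exact Nat.sInf_eq_zero.2 (Or.inl ⟨[], by simp⟩)

theorem self_mem_divisorSet {G : Type*} [Group G] (R : Set G) (c : G) :
    c ∈ divisorSet R c := ⟨1, by simp, by simp [reflLength_one]⟩

/-- The defining relations of `M(P_c)` between words in the generators `p̲` (for `p ∈ P_c`):
`w̲ w̲' = (ww')̲` whenever `w`, `w'`, `ww'` are in `P_c` and `l_R(ww') = l_R(w) + l_R(w')`, and the
generator attached to the identity of the group is the identity of the monoid. -/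
inductive DualRel {G : Type*} [Group G] (R : Set G) (c : G) :
    FreeMonoid (divisorSet R c) → FreeMonoid (divisorSet R c) → Prop
  | mul (w w' v : divisorSet R c) (hv : (v : G) = w * w')
      (hl : reflLength R (v : G) = reflLength R (w : G) + reflLength R (w' : G)) :
      DualRel R c (FreeMonoid.of w * FreeMonoid.of w') (FreeMonoid.of v)
  | one (e : divisorSet R c) (he : (e : G) = 1) : DualRel R c (FreeMonoid.of e) 1

/-- The dual monoid `M(P_c)`. -/
abbrev DualMonoid {G : Type*} [Group G] (R : Set G) (c : G) : Type _ :=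
  PresentedMonoid (DualRel R c)

/-- The element `c̲` of `M(P_c)`. -/
def DualMonoid.delta {G : Type*} [Group G] (R : Set G) (c : G) : DualMonoid R c :=
  PresentedMonoid.of (DualRel R c) ⟨c, self_mem_divisorSet R c⟩

/-! ### Lattices and quasi-Garside monoids -/

/-- `r` is a partial order for which any two elements have a least upper bound and a greatest
lower bound. -/
structure IsLatticeOrder {α : Type*} (r : α → α → Prop) : Prop where
  refl : ∀ a, r a a
  trans : ∀ a b c, r a b → r b c → r a c
  antisymm : ∀ a b, r a b → r b a → a = b
  sup : ∀ a b, ∃ s, r a s ∧ r b s ∧ ∀ t, r a t → r b t → r s t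
  inf : ∀ a b, ∃ i, r i a ∧ r i b ∧ ∀ t, r t a → r t b → r t i

/-- `a` divides `b` on the left: `b = a m` for some `m`. -/
def LeftDivides {M : Type*} [Monoid M] (a b : M) : Prop := ∃ m, b = a * m

/-- `a` divides `b` on the right: `b = m a` for some `m`. -/
def RightDivides {M : Type*} [Monoid M] (a b : M) : Prop := ∃ m, b = m * a

/-- `M` is a quasi-Garside monoid with Garside element `Δ`. -/
structure IsQuasiGarside (M : Type*) [Monoid M] (Δ : M) : Prop where
  /-- The number of (non-trivial) factors in a product equal to a given `m` is bounded. -/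
  bounded : ∀ m : M, ∃ N : ℕ, ∀ l : List M, (∀ x ∈ l, x ≠ 1) → l.prod = m → l.length ≤ N
  cancel_left : ∀ a x y : M, a * x = a * y → x = y
  cancel_right : ∀ a x y : M, x * a = y * a → x = y
  lattice_left : IsLatticeOrder (LeftDivides : M → M → Prop)
  lattice_right : IsLatticeOrder (RightDivides : M → M → Prop)
  divisors : {x : M | LeftDivides x Δ} = {x : M | RightDivides x Δ}
  generate : Submonoid.closure {x : M | LeftDivides x Δ} = ⊤

/-! ### The Coxeter group of type `Ã_{n-1}` as a group of permutations of `ℤ` -/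

/-- `w` is an `n`-periodic permutation of `ℤ`. -/
def IsNPeriodic (n : ℕ) (w : Equiv.Perm ℤ) : Prop := ∀ x : ℤ, w (x + n) = w x + n

theorem IsNPeriodic.add_mul {n : ℕ} {w : Equiv.Perm ℤ} (hw : IsNPeriodic n w) (x k : ℤ) :
    w (x + k * n) = w x + k * n := by
  have h : Function.Periodic (fun y => w y - y) (n : ℤ) := fun y => by
    simp only [hw y]; ring
  have := h.int_mul k x
  simp only [Int.cast_id] at this
  linarith

theorem IsNPeriodic.mul {n : ℕ} {v w : Equiv.Perm ℤ} (hv : IsNPeriodic n v)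
    (hw : IsNPeriodic n w) : IsNPeriodic n (v * w) := fun x => by
  rw [Equiv.Perm.mul_apply, Equiv.Perm.mul_apply, hw, hv]

theorem IsNPeriodic.inv {n : ℕ} {w : Equiv.Perm ℤ} (hw : IsNPeriodic n w) :
    IsNPeriodic n w⁻¹ := fun x => by
  rw [Equiv.Perm.inv_eq_iff_eq, hw]; simp

theorem sum_comp_of_isNPeriodic {n : ℕ} {w : Equiv.Perm ℤ} (hw : IsNPeriodic n w) (f : ℤ → ℤ)
    (hf : Function.Periodic f (n : ℤ)) :
    ∑ x ∈ Finset.Icc (1 : ℤ) n, f (w x) = ∑ x ∈ Finset.Icc (1 : ℤ) n, f x := by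
  rcases Nat.eq_zero_or_pos n with rfl | hn
  · simp
  have hn' : (0 : ℤ) < n := by exact_mod_cast hn
  have key : ∀ y : ℤ, (y - 1) % n + 1 = y + (-((y - 1) / n)) * n := fun y => by
    have := Int.emod_add_mul_ediv (y - 1) n
    linarith
  have hmem : ∀ y : ℤ, (y - 1) % n + 1 ∈ Finset.Icc (1 : ℤ) n := fun y => by
    have h1 := Int.emod_nonneg (y - 1) hn'.ne'
    have h2 := Int.emod_lt_of_pos (y - 1) hn'
    rw [Finset.mem_Icc]; omega
  have hself : ∀ x ∈ Finset.Icc (1 : ℤ) n, ∀ k : ℤ, (x + k * n - 1) % n + 1 = x := by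
    intro x hx k
    rw [Finset.mem_Icc] at hx
    rw [show x + k * n - 1 = (x - 1) + k * n by ring, Int.add_mul_emod_self_right,
      Int.emod_eq_of_lt (by omega) (by omega)]
    ring
  refine Finset.sum_nbij' (fun x => (w x - 1) % n + 1) (fun y => (w⁻¹ y - 1) % n + 1)
    (fun x _ => hmem _) (fun y _ => hmem _) ?_ ?_ ?_
  · intro x hx
    rw [key (w x), hw.inv.add_mul, show w⁻¹ (w x) = x by simp]
    exact hself x hx _
  · intro y hy
    rw [key (w⁻¹ y), hw.add_mul, show w (w⁻¹ y) = y by simp]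
    exact hself y hy _
  · intro x _
    rw [key (w x)]
    exact (hf.int_mul _ _).symm

theorem IsNPeriodic.periodic_sub {n : ℕ} {w : Equiv.Perm ℤ} (hw : IsNPeriodic n w) :
    Function.Periodic (fun x => w x - x) (n : ℤ) := fun x => by
  simp only [hw x]; ring

/-- The Coxeter group `W` of type `Ã_{n-1}`: the group of `n`-periodic permutations `w` of `ℤ`
whose shift `(1/n) ∑_{x=1}^{n} (w(x) - x)` is zero. The product is composition of maps. -/
def AffineW (n : ℕ) : Subgroup (Equiv.Perm ℤ) where
  carrier := {w | IsNPeriodic n w ∧ ∑ x ∈ Finset.Icc (1 : ℤ) n, (w x - x) = 0}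
  one_mem' := ⟨fun _ => rfl, by simp⟩
  mul_mem' := by
    rintro v w ⟨hv, hv0⟩ ⟨hw, hw0⟩
    refine ⟨hv.mul hw, ?_⟩
    have h := sum_comp_of_isNPeriodic hw _ hv.periodic_sub
    rw [hv0] at h
    rw [← add_zero (0 : ℤ)]
    nth_rewrite 1 [← h]
    rw [← hw0, ← Finset.sum_add_distrib]
    exact Finset.sum_congr rfl fun x _ => by simp
  inv_mem' := by
    rintro w ⟨hw, hw0⟩
    refine ⟨hw.inv, ?_⟩
    have h := sum_comp_of_isNPeriodic hw.inv _ hw.periodic_sub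
    rw [hw0] at h
    rw [← neg_eq_zero, ← Finset.sum_neg_distrib, ← h]
    exact Finset.sum_congr rfl fun x _ => by simp

/-- The map underlying `(a, b)`. -/
def transpFun (n : ℕ) (a b x : ℤ) : ℤ :=
  if (n : ℤ) ∣ x - a then x + (b - a) else if (n : ℤ) ∣ x - b then x + (a - b) else x

theorem transpFun_involutive {n : ℕ} {a b : ℤ} (h : ¬ (n : ℤ) ∣ b - a) :
    Function.Involutive (transpFun n a b) := by
  intro x
  unfold transpFun
  by_cases h1 : (n : ℤ) ∣ x - a
  · have h2 : ¬ (n : ℤ) ∣ x + (b - a) - a := fun h2 => h (by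
      have := dvd_sub h2 h1
      rwa [show x + (b - a) - a - (x - a) = b - a by ring] at this)
    have h3 : (n : ℤ) ∣ x + (b - a) - b := by
      rwa [show x + (b - a) - b = x - a by ring]
    rw [if_pos h1, if_neg h2, if_pos h3]; ring
  · by_cases h2 : (n : ℤ) ∣ x - b
    · have h3 : (n : ℤ) ∣ x + (a - b) - a := by
        rwa [show x + (a - b) - a = x - b by ring]
      rw [if_neg h1, if_pos h2, if_pos h3]; ring
    · simp [h1, h2]

/-- The permutation of `ℤ` underlying `(a, b)`. -/
def transpPerm (n : ℕ) (a b : ℤ) (h : ¬ (n : ℤ) ∣ b - a) : Equiv.Perm ℤ :=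
  (transpFun_involutive h).toPerm

theorem transpPerm_apply {n : ℕ} {a b : ℤ} (h : ¬ (n : ℤ) ∣ b - a) (x : ℤ) :
    transpPerm n a b h x = transpFun n a b x := rfl

theorem transpPerm_isNPeriodic {n : ℕ} {a b : ℤ} (h : ¬ (n : ℤ) ∣ b - a) :
    IsNPeriodic n (transpPerm n a b h) := by
  intro x
  simp only [transpPerm_apply]
  unfold transpFun
  have e : ∀ d : ℤ, (n : ℤ) ∣ x + n - d ↔ (n : ℤ) ∣ x - d := fun d => by
    rw [show x + n - d = (x - d) + n by ring]
    exact dvd_add_self_right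
  simp only [e]
  split_ifs <;> ring

/-- The element `(a, b)` of `W`, for `a`, `b` distinct modulo `n`: it exchanges `a + kn` and
`b + kn` for all `k` and fixes the other integers. -/
def affineTransp (n : ℕ) (a b : ℤ) (h : ¬ (n : ℤ) ∣ b - a) : AffineW n :=
  ⟨transpPerm n a b h, transpPerm_isNPeriodic h, by
    have hp := transpPerm_isNPeriodic h
    have hs := sum_comp_of_isNPeriodic hp _ hp.periodic_sub
    have : ∑ x ∈ Finset.Icc (1 : ℤ) n, (transpPerm n a b h x - x) =
        -∑ x ∈ Finset.Icc (1 : ℤ) n, (transpPerm n a b h x - x) := by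
      nth_rewrite 1 [← hs]
      rw [← Finset.sum_neg_distrib]
      refine Finset.sum_congr rfl fun x _ => ?_
      simp only [transpPerm_apply, transpFun_involutive h x]
      ring
    linarith⟩

theorem not_dvd_succ_sub {n : ℕ} (hn : 2 ≤ n) (a : ℤ) : ¬ (n : ℤ) ∣ (a + 1) - a := by
  rw [add_sub_cancel_left]
  intro h
  have := Int.le_of_dvd one_pos h
  omega

/-- The Coxeter generators `s_i = (i, i+1)`, `1 ≤ i ≤ n`; the index `i : Fin n` stands for
`s_{i+1}`. -/
def simpleRefl {n : ℕ} (hn : 2 ≤ n) (i : Fin n) : AffineW n :=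
  affineTransp n ((i : ℤ) + 1) ((i : ℤ) + 1 + 1) (not_dvd_succ_sub hn _)

/-- The set `R` of reflections: the conjugates in `W` of the Coxeter generators. -/
def reflections {n : ℕ} (hn : 2 ≤ n) : Set (AffineW n) :=
  {r | ∃ (i : Fin n) (g : AffineW n), r = g * simpleRefl hn i * g⁻¹}

/-- `c` is a Coxeter element: the product of all Coxeter generators in some order. -/
def IsCoxeterElement {n : ℕ} (hn : 2 ≤ n) (c : AffineW n) : Prop :=
  ∃ l : List (Fin n), l.Perm (List.finRange n) ∧ (l.map (simpleRefl hn)).prod = c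

/-- The Coxeter element `s_1 s_2 ⋯ s_n`. -/
def standardCoxeter {n : ℕ} (hn : 2 ≤ n) : AffineW n :=
  ((List.finRange n).map (simpleRefl hn)).prod

/-- A diagram automorphism, as an automorphism of `W`: an automorphism of the group that permutes
the Coxeter generators. -/
def IsDiagramAut {n : ℕ} (hn : 2 ≤ n) (φ : AffineW n ≃* AffineW n) : Prop :=
  ∃ σ : Equiv.Perm (Fin n), ∀ i, φ (simpleRefl hn i) = simpleRefl hn (σ i)

/-- `c = (a, b, …, l)_{[1]} (λ, …, β, α)_{[-1]}`, where `a < b < ⋯ < l` and `α < β < ⋯ < λ` form a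
partition of `{1, …, n}` into two non-empty parts, `X = {a, b, …, l} + nℤ` and
`Ξ = {α, β, …, λ} + nℤ`. Equivalently: `X` and `Ξ` are non-empty, invariant under translation by
`n`, they partition `ℤ`, and `c` moves each element of `X` to the next larger element of `X` and
each element of `Ξ` to the next smaller element of `Ξ`. -/
structure IsCoxeterPartition {n : ℕ} (c : AffineW n) (X Ξ : Set ℤ) : Prop where
  nonempty_X : X.Nonempty
  nonempty_Ξ : Ξ.Nonempty
  add_mem_X : ∀ x : ℤ, x + (n : ℤ) ∈ X ↔ x ∈ X
  add_mem_Ξ : ∀ x : ℤ, x + (n : ℤ) ∈ Ξ ↔ x ∈ Ξ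
  isCompl : IsCompl X Ξ
  next_X : ∀ x ∈ X, IsLeast {y | y ∈ X ∧ x < y} ((c : Equiv.Perm ℤ) x)
  prev_Ξ : ∀ x ∈ Ξ, IsGreatest {y | y ∈ Ξ ∧ y < x} ((c : Equiv.Perm ℤ) x)

/-- The image of `A` in `ℤ/nℤ` has exactly one element. -/
def IsSingletonMod (n : ℕ) (A : Set ℤ) : Prop :=
  ((fun x : ℤ => (x : ZMod n)) '' A).ncard = 1

/-! ### The absolute length and the absolute order -/

/-! Divisibility between generators of `DualMonoid R c` is the absolute order on the divisors of `c`
(`DualMonoid.leftDivides_gen_iff`), so everything turns on whether the interval from `1` to `c` is a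
lattice.

A lattice suffices, for any reflection set. The monoid acts on pairs (head, tail) through the greedy
normal form (`act`), which provides the largest generator dividing an element and left cancellation.
Lcms of generators then propagate to all pairs with a common multiple, and powers of `delta` provide
common multiples. Statements on the right follow from those for `c⁻¹` by reversing products.

Suppose one part of the partition is a single class; passing to `c⁻¹` if necessary, this is Ξ. Order
ℤ with X first, increasing, then Ξ, decreasing. The divisors of `c` are then the maps "next element
of the class, cyclically" of periodic noncrossing equivalence relations (`IsModel`). Three facts
carry this: cutting a class in two multiplies the map by a reflection and lowers its length by one
(`IsNextMap.split`, `IsModel.split`); every reflection lowering the length is such a cut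
(`IsNextMap.exists_isCut`); and below the relation of a map, above any strictly smaller relation,
there is always a cut (`IsNextMap.exists_isCut_of_lt`). The second rests on a lower bound for the
reflection length, obtained by linear algebra on functions on ℤ/nℤ (`exists_subspace`). Noncrossing
relations have meets (`IsNoncrossing.meet`), hence so do divisors, and joins follow because lengths
are bounded.

Suppose instead that X contains two classes a, b and Ξ two classes α, β. The reflections (a, b) and
(b, a+n) lie below two divisors p and q of length three, both mapping a to b and b to a+n, with p
translating α and q translating β by -n. A least upper bound of the two reflections in the monoid
would be a generator s of length two below p and q, and (a, b)s would be a single reflection moving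
the three classes b, α, β (`not_exists_between`).

Finally, a Coxeter element is determined by its partition, and conjugation by x ↦ ±x + k is a
diagram automorphism that moves any single class to any other, exchanging X and Ξ when the sign is
negative. -/

/-- A generating set of a group which is stable under inversion and conjugation. -/
structure IsReflectionSet {G : Type*} [Group G] (R : Set G) : Prop where
  conj : ∀ g r, r ∈ R → g * r * g⁻¹ ∈ R
  inv : ∀ r, r ∈ R → r⁻¹ ∈ R
  gen : ∀ g : G, ∃ l : List G, (∀ r ∈ l, r ∈ R) ∧ l.prod = g

/-- The absolute order: `p` is a divisor of `q`. -/
def AbsLE {G : Type*} [Group G] (R : Set G) (p q : G) : Prop :=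
  reflLength R q = reflLength R p + reflLength R (p⁻¹ * q)

section AbsoluteOrder

variable {G : Type*} [Group G] {R : Set G}

theorem mem_divisorSet_iff {c p : G} : p ∈ divisorSet R c ↔ AbsLE R p c := by
  constructor
  · rintro ⟨p', rfl, h⟩
    simpa [AbsLE] using h
  · intro h
    exact ⟨p⁻¹ * c, by simp, h⟩

theorem reflLength_prod_le (l : List G) (hl : ∀ r ∈ l, r ∈ R) :
    reflLength R l.prod ≤ l.length :=
  Nat.sInf_le ⟨l, rfl, hl, rfl⟩

theorem reflLength_le_one {r : G} (hr : r ∈ R) : reflLength R r ≤ 1 := by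
  simpa using reflLength_prod_le (R := R) [r] (by simpa using hr)

theorem absLE_refl (R : Set G) (p : G) : AbsLE R p p := by simp [AbsLE, reflLength_one]

theorem one_absLE (R : Set G) (p : G) : AbsLE R 1 p := by simp [AbsLE, reflLength_one]

namespace IsReflectionSet

variable (hR : IsReflectionSet R)

include hR

theorem exists_list (g : G) :
    ∃ l : List G, l.length = reflLength R g ∧ (∀ r ∈ l, r ∈ R) ∧ l.prod = g := by
  obtain ⟨l, hl, hp⟩ := hR.gen g
  exact Nat.sInf_mem (s := {k : ℕ | ∃ l : List G, l.length = k ∧ (∀ r ∈ l, r ∈ R) ∧ l.prod = g})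
    ⟨l.length, l, rfl, hl, hp⟩

theorem length_mul_le (g h : G) :
    reflLength R (g * h) ≤ reflLength R g + reflLength R h := by
  obtain ⟨l, hl, hlR, rfl⟩ := hR.exists_list g
  obtain ⟨m, hm, hmR, rfl⟩ := hR.exists_list h
  rw [← hl, ← hm, ← List.length_append, ← List.prod_append]
  exact reflLength_prod_le _ fun r hr => (List.mem_append.1 hr).elim (hlR r) (hmR r)

theorem length_eq_zero {g : G} : reflLength R g = 0 ↔ g = 1 := by
  constructor
  · intro h
    obtain ⟨l, hl, -, rfl⟩ := hR.exists_list g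
    rw [h, List.length_eq_zero_iff] at hl
    simp [hl]
  · rintro rfl
    exact reflLength_one R

theorem length_inv_le (g : G) : reflLength R g⁻¹ ≤ reflLength R g := by
  obtain ⟨l, hl, hlR, rfl⟩ := hR.exists_list g
  rw [← hl, List.prod_inv_reverse]
  refine (reflLength_prod_le _ ?_).trans (by simp)
  intro r hr
  simp only [List.mem_reverse, List.mem_map] at hr
  obtain ⟨s, hs, rfl⟩ := hr
  exact hR.inv s (hlR s hs)

theorem length_inv (g : G) : reflLength R g⁻¹ = reflLength R g :=
  le_antisymm (hR.length_inv_le g) (by simpa using hR.length_inv_le g⁻¹)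

theorem length_conj_le (h g : G) : reflLength R (h * g * h⁻¹) ≤ reflLength R g := by
  obtain ⟨l, hl, hlR, rfl⟩ := hR.exists_list g
  have : h * l.prod * h⁻¹ = (l.map (MulAut.conj h)).prod := by
    rw [← map_list_prod]; simp
  rw [← hl, this]
  refine (reflLength_prod_le _ ?_).trans (by simp)
  intro r hr
  obtain ⟨s, hs, rfl⟩ := List.mem_map.1 hr
  exact hR.conj h s (hlR s hs)

theorem length_conj (h g : G) : reflLength R (h * g * h⁻¹) = reflLength R g := by
  refine le_antisymm (hR.length_conj_le h g) ?_
  have := hR.length_conj_le h⁻¹ (h * g * h⁻¹)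
  rwa [show h⁻¹ * (h * g * h⁻¹) * h⁻¹⁻¹ = g by group] at this

theorem length_comm (g h : G) : reflLength R (g * h) = reflLength R (h * g) := by
  have := hR.length_conj h (g * h)
  rwa [show h * (g * h) * h⁻¹ = h * g by group, eq_comm] at this

theorem mem_of_length_eq_one {g : G} (h : reflLength R g = 1) : g ∈ R := by
  obtain ⟨l, hl, hlR, rfl⟩ := hR.exists_list g
  rw [h, List.length_eq_one_iff] at hl
  obtain ⟨a, rfl⟩ := hl
  simpa using hlR a (by simp)

theorem absLE_of_mul {p q : G} (h : reflLength R p + reflLength R q ≤ reflLength R (p * q)) :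
    AbsLE R p (p * q) := by
  have := hR.length_mul_le p q
  simp only [AbsLE, inv_mul_cancel_left]
  omega

theorem absLE_trans {p q r : G} (h : AbsLE R p q) (h' : AbsLE R q r) : AbsLE R p r := by
  unfold AbsLE at *
  have h1 := hR.length_mul_le p (p⁻¹ * r)
  have h2 := hR.length_mul_le (p⁻¹ * q) (q⁻¹ * r)
  rw [show p * (p⁻¹ * r) = r by group] at h1
  rw [show p⁻¹ * q * (q⁻¹ * r) = p⁻¹ * r by group] at h2
  omega

theorem eq_of_absLE_of_length_le {p q : G} (h : AbsLE R p q)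
    (h' : reflLength R q ≤ reflLength R p) : p = q := by
  unfold AbsLE at *
  have : reflLength R (p⁻¹ * q) = 0 := by omega
  rw [hR.length_eq_zero, inv_mul_eq_one] at this
  exact this

theorem absLE_antisymm {p q : G} (h : AbsLE R p q) (h' : AbsLE R q p) : p = q :=
  hR.eq_of_absLE_of_length_le h (by unfold AbsLE at *; omega)

/-- If `p ≤ q ≤ c` then `p⁻¹ q ≤ p⁻¹ c`. -/
theorem absLE_inv_mul {p q c : G} (h : AbsLE R p q) (h' : AbsLE R q c) :
    AbsLE R (p⁻¹ * q) (p⁻¹ * c) := by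
  have h'' := hR.absLE_trans h h'
  unfold AbsLE at *
  rw [show (p⁻¹ * q)⁻¹ * (p⁻¹ * c) = q⁻¹ * c by group]
  omega

/-- If `p ≤ c` and `q ≤ p⁻¹ c` then `p ≤ p q`. -/
theorem absLE_mul_right {p q c : G} (h : AbsLE R p c) (h' : AbsLE R q (p⁻¹ * c)) :
    AbsLE R p (p * q) := by
  refine hR.absLE_of_mul ?_
  unfold AbsLE at *
  have h1 := hR.length_mul_le (p * q) ((p * q)⁻¹ * c)
  rw [mul_inv_cancel_left, show (p * q)⁻¹ * c = q⁻¹ * (p⁻¹ * c) by group] at h1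
  omega

/-- If `p ≤ c` and `q ≤ p⁻¹ c` then `p q ≤ c`. -/
theorem mul_absLE {p q c : G} (h : AbsLE R p c) (h' : AbsLE R q (p⁻¹ * c)) :
    AbsLE R (p * q) c := by
  have h2 := hR.absLE_mul_right h h'
  unfold AbsLE at *
  rw [inv_mul_cancel_left] at h2
  rw [show (p * q)⁻¹ * c = q⁻¹ * (p⁻¹ * c) by group]
  omega

/-- Right divisors are left divisors. -/
theorem inv_mul_absLE {p q : G} (h : AbsLE R p q) : AbsLE R (p⁻¹ * q) q := by
  unfold AbsLE at *
  rw [show (p⁻¹ * q)⁻¹ * q = q⁻¹ * p * q⁻¹⁻¹ by group, hR.length_conj]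
  omega

theorem mul_inv_absLE {p q : G} (h : AbsLE R p q) : AbsLE R (q * p⁻¹) q := by
  unfold AbsLE at *
  rw [show (q * p⁻¹)⁻¹ * q = p by group, ← hR.length_comm p⁻¹ q]
  omega

/-- Left multiplication is an order isomorphism from divisors of `p⁻¹ c` onto the interval
`[p, c]`. -/
theorem mul_absLE_mul {p q q' c : G} (h : AbsLE R p c) (h' : AbsLE R q' (p⁻¹ * c))
    (hq : AbsLE R q q') : AbsLE R (p * q) (p * q') := by
  have h1 := hR.absLE_mul_right h h'
  have h2 := hR.absLE_mul_right h (hR.absLE_trans hq h')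
  unfold AbsLE at *
  rw [inv_mul_cancel_left] at h1 h2
  rw [show (p * q)⁻¹ * (p * q') = q⁻¹ * q' by group]
  omega

/-- Inversion turns left divisors into right divisors. The length is invariant under conjugation, so
these are the same elements and the order is preserved. -/
theorem absLE_inv_inv {p q : G} : AbsLE R p⁻¹ q⁻¹ ↔ AbsLE R p q := by
  unfold AbsLE
  rw [hR.length_inv, hR.length_inv, inv_inv, ← hR.length_inv (p * q⁻¹), mul_inv_rev, inv_inv,
    hR.length_comm]

end IsReflectionSet

end AbsoluteOrder

/-! ### Divisors in the dual monoid -/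

namespace DualMonoid

variable {G : Type*} [Group G] {R : Set G} {c : G}

/-- The generator of `M(P_c)` attached to a divisor of `c`. -/
def gen {p : G} (hp : AbsLE R p c) : DualMonoid R c :=
  PresentedMonoid.of (DualRel R c) ⟨p, mem_divisorSet_iff.2 hp⟩

theorem gen_congr {p q : G} (hp : AbsLE R p c) (hq : AbsLE R q c) (h : p = q) :
    gen hp = gen hq := by subst h; rfl

theorem delta_eq_gen : delta R c = gen (absLE_refl R c) := rfl

theorem gen_one (h : AbsLE R 1 c) : gen h = 1 :=
  PresentedMonoid.mk_eq_mk_of_rel (DualRel.one _ rfl)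

theorem gen_mul_gen {p q r : G} (hp : AbsLE R p c) (hq : AbsLE R q c) (hr : AbsLE R r c)
    (h : r = p * q) (hl : AbsLE R p r) : gen hp * gen hq = gen hr := by
  refine PresentedMonoid.mk_eq_mk_of_rel (DualRel.mul _ _ _ h ?_)
  subst h
  simpa [AbsLE] using hl

@[elab_as_elim]
theorem cons_induction {motive : DualMonoid R c → Prop} (one : motive 1)
    (cons : ∀ p (hp : AbsLE R p c) m, motive m → motive (gen hp * m)) (m : DualMonoid R c) :
    motive m := by
  induction m using PresentedMonoid.inductionOn with | _ w
  induction w using FreeMonoid.inductionOn' with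
  | one => exact one
  | of_mul p w ih => exact cons p (mem_divisorSet_iff.1 p.2) _ ih

theorem lift_relation {M : Type*} [Monoid M] (f : divisorSet R c → M)
    (hmul : ∀ w w' v : divisorSet R c, (v : G) = w * w' → AbsLE R (w : G) v → f w * f w' = f v)
    (hone : ∀ e : divisorSet R c, (e : G) = 1 → f e = 1) :
    ∀ a b, DualRel R c a b → FreeMonoid.lift f a = FreeMonoid.lift f b := by
  rintro _ _ (⟨w, w', v, hv, hl⟩ | ⟨e, he⟩)
  · rw [map_mul]
    simp only [FreeMonoid.lift_eval_of]
    exact hmul _ _ _ hv (by rw [hv] at hl ⊢; simpa [AbsLE] using hl)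
  · rw [map_one]
    simp only [FreeMonoid.lift_eval_of]
    exact hone _ he

/-- The canonical map from the dual monoid to the group. -/
def val : DualMonoid R c →* G :=
  PresentedMonoid.lift Subtype.val
    (lift_relation _ (fun _ _ _ hv _ => hv.symm) fun _ he => he)

@[simp] theorem val_gen {p : G} (hp : AbsLE R p c) : val (gen hp) = p := rfl

/-- The degree on the dual monoid. -/
noncomputable def degHom : DualMonoid R c →* Multiplicative ℕ :=
  PresentedMonoid.lift (fun p : divisorSet R c => Multiplicative.ofAdd (reflLength R (p : G)))
    (lift_relation _ (fun w w' v hv hl => by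
      rw [hv] at hl ⊢
      simp only [AbsLE, inv_mul_cancel_left] at hl
      rw [← ofAdd_add, hl]) fun e he => by rw [he, reflLength_one]; rfl)

/-- The degree on the dual monoid, as a natural number. -/
noncomputable def deg (m : DualMonoid R c) : ℕ := Multiplicative.toAdd (degHom m)

@[simp] theorem deg_gen {p : G} (hp : AbsLE R p c) : deg (gen hp) = reflLength R p := rfl

@[simp] theorem deg_one : deg (1 : DualMonoid R c) = 0 := by simp [deg]

@[simp] theorem deg_mul (m m' : DualMonoid R c) : deg (m * m') = deg m + deg m' := by simp [deg]

section

variable (hR : IsReflectionSet R)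

include hR

/-- The degree adds the lengths of the factors, while in the group reflections may cancel. Equality
of the two characterizes generators among the elements whose value divides `c`. -/
theorem length_val_le (m : DualMonoid R c) : reflLength R (val m) ≤ deg m := by
  induction m using cons_induction with
  | one => simp [reflLength_one]
  | cons p hp m ih =>
    rw [map_mul, deg_mul, val_gen, deg_gen]
    exact (hR.length_mul_le _ _).trans (by omega)

theorem deg_eq_zero {m : DualMonoid R c} : deg m = 0 ↔ m = 1 := by
  refine ⟨fun h => ?_, fun h => by simp [h]⟩
  induction m using cons_induction with
  | one => rfl
  | cons p hp m ih =>
    rw [deg_mul, deg_gen] at h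
    have h1 : p = 1 := hR.length_eq_zero.1 (by omega)
    subst h1
    rw [ih (by omega), gen_one, mul_one]

/-- A word without loss of length whose value divides `c` is a generator. -/
theorem eq_gen_of_deg_le {m : DualMonoid R c} (h : AbsLE R (val m) c)
    (hl : deg m ≤ reflLength R (val m)) : m = gen h := by
  induction m using cons_induction with
  | one => exact (gen_one _).symm
  | cons p hp m ih =>
    simp only [map_mul, val_gen, deg_mul, deg_gen] at h hl
    have h1 := hR.length_mul_le p (val m)
    have h2 := length_val_le hR m
    have h3 : AbsLE R p (p * val m) := hR.absLE_of_mul (by omega)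
    have h4 : AbsLE R (val m) c := by
      have := hR.absLE_trans (hR.inv_mul_absLE h3) h
      rwa [inv_mul_cancel_left] at this
    conv_lhs => rw [ih h4 (by omega)]
    exact gen_mul_gen _ _ _ (by simp) (by simpa using h3)

/-- The length of `p` is at most the sum of the lengths of the two values, hence at most the sum of
the two degrees, which is again the length of `p`. So neither factor loses length, and both are
generators. -/
theorem gen_of_mul_eq_gen {m m' : DualMonoid R c} {p : G} {hp : AbsLE R p c}
    (h : m * m' = gen hp) : ∃ hm : AbsLE R (val m) c, m = gen hm ∧ AbsLE R (val m) p := by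
  have hv : val m * val m' = p := by rw [← map_mul, h, val_gen]
  have hd : deg m + deg m' = reflLength R p := by rw [← deg_mul, h, deg_gen]
  have h1 := hR.length_mul_le (val m) (val m')
  have h2 := length_val_le hR m
  have h3 := length_val_le hR m'
  rw [hv] at h1
  have h4 : AbsLE R (val m) p := by
    rw [← hv]
    exact hR.absLE_of_mul (by rw [hv]; omega)
  have h5 := hR.absLE_trans h4 hp
  exact ⟨h5, eq_gen_of_deg_le hR h5 (by omega), h4⟩

theorem gen_of_mul_eq_gen' {m m' : DualMonoid R c} {p : G} {hp : AbsLE R p c}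
    (h : m * m' = gen hp) : ∃ hm : AbsLE R (val m') c, m' = gen hm ∧ AbsLE R (val m') p := by
  have hv : val m * val m' = p := by rw [← map_mul, h, val_gen]
  have hd : deg m + deg m' = reflLength R p := by rw [← deg_mul, h, deg_gen]
  have h1 := hR.length_mul_le (val m) (val m')
  have h2 := length_val_le hR m
  have h3 := length_val_le hR m'
  have h4 : AbsLE R (val m) p := by
    rw [← hv]
    exact hR.absLE_of_mul (by rw [hv] at h1 ⊢; omega)
  have h5 : AbsLE R (val m') p := by
    have := hR.inv_mul_absLE h4
    rwa [← hv, inv_mul_cancel_left, hv] at this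
  have h6 := hR.absLE_trans h5 hp
  rw [hv] at h1
  exact ⟨h6, eq_gen_of_deg_le hR h6 (by omega), h5⟩

theorem leftDivides_gen_iff {p q : G} (hp : AbsLE R p c) (hq : AbsLE R q c) :
    LeftDivides (gen hp) (gen hq) ↔ AbsLE R p q := by
  constructor
  · rintro ⟨m, hm⟩
    obtain ⟨_, -, h⟩ := gen_of_mul_eq_gen hR hm.symm
    exact h
  · intro h
    exact ⟨gen (hR.absLE_trans (hR.inv_mul_absLE h) hq),
      (gen_mul_gen _ _ _ (by simp) h).symm⟩

theorem leftDivides_delta_iff {m : DualMonoid R c} :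
    LeftDivides m (delta R c) ↔ ∃ p, ∃ hp : AbsLE R p c, m = gen hp := by
  constructor
  · rintro ⟨m', h⟩
    obtain ⟨h, e, -⟩ := gen_of_mul_eq_gen hR (h.symm.trans delta_eq_gen)
    exact ⟨_, h, e⟩
  · rintro ⟨p, hp, rfl⟩
    rw [delta_eq_gen, leftDivides_gen_iff hR]
    exact hp

theorem rightDivides_delta_iff {m : DualMonoid R c} :
    RightDivides m (delta R c) ↔ ∃ p, ∃ hp : AbsLE R p c, m = gen hp := by
  constructor
  · rintro ⟨m', h⟩
    obtain ⟨h, e, -⟩ := gen_of_mul_eq_gen' hR (h.symm.trans delta_eq_gen)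
    exact ⟨_, h, e⟩
  · rintro ⟨p, hp, rfl⟩
    have h := hR.mul_inv_absLE hp
    refine ⟨gen h, (gen_mul_gen h hp (absLE_refl R c) (by group) h).symm⟩

theorem length_le_deg (l : List (DualMonoid R c)) (hl : ∀ x ∈ l, x ≠ 1) :
    l.length ≤ deg l.prod := by
  induction l with
  | nil => simp
  | cons x l ih =>
    rw [List.prod_cons, deg_mul, List.length_cons]
    have h1 := ih fun y hy => hl y (List.mem_cons_of_mem _ hy)
    have h2 : deg x ≠ 0 := fun h => hl x List.mem_cons_self ((deg_eq_zero hR).1 h)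
    omega

theorem leftDivides_antisymm {a b : DualMonoid R c} (h : LeftDivides a b)
    (h' : LeftDivides b a) : a = b := by
  obtain ⟨m, rfl⟩ := h
  obtain ⟨m', h'⟩ := h'
  have : deg a = deg a + deg m + deg m' := by rw [← deg_mul, ← deg_mul, ← h']
  rw [(deg_eq_zero hR (m := m)).1 (by omega), mul_one]

end

theorem leftDivides_trans {M : Type*} [Monoid M] {a b d : M} (h : LeftDivides a b)
    (h' : LeftDivides b d) : LeftDivides a d := by
  obtain ⟨m, rfl⟩ := h
  obtain ⟨m', rfl⟩ := h'
  exact ⟨m * m', by rw [mul_assoc]⟩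

theorem leftDivides_refl {M : Type*} [Monoid M] (a : M) : LeftDivides a a := ⟨1, by simp⟩

theorem one_leftDivides {M : Type*} [Monoid M] (a : M) : LeftDivides 1 a := ⟨a, by simp⟩

theorem leftDivides_mul {M : Type*} [Monoid M] (a b : M) : LeftDivides a (a * b) := ⟨b, rfl⟩

theorem leftDivides_mul_mul {M : Type*} [Monoid M] (a : M) {b d : M} (h : LeftDivides b d) :
    LeftDivides (a * b) (a * d) := by
  obtain ⟨m, rfl⟩ := h
  exact ⟨m, by rw [mul_assoc]⟩

theorem closure_leftDivides_delta (hR : IsReflectionSet R) :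
    Submonoid.closure {x : DualMonoid R c | LeftDivides x (delta R c)} = ⊤ := by
  rw [Submonoid.eq_top_iff']
  intro m
  induction m using cons_induction with
  | one => exact Submonoid.one_mem _
  | cons p hp m ih =>
    exact Submonoid.mul_mem _
      (Submonoid.subset_closure ((leftDivides_delta_iff hR).2 ⟨p, hp, rfl⟩)) ih

end DualMonoid

/-! ### The Garside structure attached to a lattice of divisors -/

/-- The divisors of `c` form a lattice. -/
structure IsDivisorLattice {G : Type*} [Group G] (R : Set G) (c : G) : Prop where
  inf : ∀ p q, AbsLE R p c → AbsLE R q c →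
    ∃ i, AbsLE R i p ∧ AbsLE R i q ∧ ∀ t, AbsLE R t p → AbsLE R t q → AbsLE R t i
  sup : ∀ p q, AbsLE R p c → AbsLE R q c →
    ∃ s, AbsLE R s c ∧ AbsLE R p s ∧ AbsLE R q s ∧
      ∀ t, AbsLE R t c → AbsLE R p t → AbsLE R q t → AbsLE R s t

namespace DualMonoid

variable {G : Type*} [Group G] {R : Set G} {c : G}

/-! ### Greedy normal form and left cancellation. -/

section Head

variable (hR : IsReflectionSet R) (hL : IsDivisorLattice R c)

/-- The meet of two divisors of `c`. -/
noncomputable def meet (p q : divisorSet R c) : divisorSet R c :=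
  ⟨(hL.inf p q (mem_divisorSet_iff.1 p.2) (mem_divisorSet_iff.1 q.2)).choose,
    mem_divisorSet_iff.2 (hR.absLE_trans
      (hL.inf p q (mem_divisorSet_iff.1 p.2) (mem_divisorSet_iff.1 q.2)).choose_spec.1
      (mem_divisorSet_iff.1 p.2))⟩

theorem meet_left (p q : divisorSet R c) : AbsLE R (meet hR hL p q : G) p :=
  (hL.inf p q (mem_divisorSet_iff.1 p.2) (mem_divisorSet_iff.1 q.2)).choose_spec.1

theorem meet_right (p q : divisorSet R c) : AbsLE R (meet hR hL p q : G) q :=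
  (hL.inf p q (mem_divisorSet_iff.1 p.2) (mem_divisorSet_iff.1 q.2)).choose_spec.2.1

theorem le_meet {t : G} {p q : divisorSet R c} (h : AbsLE R t p) (h' : AbsLE R t q) :
    AbsLE R t (meet hR hL p q : G) :=
  (hL.inf p q (mem_divisorSet_iff.1 p.2) (mem_divisorSet_iff.1 q.2)).choose_spec.2.2 t h h'

include hR in
/-- The complement `p⁻¹ c` of a divisor of `c`. -/
theorem compl_mem (p : divisorSet R c) : (p : G)⁻¹ * c ∈ divisorSet R c :=
  mem_divisorSet_iff.2 (hR.inv_mul_absLE (mem_divisorSet_iff.1 p.2))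

/-- The largest divisor `t` of `h` such that `p t` is a divisor of `c`. -/
noncomputable def carry (p h : divisorSet R c) : divisorSet R c :=
  meet hR hL ⟨(p : G)⁻¹ * c, compl_mem hR p⟩ h

theorem carry_compl (p h : divisorSet R c) :
    AbsLE R (carry hR hL p h : G) ((p : G)⁻¹ * c) := meet_left hR hL _ _

theorem carry_le (p h : divisorSet R c) : AbsLE R (carry hR hL p h : G) h := meet_right hR hL _ _

theorem le_carry {t : G} {p h : divisorSet R c} (h1 : AbsLE R t ((p : G)⁻¹ * c))
    (h2 : AbsLE R t h) : AbsLE R t (carry hR hL p h : G) := le_meet hR hL h1 h2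

theorem head_mem (p h : divisorSet R c) : AbsLE R ((p : G) * carry hR hL p h) c :=
  hR.mul_absLE (mem_divisorSet_iff.1 p.2) (carry_compl hR hL p h)

theorem rest_mem (p h : divisorSet R c) : AbsLE R ((carry hR hL p h : G)⁻¹ * h) c :=
  hR.absLE_trans (hR.inv_mul_absLE (carry_le hR hL p h)) (mem_divisorSet_iff.1 h.2)

/-- Left multiplication by a divisor of `c` on pairs (head, tail). -/
noncomputable def step (p : divisorSet R c) :
    Function.End (divisorSet R c × DualMonoid R c) := fun x =>
  (⟨(p : G) * carry hR hL p x.1, mem_divisorSet_iff.2 (head_mem hR hL p x.1)⟩,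
    gen (rest_mem hR hL p x.1) * x.2)

/-- The cocycle identity behind the action: once `q` has absorbed what it can of `h`, what `p`
absorbs is `q` together with what `p q` would absorb from `h` directly. Both inequalities use that
left multiplication by `q` is an isomorphism onto an interval starting at `q`. -/
theorem carry_carry {p q v : divisorSet R c} (hv : (v : G) = p * q) (hpv : AbsLE R (p : G) v)
    (h : divisorSet R c) (h' : divisorSet R c) (hh' : (h' : G) = q * carry hR hL q h) :
    (carry hR hL p h' : G) = q * carry hR hL v h := by
  have hpc := mem_divisorSet_iff.1 p.2
  have hqc := mem_divisorSet_iff.1 q.2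
  have hvc := mem_divisorSet_iff.1 v.2
  have hq : AbsLE R (q : G) ((p : G)⁻¹ * c) := by
    have := hR.absLE_inv_mul hpv hvc
    rwa [hv, inv_mul_cancel_left] at this
  have hqpc : (q : G)⁻¹ * ((p : G)⁻¹ * c) = (v : G)⁻¹ * c := by rw [hv]; group
  have hz : AbsLE R (carry hR hL v h : G) ((q : G)⁻¹ * ((p : G)⁻¹ * c)) := by
    rw [hqpc]; exact carry_compl hR hL v h
  have hpcc := mem_divisorSet_iff.1 (compl_mem hR p)
  have hz' : AbsLE R (carry hR hL v h : G) ((q : G)⁻¹ * c) :=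
    hR.absLE_trans hz (hR.absLE_inv_mul hq hpcc)
  apply hR.absLE_antisymm
  · have h1 : AbsLE R (q : G) (carry hR hL p h') := by
      refine le_carry hR hL hq ?_
      rw [hh']
      exact hR.absLE_mul_right hqc (carry_compl hR hL q h)
    have h2 : AbsLE R ((q : G)⁻¹ * carry hR hL p h') (carry hR hL v h : G) := by
      refine le_carry hR hL ?_ ?_
      · rw [← hqpc]
        exact hR.absLE_inv_mul h1 (carry_compl hR hL p h')
      · have h3 := hR.absLE_inv_mul h1 (carry_le hR hL p h')
        rw [hh', inv_mul_cancel_left] at h3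
        exact hR.absLE_trans h3 (carry_le hR hL q h)
    have := hR.mul_absLE_mul hqc hz' h2
    rwa [mul_inv_cancel_left] at this
  · refine le_carry hR hL (hR.mul_absLE hq hz) ?_
    rw [hh']
    exact hR.mul_absLE_mul hqc (carry_compl hR hL q h)
      (le_carry hR hL hz' (carry_le hR hL v h))

theorem step_mul (w w' v : divisorSet R c) (hv : (v : G) = w * w') (hl : AbsLE R (w : G) v) :
    step hR hL w * step hR hL w' = step hR hL v := by
  funext x
  obtain ⟨h, τ⟩ := x
  let h' : divisorSet R c :=
    ⟨(w' : G) * carry hR hL w' h, mem_divisorSet_iff.2 (head_mem hR hL w' h)⟩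
  have key := carry_carry hR hL hv hl h h' rfl
  refine Prod.ext (Subtype.ext ?_) ?_
  · change (w : G) * carry hR hL w h' = v * carry hR hL v h
    rw [key, hv, mul_assoc]
  · change gen (rest_mem hR hL w h') * (gen (rest_mem hR hL w' h) * τ) =
      gen (rest_mem hR hL v h) * τ
    rw [← mul_assoc]
    congr 1
    -- The two leftovers recombine: the part of `h` between `carry v h` and `carry w' h`, followed
    -- by the part beyond `carry w' h`.
    have e1 : (carry hR hL w h' : G)⁻¹ * h' = (carry hR hL v h : G)⁻¹ * carry hR hL w' h := by
      rw [key]; simp only [h']; group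
    have h1 : AbsLE R (carry hR hL v h : G) (carry hR hL w' h) := by
      have h2 := hR.absLE_inv_mul (p := (w' : G)) (q := carry hR hL w h') (c := h') ?_
        (carry_le hR hL w h')
      · rw [key, inv_mul_cancel_left] at h2
        simpa only [h', inv_mul_cancel_left] using h2
      · refine le_carry hR hL ?_ ?_
        · have := hR.absLE_inv_mul hl (mem_divisorSet_iff.1 v.2)
          rwa [hv, inv_mul_cancel_left] at this
        · exact hR.absLE_mul_right (mem_divisorSet_iff.1 w'.2) (carry_compl hR hL w' h)
    refine gen_mul_gen _ _ _ ?_ ?_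
    · rw [e1]; group
    · rw [e1]
      exact hR.absLE_inv_mul h1 (carry_le hR hL w' h) |> fun h3 => h3

theorem step_one (e : divisorSet R c) (he : (e : G) = 1) : step hR hL e = 1 := by
  funext x
  obtain ⟨h, τ⟩ := x
  have key : (carry hR hL e h : G) = h := by
    refine hR.absLE_antisymm (carry_le hR hL e h) (le_carry hR hL ?_ (absLE_refl R _))
    rw [he]
    simpa using mem_divisorSet_iff.1 h.2
  refine Prod.ext (Subtype.ext ?_) ?_
  · change (e : G) * carry hR hL e h = h
    rw [key, he, one_mul]
  · change gen (rest_mem hR hL e h) * τ = τ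
    rw [gen_congr _ (one_absLE R c) (by rw [key]; group), gen_one, one_mul]

/-- The action of the dual monoid on pairs (head, tail). -/
noncomputable def act : DualMonoid R c →* Function.End (divisorSet R c × DualMonoid R c) :=
  PresentedMonoid.lift (step hR hL) (lift_relation _ (step_mul hR hL) (step_one hR hL))

/-- The pair consisting of the largest generator dividing `m` on the left, and of the
quotient. -/
noncomputable def headTail (m : DualMonoid R c) : divisorSet R c × DualMonoid R c :=
  act hR hL m (⟨1, mem_divisorSet_iff.2 (one_absLE R c)⟩, 1)

/-- The largest generator dividing `m` on the left. -/
noncomputable def head (m : DualMonoid R c) : divisorSet R c := (headTail hR hL m).1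

/-- The quotient of `m` by its head. -/
noncomputable def tail (m : DualMonoid R c) : DualMonoid R c := (headTail hR hL m).2

theorem head_le (m : DualMonoid R c) : AbsLE R (head hR hL m : G) c :=
  mem_divisorSet_iff.1 (head hR hL m).2

theorem headTail_gen_mul {p : G} (hp : AbsLE R p c) (m : DualMonoid R c) :
    headTail hR hL (gen hp * m) =
      step hR hL ⟨p, mem_divisorSet_iff.2 hp⟩ (headTail hR hL m) := by
  unfold headTail
  rw [map_mul]
  rfl

theorem head_gen_mul {p : G} (hp : AbsLE R p c) (m : DualMonoid R c) :
    (head hR hL (gen hp * m) : G) =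
      p * carry hR hL ⟨p, mem_divisorSet_iff.2 hp⟩ (head hR hL m) := by
  rw [head, headTail_gen_mul]
  rfl

theorem tail_gen_mul {p : G} (hp : AbsLE R p c) (m : DualMonoid R c) :
    tail hR hL (gen hp * m) =
      gen (rest_mem hR hL ⟨p, mem_divisorSet_iff.2 hp⟩ (head hR hL m)) * tail hR hL m := by
  rw [tail, headTail_gen_mul]
  rfl

theorem head_mul_tail (m : DualMonoid R c) : gen (head_le hR hL m) * tail hR hL m = m := by
  induction m using cons_induction with
  | one =>
    have h1 : headTail hR hL 1 = (⟨1, mem_divisorSet_iff.2 (one_absLE R c)⟩, 1) := by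
      unfold headTail; rw [map_one]; rfl
    have h2 : (head hR hL 1 : G) = 1 := by rw [head, h1]
    have h3 : tail hR hL 1 = 1 := by rw [tail, h1]
    rw [h3, mul_one, gen_congr _ (one_absLE R c) h2, gen_one]
  | cons p hp m ih =>
    conv_rhs => rw [← ih]
    let P : divisorSet R c := ⟨p, mem_divisorSet_iff.2 hp⟩
    let h := head hR hL m
    have hc : AbsLE R (carry hR hL P h : G) c :=
      mem_divisorSet_iff.1 (carry hR hL P h).2
    rw [tail_gen_mul, gen_congr _ (head_mem hR hL P h) (head_gen_mul hR hL hp m),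
      ← gen_mul_gen hp hc (head_mem hR hL P h) rfl
        (hR.absLE_mul_right hp (carry_compl hR hL P h)), mul_assoc, ← mul_assoc (gen hc),
      gen_mul_gen hc _ (head_le hR hL m) (by simp [P, h]) (carry_le hR hL P h)]

/-- The formula `head_gen_mul` exhibits `p` as a prefix of the head of any product beginning with
`p`. Since the head is defined through the action, it does not depend on how the element is written.
-/
theorem leftDivides_iff_le_head {p : G} (hp : AbsLE R p c) (m : DualMonoid R c) :
    LeftDivides (gen hp) m ↔ AbsLE R p (head hR hL m) := by
  constructor
  · rintro ⟨m', rfl⟩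
    rw [head_gen_mul]
    exact hR.absLE_mul_right hp (carry_compl hR hL ⟨p, _⟩ _)
  · intro h
    refine leftDivides_trans ((leftDivides_gen_iff hR hp (head_le hR hL m)).2 h) ?_
    exact ⟨tail hR hL m, (head_mul_tail hR hL m).symm⟩

-- The product `gen hp * x` determines `x`: its head is `p` times the part of the head of `x` that
-- `p` absorbs, and `x` is that part times the tail of the product.
include hR hL in
theorem gen_mul_cancel {p : G} (hp : AbsLE R p c) {x y : DualMonoid R c}
    (h : gen hp * x = gen hp * y) : x = y := by
  let P : divisorSet R c := ⟨p, mem_divisorSet_iff.2 hp⟩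
  have hc : ∀ z : DualMonoid R c, AbsLE R (carry hR hL P (head hR hL z) : G) c := fun z =>
    mem_divisorSet_iff.1 (carry hR hL P (head hR hL z)).2
  have key : ∀ z, z = gen (hc z) * tail hR hL (gen hp * z) := fun z => by
    rw [tail_gen_mul, ← mul_assoc, gen_mul_gen (hc z) _ (head_le hR hL z) (by simp [P])
      (carry_le hR hL P _), head_mul_tail]
  have h1 : (carry hR hL P (head hR hL x) : G) = carry hR hL P (head hR hL y) := by
    have h2 := head_gen_mul hR hL hp x
    rw [h, head_gen_mul hR hL hp y] at h2
    exact (mul_left_cancel h2).symm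
  rw [key x, key y, h, gen_congr (hc x) (hc y) h1]

include hR hL in
theorem mul_left_cancel_of_lattice (a x y : DualMonoid R c) (h : a * x = a * y) : x = y := by
  induction a using cons_induction with
  | one => simpa using h
  | cons p hp m ih =>
    rw [mul_assoc, mul_assoc] at h
    exact ih (gen_mul_cancel hR hL hp h)

end Head

/-! ### Propagation of least common multiples from generators to all elements. -/

/-- `s` is a least common multiple of `x` and `y`, for left divisibility. -/
def IsLcm {M : Type*} [Monoid M] (x y s : M) : Prop :=
  LeftDivides x s ∧ LeftDivides y s ∧ ∀ t, LeftDivides x t → LeftDivides y t → LeftDivides s t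

section Lcm

variable (hR : IsReflectionSet R) (hL : IsDivisorLattice R c)

include hR hL

theorem leftDivides_of_mul_left {a x y : DualMonoid R c} (h : LeftDivides (a * x) (a * y)) :
    LeftDivides x y := by
  obtain ⟨m, hm⟩ := h
  exact ⟨m, mul_left_cancel_of_lattice hR hL a _ _ (by rw [hm, mul_assoc])⟩

theorem isLcm_mul {x y s : DualMonoid R c} (a : DualMonoid R c) (h : IsLcm x y s) :
    IsLcm (a * x) (a * y) (a * s) := by
  refine ⟨leftDivides_mul_mul a h.1, leftDivides_mul_mul a h.2.1, ?_⟩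
  rintro t h1 h2
  obtain ⟨t, rfl⟩ : LeftDivides a t := leftDivides_trans (leftDivides_mul a x) h1
  exact leftDivides_mul_mul a (h.2.2 t (leftDivides_of_mul_left hR hL h1)
    (leftDivides_of_mul_left hR hL h2))

theorem exists_isLcm_gen {p q : G} (hp : AbsLE R p c) (hq : AbsLE R q c) :
    ∃ j : DualMonoid R c, IsLcm (gen hp) (gen hq) j := by
  obtain ⟨s, hs, h1, h2, h3⟩ := hL.sup p q hp hq
  refine ⟨gen hs, (leftDivides_gen_iff hR hp hs).2 h1, (leftDivides_gen_iff hR hq hs).2 h2, ?_⟩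
  intro t ht1 ht2
  rw [leftDivides_iff_le_head hR hL] at *
  exact h3 _ (head_le hR hL t) ht1 ht2

/-- Positivity of the degree of the factor is what makes inductions on the degree progress. The head
is such a factor: if it were trivial, no nontrivial generator would divide `m`. -/
theorem exists_gen_mul {m : DualMonoid R c} (hm : m ≠ 1) :
    ∃ p, ∃ hp : AbsLE R p c, ∃ m', m = gen hp * m' ∧ 0 < deg (gen hp) := by
  have h := head_mul_tail hR hL m
  refine ⟨_, head_le hR hL m, tail hR hL m, h.symm, Nat.pos_of_ne_zero fun h0 => hm ?_⟩
  have h1 : (head hR hL m : G) = 1 := hR.length_eq_zero.1 h0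
  have h2 : ¬ ∃ (p : G) (hp : AbsLE R p c), p ≠ 1 ∧ LeftDivides (gen hp) m := by
    rintro ⟨p, hp, hp1, hd⟩
    rw [leftDivides_iff_le_head hR hL, h1] at hd
    exact hp1 (hR.absLE_antisymm hd (one_absLE R p))
  clear h h0
  induction m using cons_induction with
  | one => rfl
  | cons p hp m ih =>
    by_cases hp1 : p = 1
    · subst hp1
      rw [gen_one, one_mul] at h1 h2 hm ⊢
      exact ih hm h1 h2
    · exact absurd ⟨p, hp, hp1, leftDivides_mul _ _⟩ h2

/-- A tiling argument. With `j` the lcm of the first letters `p` and `q`, form the lcm `u` of `x`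
and `j`, then the lcm `v` of `y` and `j`, then the lcm of `u` and `v`. Each of the three pairs
shares a nontrivial left factor (`p`, `q` and `j`); once it is cancelled, the common multiple `z`
has smaller degree. -/
theorem exists_isLcm_of_common_multiple (N : ℕ) : ∀ x y z : DualMonoid R c, deg z ≤ N →
    LeftDivides x z → LeftDivides y z → ∃ s, IsLcm x y s := by
  induction N with
  | zero =>
    intro x y z hz hx hy
    have : z = 1 := (deg_eq_zero hR).1 (by omega)
    subst this
    obtain rfl := leftDivides_antisymm hR hx (one_leftDivides x)
    obtain rfl := leftDivides_antisymm hR hy (one_leftDivides y)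
    exact ⟨1, leftDivides_refl 1, leftDivides_refl 1, fun t h _ => h⟩
  | succ N ih =>
    intro x y z hz hx hy
    by_cases hx1 : x = 1
    · subst hx1
      exact ⟨y, one_leftDivides y, leftDivides_refl y, fun t _ h => h⟩
    by_cases hy1 : y = 1
    · subst hy1
      exact ⟨x, leftDivides_refl x, one_leftDivides x, fun t h _ => h⟩
    obtain ⟨p, hp, x1, rfl, hpd⟩ := exists_gen_mul hR hL hx1
    obtain ⟨q, hq, y1, rfl, hqd⟩ := exists_gen_mul hR hL hy1
    obtain ⟨j, hj1, hj2, hj⟩ := exists_isLcm_gen hR hL hp hq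
    have hpz := leftDivides_trans (leftDivides_mul _ _) hx
    have hqz := leftDivides_trans (leftDivides_mul _ _) hy
    have hjz := hj z hpz hqz
    have aux : ∀ a b d : DualMonoid R c, 0 < deg a → LeftDivides (a * b) z →
        LeftDivides (a * d) z → ∃ s, IsLcm (a * b) (a * d) (a * s) := by
      intro a b d ha hb hd
      obtain ⟨z1, rfl⟩ : LeftDivides a z := leftDivides_trans (leftDivides_mul a b) hb
      rw [deg_mul] at hz
      obtain ⟨s, hs⟩ := ih b d z1 (by omega) (leftDivides_of_mul_left hR hL hb)
        (leftDivides_of_mul_left hR hL hd)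
      exact ⟨s, isLcm_mul hR hL a hs⟩
    obtain ⟨jp, rfl⟩ := hj1
    obtain ⟨u, hu1, hu2, hu⟩ := aux _ x1 jp hpd hx hjz
    obtain ⟨jq, hjq⟩ := hj2
    obtain ⟨v, hv1, hv2, hv⟩ := aux _ y1 jq hqd hy (hjq ▸ hjz)
    rw [← hjq] at hv2 hv
    have huz := hu z hx hjz
    have hvz := hv z hy hjz
    obtain ⟨u', hu'⟩ := hu2
    obtain ⟨v', hv'⟩ := hv2
    obtain ⟨s, hs1, hs2, hs⟩ := aux _ u' v' (by rw [deg_mul]; omega) (hu' ▸ huz) (hv' ▸ hvz)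
    rw [← hu'] at hs1 hs
    rw [← hv'] at hs2 hs
    refine ⟨_, leftDivides_trans hu1 hs1, leftDivides_trans hv1 hs2, fun t hx hy => ?_⟩
    have hjt := hj t (leftDivides_trans (leftDivides_mul _ _) hx)
      (leftDivides_trans (leftDivides_mul _ _) hy)
    exact hs t (hu t hx hjt) (hv t hy hjt)

end Lcm

/-! ### Powers of the Garside element as common multiples. -/

section Delta

variable (hR : IsReflectionSet R)

include hR

/-- Put `p' = p⁻¹ c` and `p'' = p'⁻¹ c`. Then `c` factors without loss of length both as `p p'` and
as `p' p''`, and the product `p p' p''` can be bracketed either way. -/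
theorem gen_mul_delta {p : G} (hp : AbsLE R p c) :
    ∃ q, ∃ hq : AbsLE R q c, gen hp * delta R c = delta R c * gen hq := by
  have h1 := hR.inv_mul_absLE hp
  have h2 := hR.inv_mul_absLE h1
  refine ⟨_, h2, ?_⟩
  rw [delta_eq_gen, ← gen_mul_gen hp h1 (absLE_refl R c) (by group) hp, mul_assoc,
    gen_mul_gen h1 h2 (absLE_refl R c) (by group) h1,
    gen_mul_gen hp h1 (absLE_refl R c) (by group) hp]

theorem gen_mul_delta_pow {p : G} (hp : AbsLE R p c) (k : ℕ) :
    ∃ q, ∃ hq : AbsLE R q c, gen hp * delta R c ^ k = delta R c ^ k * gen hq := by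
  induction k with
  | zero => exact ⟨p, hp, by simp⟩
  | succ k ih =>
    obtain ⟨q, hq, h⟩ := ih
    obtain ⟨q', hq', h'⟩ := gen_mul_delta hR hq
    exact ⟨q', hq', by rw [pow_succ, ← mul_assoc, h, mul_assoc, h', mul_assoc]⟩

/-- A further letter on the left can be pushed to the right across a power of `delta`, where one
more `delta` absorbs it. The bound holds for all larger exponents so that two elements can share
one. -/
theorem exists_leftDivides_delta_pow (m : DualMonoid R c) :
    ∃ k : ℕ, ∀ k', k ≤ k' → LeftDivides m (delta R c ^ k') := by
  induction m using cons_induction with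
  | one => exact ⟨0, fun _ _ => one_leftDivides _⟩
  | cons p hp m ih =>
    obtain ⟨k, hk⟩ := ih
    refine ⟨k + 1, fun k' hk' => ?_⟩
    obtain ⟨k', rfl⟩ : ∃ l, k' = l + 1 := ⟨k' - 1, by omega⟩
    refine leftDivides_trans (leftDivides_mul_mul _ (hk k' (by omega))) ?_
    obtain ⟨q, hq, h⟩ := gen_mul_delta_pow hR hp k'
    rw [h, pow_succ]
    exact leftDivides_mul_mul _ ((leftDivides_delta_iff hR).2 ⟨q, hq, rfl⟩)

theorem isLatticeOrder_leftDivides (hL : IsDivisorLattice R c) :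
    IsLatticeOrder (LeftDivides : DualMonoid R c → DualMonoid R c → Prop) := by
  have hsup : ∀ a b : DualMonoid R c, ∃ s, IsLcm a b s := by
    intro a b
    obtain ⟨k, hk⟩ := exists_leftDivides_delta_pow hR a
    obtain ⟨k', hk'⟩ := exists_leftDivides_delta_pow hR b
    exact exists_isLcm_of_common_multiple hR hL _ a b _ le_rfl
      (hk (max k k') (le_max_left _ _)) (hk' (max k k') (le_max_right _ _))
  refine ⟨leftDivides_refl, fun _ _ _ => leftDivides_trans,
    fun _ _ => leftDivides_antisymm hR, hsup, fun a b => ?_⟩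
  have hbdd : ∀ d, LeftDivides d a → deg d ≤ deg a := by
    rintro d ⟨m, rfl⟩
    simp
  -- The greatest lower bound is a common divisor of greatest degree: its lcm with another common
  -- divisor is still a common divisor, hence of no larger degree.
  let S : Set ℕ := {k | ∃ d : DualMonoid R c, LeftDivides d a ∧ LeftDivides d b ∧ deg d = k}
  have hS : S.Nonempty := ⟨0, 1, one_leftDivides a, one_leftDivides b, deg_one⟩
  have hSb : BddAbove S := ⟨deg a, by rintro _ ⟨d, h, -, rfl⟩; exact hbdd d h⟩
  obtain ⟨d, hda, hdb, hd⟩ := Nat.sSup_mem hS hSb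
  refine ⟨d, hda, hdb, fun t hta htb => ?_⟩
  obtain ⟨s, ⟨m, rfl⟩, hs2, hs⟩ := hsup d t
  have := le_csSup hSb ⟨d * m, hs a hda hta, hs b hdb htb, rfl⟩
  rw [deg_mul, hd] at this
  rwa [(deg_eq_zero hR (m := m)).1 (by omega), mul_one] at hs2

end Delta

end DualMonoid

/-! ### Symmetries of dual monoids -/

theorem IsLatticeOrder.of_equiv {α β : Type*} {r : α → α → Prop} {s : β → β → Prop}
    (h : IsLatticeOrder r) (e : α ≃ β) (he : ∀ a b, r a b ↔ s (e a) (e b)) :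
    IsLatticeOrder s := by
  have he' : ∀ a b, s a b ↔ r (e.symm a) (e.symm b) := fun a b => by
    rw [he, e.apply_symm_apply, e.apply_symm_apply]
  constructor
  · intro a
    rw [he']
    exact h.refl _
  · intro a b c
    simp only [he']
    exact h.trans _ _ _
  · intro a b h1 h2
    rw [he'] at h1 h2
    exact e.symm.injective (h.antisymm _ _ h1 h2)
  · intro a b
    obtain ⟨x, h1, h2, h3⟩ := h.sup (e.symm a) (e.symm b)
    refine ⟨e x, ?_, ?_, fun t => ?_⟩ <;> simp only [he', e.symm_apply_apply]
    exacts [h1, h2, h3 _]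
  · intro a b
    obtain ⟨x, h1, h2, h3⟩ := h.inf (e.symm a) (e.symm b)
    refine ⟨e x, ?_, ?_, fun t => ?_⟩ <;> simp only [he', e.symm_apply_apply]
    exacts [h1, h2, h3 _]

theorem LeftDivides.map_iff {M N : Type*} [Monoid M] [Monoid N] (e : M ≃* N) (a b : M) :
    LeftDivides a b ↔ LeftDivides (e a) (e b) := by
  constructor
  · rintro ⟨m, rfl⟩
    exact ⟨e m, map_mul e a m⟩
  · rintro ⟨m, h⟩
    exact ⟨e.symm m, e.injective (by rw [h, map_mul, e.apply_symm_apply])⟩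

theorem RightDivides.map_iff {M N : Type*} [Monoid M] [Monoid N] (e : M ≃* N) (a b : M) :
    RightDivides a b ↔ RightDivides (e a) (e b) := by
  constructor
  · rintro ⟨m, rfl⟩
    exact ⟨e m, map_mul e m a⟩
  · rintro ⟨m, h⟩
    exact ⟨e.symm m, e.injective (by rw [h, map_mul, e.apply_symm_apply])⟩

theorem IsQuasiGarside.of_mulEquiv {M N : Type*} [Monoid M] [Monoid N] {Δ : M}
    (h : IsQuasiGarside M Δ) (e : M ≃* N) : IsQuasiGarside N (e Δ) where
  bounded m := by
    obtain ⟨k, hk⟩ := h.bounded (e.symm m)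
    refine ⟨k, fun l hl hm => ?_⟩
    have := hk (l.map e.symm) ?_ (by rw [← map_list_prod, hm])
    · simpa using this
    · intro x hx
      obtain ⟨y, hy, rfl⟩ := List.mem_map.1 hx
      simpa using hl y hy
  cancel_left a x y hxy := e.symm.injective
    (h.cancel_left (e.symm a) _ _ (by rw [← map_mul, hxy, map_mul]))
  cancel_right a x y hxy := e.symm.injective
    (h.cancel_right (e.symm a) _ _ (by rw [← map_mul, hxy, map_mul]))
  lattice_left := h.lattice_left.of_equiv e.toEquiv (LeftDivides.map_iff e)
  lattice_right := h.lattice_right.of_equiv e.toEquiv (RightDivides.map_iff e)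
  divisors := by
    ext x
    have := Set.ext_iff.1 h.divisors (e.symm x)
    simpa [LeftDivides.map_iff e, RightDivides.map_iff e] using this
  generate := by
    have : {x : N | LeftDivides x (e Δ)} = e.toMonoidHom '' {x : M | LeftDivides x Δ} := by
      ext x
      constructor
      · intro hx
        exact ⟨e.symm x, (LeftDivides.map_iff e _ _).2 (by simpa using hx), by simp⟩
      · rintro ⟨y, hy, rfl⟩
        exact (LeftDivides.map_iff e _ _).1 hy
    rw [this, ← MonoidHom.map_mclosure, h.generate, ← MonoidHom.mrange_eq_map]
    exact MonoidHom.mrange_eq_top.2 e.surjective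

section Isomorphism

variable {G H : Type*} [Group G] [Group H] {R : Set G} {S : Set H}

theorem reflLength_map (e : G ≃* H) (he : ∀ r, r ∈ R ↔ e r ∈ S) (g : G) :
    reflLength S (e g) = reflLength R g := by
  unfold reflLength
  congr 1
  ext k
  constructor
  · rintro ⟨l, hl, hlS, hp⟩
    refine ⟨l.map e.symm, by simpa using hl, fun r hr => ?_, e.injective ?_⟩
    · obtain ⟨s, hs, rfl⟩ := List.mem_map.1 hr
      simpa [he] using hlS s hs
    · rw [← map_list_prod, hp, e.apply_symm_apply]
  · rintro ⟨l, hl, hlR, rfl⟩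
    refine ⟨l.map e, by simpa using hl, fun r hr => ?_, by rw [map_list_prod]⟩
    obtain ⟨s, hs, rfl⟩ := List.mem_map.1 hr
    exact (he s).1 (hlR s hs)

theorem absLE_map (e : G ≃* H) (he : ∀ r, r ∈ R ↔ e r ∈ S) {p q : G} (h : AbsLE R p q) :
    AbsLE S (e p) (e q) := by
  unfold AbsLE at *
  rw [← map_inv, ← map_mul, reflLength_map e he, reflLength_map e he, reflLength_map e he, h]

namespace DualMonoid

/-- The homomorphism of dual monoids attached to an isomorphism of groups. -/
def mapHom (e : G ≃* H) (he : ∀ r, r ∈ R ↔ e r ∈ S) {c : G} {d : H} (hd : e c = d) :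
    DualMonoid R c →* DualMonoid S d :=
  PresentedMonoid.lift
    (fun p : divisorSet R c => gen (p := e p) (hd ▸ absLE_map e he (mem_divisorSet_iff.1 p.2)))
    (lift_relation _
      (fun _ _ _ hv hl => gen_mul_gen _ _ _ (by rw [hv, map_mul]) (absLE_map e he hl))
      (fun p hp => by
        rw [gen_congr _ (one_absLE S d) (by rw [hp, map_one]), gen_one]))

theorem mapHom_gen (e : G ≃* H) (he : ∀ r, r ∈ R ↔ e r ∈ S) {c : G} {d : H} (hd : e c = d)
    {p : G} (hp : AbsLE R p c) :
    mapHom e he hd (gen hp) = gen (p := e p) (hd ▸ absLE_map e he hp) := rfl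

theorem mapHom_mapHom (e : G ≃* H) (he : ∀ r, r ∈ R ↔ e r ∈ S)
    (f : H ≃* G) (hf : ∀ s, s ∈ S ↔ f s ∈ R) (hfe : ∀ g, f (e g) = g) {c : G} {d : H}
    (hd : e c = d) (hc : f d = c) (m : DualMonoid R c) :
    mapHom f hf hc (mapHom e he hd m) = m := by
  induction m using cons_induction with
  | one => simp
  | cons p hp m ih =>
    rw [map_mul, map_mul, ih, mapHom_gen, mapHom_gen]
    congr 1
    exact gen_congr _ _ (hfe p)

/-- The isomorphism of dual monoids attached to an isomorphism of groups. -/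
def mapEquiv (e : G ≃* H) (he : ∀ r, r ∈ R ↔ e r ∈ S) {c : G} {d : H} (hd : e c = d) :
    DualMonoid R c ≃* DualMonoid S d :=
  have he' : ∀ s, s ∈ S ↔ e.symm s ∈ R := fun s => by rw [he, e.apply_symm_apply]
  have hc : e.symm d = c := by rw [← hd, e.symm_apply_apply]
  { toFun := mapHom e he hd
    invFun := mapHom e.symm he' hc
    left_inv := mapHom_mapHom e he e.symm he' e.symm_apply_apply hd hc
    right_inv := mapHom_mapHom e.symm he' e he e.apply_symm_apply hc hd
    map_mul' := map_mul _ }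

end DualMonoid

end Isomorphism

/-! ### Reversal: the anti-isomorphism between the dual monoids of `c` and `c⁻¹`. -/

namespace DualMonoid

open MulOpposite

variable {G : Type*} [Group G] {R : Set G} (hR : IsReflectionSet R) {c d : G}

-- The equation `d = c⁻¹` is carried as a hypothesis so that reversal can be applied twice without
-- transport along `c⁻¹⁻¹ = c`.
include hR in
theorem inv_absLE_of_eq (hd : d = c⁻¹) {p : G} (hp : AbsLE R p c) : AbsLE R p⁻¹ d :=
  hd ▸ hR.absLE_inv_inv.2 hp

/-- The anti-homomorphism from `M(P_c)` to `M(P_{c⁻¹})` induced by inversion. -/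
def revHom (hd : d = c⁻¹) : DualMonoid R c →* (DualMonoid R d)ᵐᵒᵖ :=
  PresentedMonoid.lift
    (fun p : divisorSet R c => op (gen (p := (p : G)⁻¹) (inv_absLE_of_eq hR hd (mem_divisorSet_iff.1 p.2))))
    (lift_relation _
      (fun w w' v hv hl => by
        rw [← op_mul, gen_mul_gen _ _ (inv_absLE_of_eq hR hd (mem_divisorSet_iff.1 v.2))
          (by rw [hv, mul_inv_rev])]
        rw [hR.absLE_inv_inv]
        have := hR.inv_mul_absLE hl
        rwa [hv, inv_mul_cancel_left, ← hv] at this)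
      (fun p hp => by
        rw [gen_congr _ (one_absLE R d) (by rw [hp, inv_one]), gen_one, op_one]))

/-- The anti-homomorphism from `M(P_c)` to `M(P_{c⁻¹})`, as a map. -/
def rev (hd : d = c⁻¹) (m : DualMonoid R c) : DualMonoid R d := unop (revHom hR hd m)

theorem rev_mul (hd : d = c⁻¹) (x y : DualMonoid R c) :
    rev hR hd (x * y) = rev hR hd y * rev hR hd x := by simp [rev]

theorem rev_gen (hd : d = c⁻¹) {p : G} (hp : AbsLE R p c) :
    rev hR hd (gen hp) = gen (inv_absLE_of_eq hR hd hp) := rfl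

theorem rev_rev (hd : d = c⁻¹) (hc : c = d⁻¹) (m : DualMonoid R c) :
    rev hR hc (rev hR hd m) = m := by
  induction m using cons_induction with
  | one => simp [rev]
  | cons p hp m ih =>
    rw [rev_mul, rev_mul, ih, rev_gen, rev_gen]
    congr 1
    exact gen_congr _ _ (inv_inv p)

/-- Reversal, as an equivalence. -/
def revEquiv (hd : d = c⁻¹) : DualMonoid R c ≃ DualMonoid R d where
  toFun := rev hR hd
  invFun := rev hR (by rw [hd, inv_inv])
  left_inv := rev_rev hR hd _
  right_inv := rev_rev hR _ hd

theorem leftDivides_iff_rev (hd : d = c⁻¹) (a b : DualMonoid R c) :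
    LeftDivides a b ↔ RightDivides (revEquiv hR hd a) (revEquiv hR hd b) := by
  constructor
  · rintro ⟨m, rfl⟩
    exact ⟨rev hR hd m, rev_mul hR hd a m⟩
  · rintro ⟨m, h⟩
    obtain ⟨m, rfl⟩ := (revEquiv hR hd).surjective m
    exact ⟨m, (revEquiv hR hd).injective (by rw [h]; exact (rev_mul hR hd a m).symm)⟩

theorem rightDivides_iff_rev (hd : d = c⁻¹) (a b : DualMonoid R c) :
    RightDivides a b ↔ LeftDivides (revEquiv hR hd a) (revEquiv hR hd b) := by
  rw [leftDivides_iff_rev hR (c := d) (d := c) (by rw [hd, inv_inv])]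
  change _ ↔ RightDivides ((revEquiv hR hd).symm _) ((revEquiv hR hd).symm _)
  rw [Equiv.symm_apply_apply, Equiv.symm_apply_apply]

include hR in
theorem lattice_leftDivides_inv
    (h : IsLatticeOrder (RightDivides : DualMonoid R c → DualMonoid R c → Prop)) :
    IsLatticeOrder (LeftDivides : DualMonoid R c⁻¹ → DualMonoid R c⁻¹ → Prop) :=
  h.of_equiv (revEquiv hR rfl) (rightDivides_iff_rev hR rfl)

end DualMonoid

theorem IsDivisorLattice.inv {G : Type*} [Group G] {R : Set G} (hR : IsReflectionSet R) {c : G}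
    (h : IsDivisorLattice R c) : IsDivisorLattice R c⁻¹ := by
  have e : ∀ p q : G, AbsLE R p q ↔ AbsLE R p⁻¹ q⁻¹ := fun _ _ => hR.absLE_inv_inv.symm
  constructor
  · intro p q hp hq
    rw [e, inv_inv] at hp hq
    obtain ⟨i, h1, h2, h3⟩ := h.inf _ _ hp hq
    refine ⟨i⁻¹, ?_, ?_, fun t => ?_⟩
    · rwa [e, inv_inv]
    · rwa [e, inv_inv]
    · rw [e, e t, e t, inv_inv]
      exact h3 _
  · intro p q hp hq
    rw [e, inv_inv] at hp hq
    obtain ⟨i, h1, h2, h2', h3⟩ := h.sup _ _ hp hq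
    refine ⟨i⁻¹, ?_, ?_, ?_, fun t => ?_⟩
    · rwa [e, inv_inv, inv_inv]
    · rwa [e, inv_inv]
    · rwa [e, inv_inv]
    · rw [e, e p, e q, e _ t, inv_inv, inv_inv]
      exact h3 _

/-- If the divisors of `c` form a lattice, then the dual monoid is quasi-Garside with Garside
element `c̲`. -/
theorem IsDivisorLattice.isQuasiGarside {G : Type*} [Group G] {R : Set G}
    (hR : IsReflectionSet R) {c : G} (h : IsDivisorLattice R c) :
    IsQuasiGarside (DualMonoid R c) (DualMonoid.delta R c) where
  bounded m := ⟨DualMonoid.deg m, fun l hl hm => hm ▸ DualMonoid.length_le_deg hR l hl⟩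
  cancel_left := DualMonoid.mul_left_cancel_of_lattice hR h
  cancel_right a x y hxy := by
    refine (DualMonoid.revEquiv hR rfl).injective
      (DualMonoid.mul_left_cancel_of_lattice hR (h.inv hR) (DualMonoid.rev hR rfl a) _ _ ?_)
    change DualMonoid.rev hR rfl a * DualMonoid.rev hR rfl x =
      DualMonoid.rev hR rfl a * DualMonoid.rev hR rfl y
    rw [← DualMonoid.rev_mul, hxy, DualMonoid.rev_mul]
  lattice_left := DualMonoid.isLatticeOrder_leftDivides hR h
  lattice_right := by
    refine (DualMonoid.isLatticeOrder_leftDivides hR (h.inv hR)).of_equiv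
      (DualMonoid.revEquiv hR rfl).symm fun a b => ?_
    rw [DualMonoid.rightDivides_iff_rev hR rfl, Equiv.apply_symm_apply, Equiv.apply_symm_apply]
  divisors := by
    ext m
    rw [Set.mem_ofPred_eq, Set.mem_ofPred_eq, DualMonoid.leftDivides_delta_iff hR,
      DualMonoid.rightDivides_delta_iff hR]
  generate := DualMonoid.closure_leftDivides_delta hR

/-! ### Affine transpositions -/

namespace AffineW

variable {n : ℕ}

theorem apply_add_mul (w : AffineW n) (x k : ℤ) : w.1 (x + k * n) = w.1 x + k * n :=
  w.2.1.add_mul x k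

theorem ext_apply {v w : AffineW n} (h : ∀ x, v.1 x = w.1 x) : v = w :=
  Subtype.ext (Equiv.ext h)

@[simp] theorem mul_apply (v w : AffineW n) (x : ℤ) : (v * w).1 x = v.1 (w.1 x) := rfl

@[simp] theorem inv_apply_self (w : AffineW n) (x : ℤ) : (w⁻¹).1 (w.1 x) = x :=
  Equiv.symm_apply_apply w.1 x

@[simp] theorem apply_inv_self (w : AffineW n) (x : ℤ) : w.1 ((w⁻¹).1 x) = x :=
  Equiv.apply_symm_apply w.1 x

theorem dvd_apply_sub_apply (w : AffineW n) (x y : ℤ) :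
    (n : ℤ) ∣ w.1 x - w.1 y ↔ (n : ℤ) ∣ x - y := by
  have key : ∀ (w : AffineW n) (x y : ℤ), (n : ℤ) ∣ x - y → (n : ℤ) ∣ w.1 x - w.1 y := by
    rintro w x y ⟨k, hk⟩
    obtain rfl : x = y + k * n := by linarith
    rw [apply_add_mul]
    exact ⟨k, by ring⟩
  refine ⟨fun h => ?_, key w x y⟩
  simpa using key w⁻¹ _ _ h

end AffineW

section Transp

variable {n : ℕ} {a b : ℤ}

theorem transp_left (h : ¬ (n : ℤ) ∣ b - a) (k : ℤ) :
    (affineTransp n a b h).1 (a + k * n) = b + k * n := by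
  change transpFun n a b _ = _
  rw [transpFun, if_pos ⟨k, by ring⟩]
  ring

theorem transp_right (h : ¬ (n : ℤ) ∣ b - a) (k : ℤ) :
    (affineTransp n a b h).1 (b + k * n) = a + k * n := by
  change transpFun n a b _ = _
  rw [transpFun, if_neg, if_pos ⟨k, by ring⟩]
  · ring
  · intro h'
    apply h
    have := dvd_sub h' (Dvd.intro_left k (rfl : k * (n : ℤ) = k * n))
    rwa [show b + k * n - a - k * n = b - a by ring] at this

theorem transp_left' (h : ¬ (n : ℤ) ∣ b - a) : (affineTransp n a b h).1 a = b := by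
  simpa using transp_left h 0

theorem transp_right' (h : ¬ (n : ℤ) ∣ b - a) : (affineTransp n a b h).1 b = a := by
  simpa using transp_right h 0

theorem transp_other (h : ¬ (n : ℤ) ∣ b - a) {x : ℤ} (ha : ¬ (n : ℤ) ∣ x - a)
    (hb : ¬ (n : ℤ) ∣ x - b) : (affineTransp n a b h).1 x = x := by
  change transpFun n a b _ = _
  rw [transpFun, if_neg ha, if_neg hb]

/-- Case distinction for the action of an affine transposition. -/
theorem transp_cases (h : ¬ (n : ℤ) ∣ b - a) (x : ℤ) :
    (∃ k : ℤ, x = a + k * n ∧ (affineTransp n a b h).1 x = b + k * n) ∨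
    (∃ k : ℤ, x = b + k * n ∧ (affineTransp n a b h).1 x = a + k * n) ∨
    (¬ (n : ℤ) ∣ x - a ∧ ¬ (n : ℤ) ∣ x - b ∧ (affineTransp n a b h).1 x = x) := by
  by_cases h1 : (n : ℤ) ∣ x - a
  · obtain ⟨k, hk⟩ := h1
    obtain rfl : x = a + k * n := by linarith
    exact Or.inl ⟨k, rfl, transp_left h k⟩
  by_cases h2 : (n : ℤ) ∣ x - b
  · obtain ⟨k, hk⟩ := h2
    obtain rfl : x = b + k * n := by linarith
    exact Or.inr (Or.inl ⟨k, rfl, transp_right h k⟩)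
  exact Or.inr (Or.inr ⟨h1, h2, transp_other h h1 h2⟩)

theorem transp_mul_self (h : ¬ (n : ℤ) ∣ b - a) :
    affineTransp n a b h * affineTransp n a b h = 1 :=
  AffineW.ext_apply fun x => transpFun_involutive h x

theorem transp_inv (h : ¬ (n : ℤ) ∣ b - a) : (affineTransp n a b h)⁻¹ = affineTransp n a b h :=
  inv_eq_of_mul_eq_one_left (transp_mul_self h)

theorem transp_eq_of_apply (h : ¬ (n : ℤ) ∣ b - a) (w : AffineW n) (h1 : w.1 a = b)
    (h2 : w.1 b = a) (h3 : ∀ x, ¬ (n : ℤ) ∣ x - a → ¬ (n : ℤ) ∣ x - b → w.1 x = x) :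
    w = affineTransp n a b h := by
  refine AffineW.ext_apply fun x => ?_
  rcases transp_cases h x with ⟨k, rfl, hk⟩ | ⟨k, rfl, hk⟩ | ⟨ha, hb, hx⟩
  · rw [hk, AffineW.apply_add_mul, h1]
  · rw [hk, AffineW.apply_add_mul, h2]
  · rw [hx, h3 x ha hb]

theorem conj_transp (w : AffineW n) (h : ¬ (n : ℤ) ∣ b - a) :
    w * affineTransp n a b h * w⁻¹ =
      affineTransp n (w.1 a) (w.1 b) (by rwa [AffineW.dvd_apply_sub_apply]) := by
  refine transp_eq_of_apply _ _ ?_ ?_ ?_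
  · simp [transp_left' h]
  · simp [transp_right' h]
  · intro x ha hb
    have hx : w.1 ((w⁻¹).1 x) = x := by simp
    rw [← hx, AffineW.dvd_apply_sub_apply] at ha hb
    rw [AffineW.mul_apply, AffineW.mul_apply, transp_other h ha hb, hx]

theorem transp_comm (h : ¬ (n : ℤ) ∣ b - a) :
    affineTransp n b a (by rwa [← dvd_neg, neg_sub]) = affineTransp n a b h := by
  refine transp_eq_of_apply _ _ (transp_right' _) (transp_left' _) fun x ha hb => ?_
  exact transp_other _ hb ha

theorem transp_add_mul (h : ¬ (n : ℤ) ∣ b - a) (k : ℤ) :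
    affineTransp n (a + k * n) (b + k * n) (by rwa [add_sub_add_right_eq_sub]) =
      affineTransp n a b h := by
  have h' : ¬ (n : ℤ) ∣ (b + k * n) - (a + k * n) := by rwa [add_sub_add_right_eq_sub]
  have e : ∀ x y : ℤ, (n : ℤ) ∣ x - (y + k * n) ↔ (n : ℤ) ∣ x - y := fun x y => by
    rw [← sub_sub]; exact dvd_sub_left (Dvd.intro_left k rfl)
  refine transp_eq_of_apply _ _ ?_ ?_ fun x ha hb => transp_other h' (by rwa [e]) (by rwa [e])
  · have := transp_left h' (-k)
    simpa using this
  · have := transp_right h' (-k)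
    simpa using this

end Transp

section Reflections

variable {n : ℕ} (hn : 2 ≤ n)

theorem conj_mem_reflections (g r : AffineW n) (hr : r ∈ reflections hn) :
    g * r * g⁻¹ ∈ reflections hn := by
  obtain ⟨i, h, rfl⟩ := hr
  exact ⟨i, g * h, by group⟩

theorem exists_eq_simpleRefl (a : ℤ) :
    ∃ i, affineTransp n a (a + 1) (not_dvd_succ_sub hn a) = simpleRefl hn i := by
  have hn' : (0 : ℤ) < n := by omega
  have h1 := Int.emod_nonneg (a - 1) hn'.ne'
  have h2 := Int.emod_lt_of_pos (a - 1) hn'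
  have h3 := Int.emod_add_mul_ediv (a - 1) n
  refine ⟨⟨((a - 1) % n).toNat, by omega⟩, ?_⟩
  rw [simpleRefl]
  have e : (((⟨((a - 1) % n).toNat, by omega⟩ : Fin n) : ℕ) : ℤ) = (a - 1) % n :=
    Int.toNat_of_nonneg h1
  rw [← transp_add_mul (k := -((a - 1) / n))]
  congr 1
  · rw [e]; linarith
  · rw [e]; linarith

theorem transp_succ_mem (a : ℤ) :
    affineTransp n a (a + 1) (not_dvd_succ_sub hn a) ∈ reflections hn := by
  obtain ⟨i, hi⟩ := exists_eq_simpleRefl hn a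
  exact ⟨i, 1, by rw [hi, one_mul, inv_one, mul_one]⟩

/-- Conjugation by the simple reflection moving `a` to `a + 1` shortens the gap: by two if `b` is
congruent to `a + 1`, since `b` then moves down as well, and by one otherwise. -/
theorem transp_mem_of_pos (d : ℕ) : ∀ (a b : ℤ) (h : ¬ (n : ℤ) ∣ b - a), b - a = d →
    affineTransp n a b h ∈ reflections hn := by
  induction d using Nat.strong_induction_on with
  | _ d ih =>
    intro a b h hd
    rcases Nat.lt_or_ge d 2 with hd2 | hd2
    · interval_cases d
      · exact absurd (by simp [hd]) h
      · obtain rfl : b = a + 1 := by push_cast at hd; omega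
        exact transp_succ_mem hn a
    · let s := affineTransp n a (a + 1) (not_dvd_succ_sub hn a)
      have hconj := conj_transp s h
      have hsa : s.1 a = a + 1 := transp_left' _
      have hss : s⁻¹ = s := transp_inv _
      suffices h' : s * affineTransp n a b h * s⁻¹ ∈ reflections hn by
        have := conj_mem_reflections hn s⁻¹ _ h'
        rwa [show s⁻¹ * (s * affineTransp n a b h * s⁻¹) * s⁻¹⁻¹ = affineTransp n a b h by
          group] at this
      rw [hconj]
      by_cases hb : (n : ℤ) ∣ b - (a + 1)
      · obtain ⟨k, hk⟩ := hb
        have hb' : b = a + 1 + k * n := by linarith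
        have hsb : s.1 b = b - 1 := by
          rw [hb', transp_right]; ring
        refine ih (d - 2) (by omega) _ _ _ ?_
        rw [hsa, hsb]
        omega
      · have hsb : s.1 b = b := transp_other _ h hb
        refine ih (d - 1) (by omega) _ _ _ ?_
        rw [hsa, hsb]
        omega

theorem transp_mem_reflections {a b : ℤ} (h : ¬ (n : ℤ) ∣ b - a) :
    affineTransp n a b h ∈ reflections hn := by
  rcases le_total a b with hab | hab
  · exact transp_mem_of_pos hn (b - a).toNat a b h (by omega)
  · rw [← transp_comm]
    exact transp_mem_of_pos hn (a - b).toNat b a _ (by omega)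

theorem exists_eq_transp {r : AffineW n} (hr : r ∈ reflections hn) :
    ∃ a b, ∃ h : ¬ (n : ℤ) ∣ b - a, r = affineTransp n a b h := by
  obtain ⟨i, g, rfl⟩ := hr
  exact ⟨_, _, _, conj_transp g _⟩

/-- Induction on the number of residues that `w` moves. -/
theorem AffineW.exists_prod_reflections (w : AffineW n) :
    ∃ l : List (AffineW n), (∀ r ∈ l, r ∈ reflections hn) ∧ l.prod = w := by
  classical
  have hn' : (0 : ℤ) < n := by omega
  have hdvd : ∀ {x y : ℤ}, x ∈ Finset.Icc (1 : ℤ) n → y ∈ Finset.Icc (1 : ℤ) n →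
      (n : ℤ) ∣ x - y → x = y := by
    intro x y hx hy h
    rw [Finset.mem_Icc] at hx hy
    obtain ⟨k, hk⟩ := h
    have h1 : k < 1 := by nlinarith
    have h2 : -1 < k := by nlinarith
    obtain rfl : k = 0 := by omega
    linarith
  generalize hN : ((Finset.Icc (1 : ℤ) n).filter fun x => w.1 x ≠ x).card = N
  induction N using Nat.strong_induction_on generalizing w with
  | _ N ih =>
    -- It is enough to find reflections whose product with `w` fixes one more residue and loses no
    -- fixed one.
    have reduce : ∀ (l : List (AffineW n)) (x : ℤ), (∀ r ∈ l, r ∈ reflections hn) →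
        x ∈ Finset.Icc (1 : ℤ) n → w.1 x ≠ x → (l.prod * w).1 x = x →
        (∀ z ∈ Finset.Icc (1 : ℤ) n, w.1 z = z → (l.prod * w).1 z = z) →
        ∃ l : List (AffineW n), (∀ r ∈ l, r ∈ reflections hn) ∧ l.prod = w := by
      intro l x hl hx hwx hlx hz
      obtain ⟨m, hm, hmp⟩ := ih _ (by
        rw [← hN]
        refine Finset.card_lt_card (Finset.ssubset_iff_subset_ne.2 ⟨?_, ?_⟩)
        · intro z hz'
          rw [Finset.mem_filter] at hz' ⊢
          exact ⟨hz'.1, fun h => hz'.2 (hz z hz'.1 h)⟩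
        · intro h
          have : x ∈ (Finset.Icc (1 : ℤ) n).filter fun z => w.1 z ≠ z := by
            rw [Finset.mem_filter]; exact ⟨hx, hwx⟩
          rw [← h, Finset.mem_filter] at this
          exact this.2 hlx) (l.prod * w) rfl
      refine ⟨(l.map (·⁻¹)).reverse ++ m, ?_, ?_⟩
      · intro r hr
        rcases List.mem_append.1 hr with hr | hr
        · simp only [List.mem_reverse, List.mem_map] at hr
          obtain ⟨s, hs, rfl⟩ := hr
          obtain ⟨a, b, h, rfl⟩ := exists_eq_transp hn (hl s hs)
          rw [transp_inv]
          exact transp_mem_reflections hn h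
        · exact hm r hr
      · rw [List.prod_append, hmp, ← List.prod_inv_reverse, inv_mul_cancel_left]
    by_cases hall : ∀ x ∈ Finset.Icc (1 : ℤ) n, w.1 x = x
    · refine ⟨[], by simp, ?_⟩
      refine AffineW.ext_apply fun x => ?_
      have h1 := Int.emod_nonneg (x - 1) hn'.ne'
      have h2 := Int.emod_lt_of_pos (x - 1) hn'
      have h3 := Int.emod_add_mul_ediv (x - 1) n
      have h4 := hall ((x - 1) % n + 1) (by rw [Finset.mem_Icc]; omega)
      have h5 := AffineW.apply_add_mul w ((x - 1) % n + 1) ((x - 1) / n)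
      rw [h4, show (x - 1) % n + 1 + (x - 1) / n * n = x by linarith] at h5
      rw [h5]; rfl
    push Not at hall
    obtain ⟨x, hx, hwx⟩ := hall
    by_cases hd : (n : ℤ) ∣ w.1 x - x
    -- Here `w x = x + k n` with `k` nonzero. The displacements sum to zero, so some other residue
    -- `y` is moved too, and the reflections `(x, y)` and then `(x, y + k n)` send `x + k n` through
    -- `y + k n` back to `x`.
    · obtain ⟨y, hy, hxy, hwy⟩ : ∃ y ∈ Finset.Icc (1 : ℤ) n, y ≠ x ∧ w.1 y ≠ y := by
        by_contra! hcon
        have := w.2.2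
        rw [Finset.sum_eq_single_of_mem x hx fun y hy hyx => by rw [hcon y hy hyx, sub_self]]
          at this
        omega
      have hnd : ¬ (n : ℤ) ∣ y - x := fun h => hxy (hdvd hy hx h)
      obtain ⟨k, hk⟩ := hd
      have hwx' : w.1 x = x + k * n := by linarith
      have hnd' : ¬ (n : ℤ) ∣ (y + k * n) - x := fun h => hnd (by
        have := dvd_sub h (Dvd.intro_left k (rfl : k * (n : ℤ) = k * n))
        rwa [show y + k * n - x - k * n = y - x by ring] at this)
      refine reduce [affineTransp n x (y + k * n) hnd', affineTransp n x y hnd] x ?_ hx hwx ?_ ?_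
      · simp [transp_mem_reflections]
      · simp [hwx', transp_left hnd, transp_right' hnd']
      · intro z hz hwz
        have hzx : ¬ (n : ℤ) ∣ z - x := fun h => hwx (hdvd hz hx h ▸ hwz)
        have hzy : ¬ (n : ℤ) ∣ z - y := fun h => hwy (hdvd hz hy h ▸ hwz)
        have hzy' : ¬ (n : ℤ) ∣ z - (y + k * n) := fun h => hzy (by
          have := dvd_add h (Dvd.intro_left k (rfl : k * (n : ℤ) = k * n))
          rwa [show z - (y + k * n) + k * n = z - y by ring] at this)
        simp [hwz, transp_other hnd hzx hzy, transp_other hnd' hzx hzy']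
    · refine reduce [affineTransp n x (w.1 x) hd] x ?_ hx hwx ?_ ?_
      · simp [transp_mem_reflections]
      · simp [transp_right' hd]
      · intro z hz hwz
        have hzx : ¬ (n : ℤ) ∣ z - x := fun h => hwx (hdvd hz hx h ▸ hwz)
        have hzy : ¬ (n : ℤ) ∣ z - w.1 x := fun h => hzx (by
          rw [← hwz, AffineW.dvd_apply_sub_apply] at h; exact h)
        simp [hwz, transp_other hd hzx hzy]

theorem isReflectionSet_reflections : IsReflectionSet (reflections hn) where
  conj := conj_mem_reflections hn
  inv r hr := by
    obtain ⟨a, b, h, rfl⟩ := exists_eq_transp hn hr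
    rw [transp_inv]
    exact transp_mem_reflections hn h
  gen := AffineW.exists_prod_reflections hn

end Reflections

/-! ### A lower bound for the absolute length -/

set_option linter.unusedSectionVars false

namespace AffineW

variable {n : ℕ}

theorem intCast_apply_congr (w : AffineW n) {x y : ℤ} (h : (x : ZMod n) = y) :
    ((w.1 x : ℤ) : ZMod n) = (w.1 y : ℤ) := by
  rw [ZMod.intCast_eq_intCast_iff_dvd_sub] at *
  rwa [dvd_apply_sub_apply]

theorem intCast_cast (z : ZMod n) : (((z.cast : ℤ)) : ZMod n) = z := ZMod.intCast_zmod_cast z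

/-- The permutation of `ℤ/nℤ` induced by an element of `W`. -/
def bar (w : AffineW n) : Equiv.Perm (ZMod n) where
  toFun z := ((w.1 (z.cast : ℤ) : ℤ) : ZMod n)
  invFun z := (((w⁻¹).1 (z.cast : ℤ) : ℤ) : ZMod n)
  left_inv z := by
    dsimp only
    rw [intCast_apply_congr (y := w.1 z.cast) w⁻¹ (intCast_cast _), inv_apply_self, intCast_cast]
  right_inv z := by
    dsimp only
    rw [intCast_apply_congr (y := (w⁻¹).1 z.cast) w (intCast_cast _), apply_inv_self,
      intCast_cast]

theorem bar_intCast (w : AffineW n) (x : ℤ) : bar w (x : ZMod n) = (w.1 x : ℤ) :=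
  intCast_apply_congr w (intCast_cast _)

theorem bar_mul (v w : AffineW n) (z : ZMod n) : bar (v * w) z = bar v (bar w z) := by
  obtain ⟨x, rfl⟩ := ZMod.intCast_surjective z
  simp only [bar_intCast, mul_apply]

theorem bar_one (z : ZMod n) : bar (1 : AffineW n) z = z := by
  obtain ⟨x, rfl⟩ := ZMod.intCast_surjective z
  rw [bar_intCast]; rfl

/-- The displacement `w(x) - x`, as a function of `x` modulo `n`. -/
def disp (w : AffineW n) (z : ZMod n) : ℚ := (w.1 (z.cast : ℤ) : ℚ) - ((z.cast : ℤ) : ℚ)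

theorem disp_intCast (w : AffineW n) (x : ℤ) : disp w (x : ZMod n) = (w.1 x : ℚ) - x := by
  have h := intCast_cast (x : ZMod n)
  rw [ZMod.intCast_eq_intCast_iff_dvd_sub] at h
  obtain ⟨k, hk⟩ := h
  obtain ⟨y, hy⟩ : ∃ y : ℤ, (((x : ZMod n)).cast : ℤ) = y := ⟨_, rfl⟩
  rw [disp, hy]
  rw [hy] at hk
  obtain rfl : x = y + k * n := by linarith
  rw [apply_add_mul]
  push_cast
  ring

theorem disp_mul (v w : AffineW n) (z : ZMod n) :
    disp (v * w) z = disp v (bar w z) + disp w z := by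
  obtain ⟨x, rfl⟩ := ZMod.intCast_surjective z
  simp only [bar_intCast, disp_intCast, mul_apply]
  ring

theorem disp_one (z : ZMod n) : disp (1 : AffineW n) z = 0 := by simp [disp]

variable [NeZero n]

theorem sum_Icc_intCast {M : Type*} [AddCommMonoid M] (F : ZMod n → M) :
    ∑ x ∈ Finset.Icc (1 : ℤ) n, F (x : ZMod n) = ∑ z : ZMod n, F z := by
  refine Finset.sum_nbij (fun x : ℤ => (x : ZMod n)) (fun _ _ => Finset.mem_univ _) ?_ ?_
    (fun _ _ => rfl)
  · intro x hx y hy hxy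
    simp only [Finset.coe_Icc, Set.mem_Icc] at hx hy
    have hxy' : (x : ZMod n) = y := hxy
    rw [ZMod.intCast_eq_intCast_iff_dvd_sub] at hxy'
    obtain ⟨k, hk⟩ := hxy'
    have h1 : k < 1 := by nlinarith
    have h2 : -1 < k := by nlinarith
    obtain rfl : k = 0 := by omega
    linarith
  · intro z _
    refine ⟨((z - 1).val : ℤ) + 1, ?_, ?_⟩
    · simp only [Finset.coe_Icc, Set.mem_Icc]
      have := ZMod.val_lt (z - 1)
      omega
    · push_cast
      rw [ZMod.natCast_zmod_val, sub_add_cancel]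

theorem sum_disp (w : AffineW n) : ∑ z, disp w z = 0 := by
  rw [← sum_Icc_intCast]
  have := w.2.2
  simp only [disp_intCast]
  exact_mod_cast this

/-- The functions on `ℤ/nℤ` which are invariant under `w`. -/
def invar (w : AffineW n) : Submodule ℚ (ZMod n → ℚ) where
  carrier := {f | ∀ z, f (bar w z) = f z}
  add_mem' hf hg z := by simp only [Pi.add_apply, hf z, hg z]
  zero_mem' z := rfl
  smul_mem' t f hf z := by simp only [Pi.smul_apply, hf z]

theorem mem_invar {w : AffineW n} {f : ZMod n → ℚ} : f ∈ invar w ↔ ∀ z, f (bar w z) = f z :=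
  Iff.rfl

theorem mem_invar_iff_intCast {w : AffineW n} {f : ZMod n → ℚ} :
    f ∈ invar w ↔ ∀ x : ℤ, f (w.1 x : ℤ) = f (x : ZMod n) := by
  rw [mem_invar]
  refine ⟨fun h x => by rw [← bar_intCast, h], fun h z => ?_⟩
  obtain ⟨x, rfl⟩ := ZMod.intCast_surjective z
  rw [bar_intCast, h]

/-- The functional `f ↦ ∑ f(x) (w(x) - x)`. -/
def shift (w : AffineW n) (f : ZMod n → ℚ) : ℚ := ∑ z, f z * disp w z

/-- The displacement is a cocycle, and `f` is constant along `w`, so the sum can be reindexed by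
`bar w`. -/
theorem shift_mul {v w : AffineW n} {f : ZMod n → ℚ} (hf : f ∈ invar w) :
    shift (v * w) f = shift v f + shift w f := by
  have h1 : ∀ z, f z * disp (v * w) z = f (bar w z) * disp v (bar w z) + f z * disp w z :=
    fun z => by rw [disp_mul, hf z]; ring
  rw [shift, Finset.sum_congr rfl fun z _ => h1 z, Finset.sum_add_distrib,
    Equiv.sum_comp (bar w) fun z => f z * disp v z]
  rfl

/-- The functions taking the same value at `a` and `b`. -/
def agree (a b : ℤ) : Submodule ℚ (ZMod n → ℚ) where
  carrier := {f | f (a : ZMod n) = f (b : ZMod n)}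
  add_mem' hf hg := by simp only [Set.mem_ofPred_eq, Pi.add_apply] at *; rw [hf, hg]
  zero_mem' := rfl
  smul_mem' t f hf := by simp only [Set.mem_ofPred_eq, Pi.smul_apply] at *; rw [hf]

theorem mem_agree {a b : ℤ} {f : ZMod n → ℚ} :
    f ∈ agree a b ↔ f (a : ZMod n) = f (b : ZMod n) := Iff.rfl

theorem finrank_le_inf_agree (S : Submodule ℚ (ZMod n → ℚ)) (a b : ℤ) :
    Module.finrank ℚ S ≤ Module.finrank ℚ (S ⊓ agree a b : Submodule ℚ (ZMod n → ℚ)) + 1 := by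
  let φ : (ZMod n → ℚ) →ₗ[ℚ] ℚ :=
    (LinearMap.proj (a : ZMod n) : (ZMod n → ℚ) →ₗ[ℚ] ℚ) - LinearMap.proj (b : ZMod n)
  have hker : agree a b = LinearMap.ker φ := by
    ext f
    rw [mem_agree, LinearMap.mem_ker, LinearMap.sub_apply, LinearMap.proj_apply,
      LinearMap.proj_apply, sub_eq_zero]
  have h1 := LinearMap.finrank_range_add_finrank_ker φ
  have h2 := Submodule.finrank_sup_add_finrank_inf_eq S (agree a b)
  have h3 := Submodule.finrank_le (S ⊔ agree a b)
  have h4 := Submodule.finrank_le (LinearMap.range φ)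
  rw [Module.finrank_self] at h4
  rw [← hker] at h1
  omega

theorem finrank_inf_agree_lt {S : Submodule ℚ (ZMod n → ℚ)} {a b : ℤ}
    (h : ¬ S ≤ agree a b) :
    Module.finrank ℚ S = Module.finrank ℚ (S ⊓ agree a b : Submodule ℚ (ZMod n → ℚ)) + 1 := by
  refine le_antisymm (finrank_le_inf_agree S a b) ?_
  refine Submodule.finrank_lt_finrank_of_lt (lt_of_le_of_ne inf_le_left fun h' => h ?_)
  exact inf_eq_left.1 h'

theorem bar_transp {a b : ℤ} (h : ¬ (n : ℤ) ∣ b - a) :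
    bar (affineTransp n a b h) = Equiv.swap (a : ZMod n) (b : ZMod n) := by
  ext1 z
  obtain ⟨x, rfl⟩ := ZMod.intCast_surjective z
  rw [bar_intCast]
  rcases transp_cases h x with ⟨k, rfl, hk⟩ | ⟨k, rfl, hk⟩ | ⟨ha, hb, hx⟩
  · rw [hk]; simp
  · rw [hk]; simp
  · rw [hx, Equiv.swap_apply_of_ne_of_ne]
    · rwa [Ne, eq_comm, ZMod.intCast_eq_intCast_iff_dvd_sub]
    · rwa [Ne, eq_comm, ZMod.intCast_eq_intCast_iff_dvd_sub]

theorem intCast_ne {a b : ℤ} (h : ¬ (n : ℤ) ∣ b - a) : (a : ZMod n) ≠ b := by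
  rwa [Ne, ZMod.intCast_eq_intCast_iff_dvd_sub]

theorem sum_mul_transp {a b : ℤ} (h : ¬ (n : ℤ) ∣ b - a) (F : ZMod n → ℚ)
    (hF : ∀ z : ZMod n, z ≠ a → z ≠ b → F z = 0) : ∑ z, F z = F a + F b := by
  rw [← Finset.sum_pair (intCast_ne h)]
  refine (Finset.sum_subset (Finset.subset_univ _) fun z _ hz => ?_).symm
  simp only [Finset.mem_insert, Finset.mem_singleton, not_or] at hz
  exact hF z hz.1 hz.2

theorem apply_swap_of_agree {a b : ℤ} {f : ZMod n → ℚ} (hf : f ∈ agree a b) (z : ZMod n) :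
    f (Equiv.swap (a : ZMod n) b z) = f z := by
  by_cases h1 : z = a
  · subst h1; rw [Equiv.swap_apply_left]; exact hf.symm
  by_cases h2 : z = b
  · subst h2; rw [Equiv.swap_apply_right]; exact hf
  rw [Equiv.swap_apply_of_ne_of_ne h1 h2]

/-! ### Effect of multiplication by a reflection on invariant functions. -/

section Mul

variable (w : AffineW n) {a b : ℤ} (h : ¬ (n : ℤ) ∣ b - a)

theorem agree_le_invar_transp : agree a b ≤ invar (affineTransp n a b h) := fun f hf z => by
  rw [bar_transp, apply_swap_of_agree hf]

theorem mem_invar_mul_transp_iff {f : ZMod n → ℚ} (hf : f ∈ agree a b) :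
    f ∈ invar (w * affineTransp n a b h) ↔ f ∈ invar w := by
  rw [mem_invar, mem_invar]
  simp only [bar_mul, bar_transp]
  constructor
  · intro hw z
    have := hw (Equiv.swap (a : ZMod n) b z)
    rwa [Equiv.swap_apply_self, apply_swap_of_agree hf] at this
  · intro hw z
    rw [hw, apply_swap_of_agree hf]

theorem invar_inf_agree :
    invar (w * affineTransp n a b h) ⊓ agree a b = invar w ⊓ agree a b := by
  ext f
  simp only [Submodule.mem_inf]
  exact and_congr_left (mem_invar_mul_transp_iff w h)

/-- Reindexing the pairing of `f` and `g` by `bar w` fixes `f` and replaces `g` by `g` composed with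
the swap; comparing the two sums leaves this product. In terms of cycles, `a` and `b` lie in one
cycle of `w` or in one cycle of `w` times the reflection. -/
theorem mul_sub_eq_zero {f g : ZMod n → ℚ} (hf : f ∈ invar w)
    (hg : g ∈ invar (w * affineTransp n a b h)) : (f a - f b) * (g a - g b) = 0 := by
  have hg' : ∀ z, g (bar w z) = g (Equiv.swap (a : ZMod n) b z) := fun z => by
    have := hg (Equiv.swap (a : ZMod n) b z)
    rwa [bar_mul, bar_transp, Equiv.swap_apply_self] at this
  have h1 : ∑ z, f z * g z = ∑ z, f z * g (Equiv.swap (a : ZMod n) b z) := by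
    rw [← Equiv.sum_comp (bar w)]
    exact Finset.sum_congr rfl fun z _ => by rw [hf z, hg' z]
  have h2 : ∑ z, f z * (g z - g (Equiv.swap (a : ZMod n) b z)) = 0 := by
    simp only [mul_sub, Finset.sum_sub_distrib]
    linarith
  rw [sum_mul_transp h _ fun z h3 h4 => by
    rw [Equiv.swap_apply_of_ne_of_ne h3 h4, sub_self, mul_zero], Equiv.swap_apply_left,
    Equiv.swap_apply_right] at h2
  linarith

theorem invar_mul_transp_le (hw : ¬ invar w ≤ agree a b) :
    invar (w * affineTransp n a b h) ≤ agree a b := by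
  obtain ⟨f, hf, hfa⟩ := Set.not_subset.1 hw
  intro g hg
  rcases mul_eq_zero.1 (mul_sub_eq_zero w h hf hg) with h1 | h1
  · exact absurd (sub_eq_zero.1 h1) hfa
  · exact sub_eq_zero.1 h1

theorem finrank_invar_mul_transp_of_not_le (hw : ¬ invar w ≤ agree a b) :
    Module.finrank ℚ (invar w) =
      Module.finrank ℚ (invar (w * affineTransp n a b h)) + 1 := by
  rw [finrank_inf_agree_lt hw, ← invar_inf_agree w h,
    inf_eq_left.2 (invar_mul_transp_le w h hw)]

theorem finrank_invar_mul_transp_le :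
    Module.finrank ℚ (invar (w * affineTransp n a b h)) ≤ Module.finrank ℚ (invar w) + 1 := by
  refine (finrank_le_inf_agree _ a b).trans ?_
  rw [invar_inf_agree]
  exact Nat.add_le_add_right (Submodule.finrank_mono inf_le_left) 1

theorem shift_transp {f : ZMod n → ℚ} :
    shift (affineTransp n a b h) f = (f a - f b) * (b - a) := by
  rw [shift, sum_mul_transp h]
  · rw [disp_intCast, disp_intCast, transp_left', transp_right']
    ring
  · intro z h1 h2
    obtain ⟨x, rfl⟩ := ZMod.intCast_surjective z
    rw [disp_intCast, transp_other, sub_self, mul_zero]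
    · rwa [Ne, eq_comm, ZMod.intCast_eq_intCast_iff_dvd_sub] at h1
    · rwa [Ne, eq_comm, ZMod.intCast_eq_intCast_iff_dvd_sub] at h2

theorem shift_mul_transp {f : ZMod n → ℚ} (hf : f ∈ agree a b) :
    shift (w * affineTransp n a b h) f = shift w f := by
  rw [shift_mul (agree_le_invar_transp h hf), shift_transp, mem_agree.1 hf]
  ring

end Mul

/-- `U` consists of the functions constant on the blocks of ℤ/nℤ joined by the reflections of the
list. It starts as the whole space, of dimension `n`. A reflection inside a block keeps `U` and
enlarges the invariants by at most one dimension; a reflection joining two blocks lowers both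
dimensions by one. Either way the inequality survives. -/
theorem exists_subspace_of_list (hn : 2 ≤ n) (l : List (AffineW n))
    (hl : ∀ r ∈ l, r ∈ reflections hn) :
    ∃ U : Submodule ℚ (ZMod n → ℚ), (∀ f ∈ U, ∀ g ∈ U, f * g ∈ U) ∧ U ≤ invar l.prod ∧
      (∀ f ∈ U, shift l.prod f = 0) ∧
      n + Module.finrank ℚ (invar l.prod) ≤ 2 * Module.finrank ℚ U + l.length := by
  induction l using List.reverseRecOn with
  | nil =>
    refine ⟨⊤, fun _ _ _ _ => trivial, fun f _ z => ?_, fun f _ => ?_, ?_⟩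
    · rw [List.prod_nil, bar_one]
    · simp [shift, disp_one]
    · have := Submodule.finrank_le (invar ([] : List (AffineW n)).prod)
      rw [finrank_top]
      simp only [Module.finrank_pi, ZMod.card, List.length_nil] at *
      omega
  | append_singleton l r ih =>
    obtain ⟨U, hU1, hU2, hU3, hU4⟩ := ih fun s hs => hl s (List.mem_append_left _ hs)
    obtain ⟨a, b, h, rfl⟩ := exists_eq_transp hn (hl r (by simp))
    rw [List.prod_append, List.prod_singleton, List.length_append, List.length_singleton]
    by_cases hU : U ≤ agree a b
    · refine ⟨U, hU1, fun f hf => ?_, fun f hf => ?_, ?_⟩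
      · exact (mem_invar_mul_transp_iff _ h (hU hf)).2 (hU2 hf)
      · rw [shift_mul_transp _ h (hU hf), hU3 f hf]
      · have := finrank_invar_mul_transp_le l.prod h
        omega
    · refine ⟨U ⊓ agree a b, fun f hf g hg => ⟨hU1 f hf.1 g hg.1, ?_⟩, fun f hf => ?_,
        fun f hf => ?_, ?_⟩
      · change f a * g a = f b * g b
        rw [mem_agree.1 hf.2, mem_agree.1 hg.2]
      · exact (mem_invar_mul_transp_iff _ h hf.2).2 (hU2 hf.1)
      · rw [shift_mul_transp _ h hf.2, hU3 f hf.1]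
      · have h1 := finrank_inf_agree_lt hU
        have h2 := finrank_invar_mul_transp_of_not_le l.prod h fun h' => hU (hU2.trans h')
        omega

/-- A lower bound for the absolute length. -/
theorem exists_subspace (hn : 2 ≤ n) (w : AffineW n) :
    ∃ U : Submodule ℚ (ZMod n → ℚ), (∀ f ∈ U, ∀ g ∈ U, f * g ∈ U) ∧ U ≤ invar w ∧
      (∀ f ∈ U, shift w f = 0) ∧
      n + Module.finrank ℚ (invar w) ≤ 2 * Module.finrank ℚ U + reflLength (reflections hn) w := by
  obtain ⟨l, hl, hlR, rfl⟩ := (isReflectionSet_reflections hn).exists_list w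
  rw [← hl]
  exact exists_subspace_of_list hn l hlR

end AffineW

/-! ### The partition attached to a Coxeter element -/

section Time

variable {n : ℕ} (hn : 2 ≤ n)

/-- The index of the Coxeter generator exchanging `x` and `x + 1`. -/
def reflIndex (x : ℤ) : Fin n :=
  ⟨((x - 1) % n).toNat, by
    have h1 := Int.emod_nonneg (x - 1) (b := n) (by omega)
    have h2 := Int.emod_lt_of_pos (x - 1) (b := n) (by omega)
    omega⟩

theorem reflIndex_coe (x : ℤ) : ((reflIndex hn x : ℕ) : ℤ) = (x - 1) % n :=
  Int.toNat_of_nonneg (Int.emod_nonneg (x - 1) (by omega))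

theorem reflIndex_eq_iff (x : ℤ) (i : Fin n) :
    reflIndex hn x = i ↔ (n : ℤ) ∣ x - ((i : ℤ) + 1) := by
  rw [Fin.ext_iff, ← Int.natCast_inj, reflIndex_coe, show x - ((i : ℤ) + 1) = (x - 1) - i by ring,
    ← Int.emod_eq_emod_iff_emod_sub_eq_zero.trans Int.dvd_iff_emod_eq_zero.symm,
    Int.emod_eq_of_lt (a := (i : ℤ)) (by omega) (by omega)]

theorem reflIndex_congr {x y : ℤ} (h : (n : ℤ) ∣ x - y) :
    reflIndex hn x = reflIndex hn y := by
  rw [reflIndex_eq_iff]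
  have := (reflIndex_eq_iff hn y _).1 rfl
  simpa using dvd_add h this

theorem reflIndex_sub_one_ne (x : ℤ) : reflIndex hn (x - 1) ≠ reflIndex hn x := by
  intro h
  rw [reflIndex_eq_iff] at h
  have h1 := (reflIndex_eq_iff hn x _).1 rfl
  have h2 := dvd_sub h1 h
  rw [show x - ((reflIndex hn x : ℤ) + 1) - (x - 1 - ((reflIndex hn x : ℤ) + 1)) = 1 by ring] at h2
  have := Int.le_of_dvd one_pos h2
  omega

theorem simpleRefl_apply (i : Fin n) (y : ℤ) :
    (simpleRefl hn i).1 y =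
      if reflIndex hn y = i then y + 1 else if reflIndex hn (y - 1) = i then y - 1 else y := by
  simp only [reflIndex_eq_iff]
  change transpFun n _ _ y = _
  rw [transpFun, show y - ((i : ℤ) + 1 + 1) = y - 1 - ((i : ℤ) + 1) by ring,
    show y + ((i : ℤ) + 1 + 1 - ((i : ℤ) + 1)) = y + 1 by ring,
    show y + ((i : ℤ) + 1 - ((i : ℤ) + 1 + 1)) = y - 1 by ring]

/-- The number of factors to the right of the Coxeter generator exchanging `x` and `x + 1` in the
product of the generators in the order of `l`. -/
def reflTime (l : List (Fin n)) (x : ℤ) : ℕ := l.reverse.idxOf (reflIndex hn x)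

variable {l : List (Fin n)} (hl : l.Perm (List.finRange n))

include hl in
theorem reflTime_lt (x : ℤ) : reflTime hn l x < n := by
  have h1 : l.reverse.length = n := by simpa using hl.length_eq
  rw [reflTime]
  conv_rhs => rw [← h1]
  rw [List.idxOf_lt_length_iff, List.mem_reverse, hl.mem_iff]
  exact List.mem_finRange _

include hl in
theorem reflTime_eq_iff (x : ℤ) (t : ℕ) (ht : t < l.reverse.length) :
    reflTime hn l x = t ↔ reflIndex hn x = l.reverse[t] := by
  have hnd : l.reverse.Nodup := List.nodup_reverse.2 (hl.nodup_iff.2 (List.nodup_finRange n))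
  constructor
  · rintro rfl
    exact (List.getElem_idxOf ht).symm
  · intro h
    rw [reflTime, h, hnd.idxOf_getElem]

include hl in
theorem reflTime_sub_one_ne (x : ℤ) : reflTime hn l (x - 1) ≠ reflTime hn l x := by
  intro h
  have h1 : l.reverse.length = n := by simpa using hl.length_eq
  have h2 := reflTime_lt hn hl x
  rw [reflTime_eq_iff hn hl _ _ (by rw [h1]; exact h2)] at h
  have h3 := (reflTime_eq_iff hn hl x _ (by rw [h1]; exact h2)).1 rfl
  exact reflIndex_sub_one_ne hn x (h.trans h3.symm)

/-- The product of the last `t` factors. -/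
def suffixProd (l : List (Fin n)) (t : ℕ) : AffineW n :=
  ((l.reverse.take t).reverse.map (simpleRefl hn)).prod

include hl in
theorem suffixProd_succ_apply {t : ℕ} (ht : t < n) (x : ℤ) :
    (suffixProd hn l (t + 1)).1 x =
      if reflTime hn l ((suffixProd hn l t).1 x) = t then (suffixProd hn l t).1 x + 1
      else if reflTime hn l ((suffixProd hn l t).1 x - 1) = t then (suffixProd hn l t).1 x - 1
      else (suffixProd hn l t).1 x := by
  have h1 : l.reverse.length = n := by simpa using hl.length_eq
  have ht' : t < l.reverse.length := by rw [h1]; exact ht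
  simp only [reflTime_eq_iff hn hl _ t ht']
  rw [← simpleRefl_apply, ← AffineW.mul_apply, suffixProd, suffixProd, List.take_succ_eq_append_getElem ht']
  simp

-- If the generator exchanging `x` and `x + 1` acts before the one exchanging `x - 1` and `x`, the
-- first move of `x` is upwards. The point then climbs as long as the times increase, and stops at
-- the first `y` whose generator acts before that of `y - 1`. It never turns back, because the
-- generator below its position has already been used.
include hl in
theorem suffixProd_up {x : ℤ} (hx : reflTime hn l x < reflTime hn l (x - 1)) (t : ℕ)
    (ht : t ≤ n) :
    ∃ y, (suffixProd hn l t).1 x = y ∧ x ≤ y ∧ (∀ z, x ≤ z → z < y → reflTime hn l z < t) ∧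
      (∀ z, x < z → z < y → reflTime hn l (z - 1) < reflTime hn l z) ∧
      (x < y → t ≤ reflTime hn l y ∨ reflTime hn l y < reflTime hn l (y - 1)) ∧
      (y = x → t ≤ reflTime hn l x) := by
  induction t with
  | zero =>
    exact ⟨x, by simp [suffixProd], le_rfl, fun z _ _ => by omega, fun z _ _ => by omega,
      fun h => by omega, fun _ => Nat.zero_le _⟩
  | succ t ih =>
    obtain ⟨y, hy, hxy, hA, hB, hC, hD⟩ := ih (by omega)
    have hs := suffixProd_succ_apply hn hl (t := t) (by omega) x
    rw [hy] at hs
    have hne := reflTime_sub_one_ne hn hl (y + 1)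
    rw [add_sub_cancel_right] at hne
    split_ifs at hs with h1 h2
    · refine ⟨y + 1, hs, by omega, fun z hz hz' => ?_, fun z hz hz' => ?_, fun _ => ?_,
        fun h => by omega⟩
      · rcases eq_or_lt_of_le (show z ≤ y by omega) with rfl | h3
        · omega
        · have := hA z hz h3; omega
      · rcases eq_or_lt_of_le (show z ≤ y by omega) with rfl | h3
        · rw [h1]; exact hA _ (by omega) (by omega)
        · exact hB z hz h3
      · rw [add_sub_cancel_right]; omega
    · exfalso
      rcases eq_or_lt_of_le hxy with rfl | h3
      · have := hD rfl; clear hs hy; omega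
      · have := hA (y - 1) (by omega) (by omega); omega
    · refine ⟨y, hs, hxy, fun z hz hz' => ?_, hB, fun h => ?_, fun h => ?_⟩
      · have := hA z hz hz'; omega
      · have := hC h; omega
      · exact lt_of_le_of_ne (hD h) fun h' => h1 (h ▸ h'.symm)

include hl in
theorem suffixProd_down {x : ℤ} (hx : reflTime hn l (x - 1) < reflTime hn l x) (t : ℕ)
    (ht : t ≤ n) :
    ∃ y, (suffixProd hn l t).1 x = y ∧ y ≤ x ∧
      (∀ z, y < z → z ≤ x → reflTime hn l (z - 1) < t) ∧
      (∀ z, y < z → z < x → reflTime hn l z < reflTime hn l (z - 1)) ∧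
      (y < x → t ≤ reflTime hn l (y - 1) ∨ reflTime hn l (y - 1) < reflTime hn l y) ∧
      (y = x → t ≤ reflTime hn l (x - 1)) := by
  induction t with
  | zero =>
    exact ⟨x, by simp [suffixProd], le_rfl, fun z _ _ => by omega, fun z _ _ => by omega,
      fun h => by omega, fun _ => Nat.zero_le _⟩
  | succ t ih =>
    obtain ⟨y, hy, hxy, hA, hB, hC, hD⟩ := ih (by omega)
    have hs := suffixProd_succ_apply hn hl (t := t) (by omega) x
    rw [hy] at hs
    have hne := reflTime_sub_one_ne hn hl (y - 1)
    split_ifs at hs with h1 h2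
    · exfalso
      rcases eq_or_lt_of_le hxy with rfl | h3
      · have := hD rfl; clear hs hy; omega
      · have := hA (y + 1) (by omega) (by omega)
        rw [add_sub_cancel_right] at this; omega
    · refine ⟨y - 1, hs, by omega, fun z hz hz' => ?_, fun z hz hz' => ?_, fun _ => ?_,
        fun h => by omega⟩
      · rcases eq_or_lt_of_le (show y ≤ z by omega) with rfl | h3
        · omega
        · have := hA z h3 hz'; omega
      · rcases eq_or_lt_of_le (show y ≤ z by omega) with rfl | h3
        · rw [h2]
          have := hA (y + 1) (by omega) (by omega)
          rw [add_sub_cancel_right] at this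
          exact this
        · exact hB z h3 hz'
      · omega
    · refine ⟨y, hs, hxy, fun z hz hz' => ?_, hB, fun h => ?_, fun h => ?_⟩
      · have := hA z hz hz'; omega
      · have := hC h; omega
      · exact lt_of_le_of_ne (hD h) fun h' => h2 (h ▸ h'.symm)

theorem reflTime_add (l : List (Fin n)) (x : ℤ) : reflTime hn l (x + n) = reflTime hn l x := by
  rw [reflTime, reflTime, reflIndex_congr hn (y := x)]
  simp

-- The points carried upwards stop at the next point of the same kind, and likewise downwards. Both
-- kinds occur: otherwise all displacements would have the same strict sign, while their sum is
-- zero.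
include hl in
theorem isCoxeterPartition_time :
    IsCoxeterPartition (l.map (simpleRefl hn)).prod
      {x | reflTime hn l x < reflTime hn l (x - 1)}
      {x | reflTime hn l (x - 1) < reflTime hn l x} := by
  have hlen : l.reverse.length = n := by simpa using hl.length_eq
  have hprod : (l.map (simpleRefl hn)).prod = suffixProd hn l n := by
    rw [suffixProd, List.take_of_length_le hlen.le, List.reverse_reverse]
  have hup : ∀ x, reflTime hn l x < reflTime hn l (x - 1) →
      IsLeast {y | reflTime hn l y < reflTime hn l (y - 1) ∧ x < y} ((suffixProd hn l n).1 x) := by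
    intro x hx
    obtain ⟨y, hy, hxy, hA, hB, hC, hD⟩ := suffixProd_up hn hl hx n le_rfl
    have hlt := reflTime_lt hn hl
    rw [hy]
    have hxy' : x < y := lt_of_le_of_ne hxy fun h => by
      have := hD h.symm; have := hlt x; omega
    refine ⟨⟨(hC hxy').resolve_left fun h => by have := hlt y; omega, hxy'⟩, fun z hz => ?_⟩
    by_contra! hzy
    have := hB z hz.2 hzy
    have := hz.1
    omega
  have hdown : ∀ x, reflTime hn l (x - 1) < reflTime hn l x →
      IsGreatest {y | reflTime hn l (y - 1) < reflTime hn l y ∧ y < x}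
        ((suffixProd hn l n).1 x) := by
    intro x hx
    obtain ⟨y, hy, hxy, hA, hB, hC, hD⟩ := suffixProd_down hn hl hx n le_rfl
    have hlt := reflTime_lt hn hl
    rw [hy]
    have hxy' : y < x := lt_of_le_of_ne hxy fun h => by
      have := hD h; have := hlt (x - 1); omega
    refine ⟨⟨(hC hxy').resolve_left fun h => by have := hlt (y - 1); omega, hxy'⟩, fun z hz => ?_⟩
    by_contra! hzy
    have := hB z hzy hz.2
    have := hz.1
    omega
  have hshift : ∀ x : ℤ, reflTime hn l (x + n - 1) = reflTime hn l (x - 1) := fun x => by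
    rw [show x + n - 1 = (x - 1) + n by ring, reflTime_add]
  have hne : (Finset.Icc (1 : ℤ) n).Nonempty := ⟨1, by simp; omega⟩
  have hsum := (suffixProd hn l n).2.2
  rw [hprod]
  refine ⟨?_, ?_, fun x => ?_, fun x => ?_, ?_, hup, hdown⟩
  · by_contra hX
    rw [Set.not_nonempty_iff_eq_empty, Set.eq_empty_iff_forall_notMem] at hX
    refine (Finset.sum_neg (fun x _ => ?_) hne).ne hsum
    have h1 := hX x
    have h2 := reflTime_sub_one_ne hn hl x
    have h3 := (hdown x (by simp only [Set.mem_ofPred_eq] at h1; omega)).1.2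
    exact sub_neg.2 h3
  · by_contra hX
    rw [Set.not_nonempty_iff_eq_empty, Set.eq_empty_iff_forall_notMem] at hX
    refine (Finset.sum_pos (fun x _ => ?_) hne).ne' hsum
    have h1 := hX x
    have h2 := reflTime_sub_one_ne hn hl x
    have h3 := (hup x (by simp only [Set.mem_ofPred_eq] at h1; omega)).1.2
    exact sub_pos.2 h3
  · simp only [Set.mem_ofPred_eq, reflTime_add, hshift]
  · simp only [Set.mem_ofPred_eq, reflTime_add, hshift]
  · rw [isCompl_iff, Set.disjoint_left, codisjoint_iff]
    refine ⟨fun x hx hx' => ?_, Set.eq_univ_of_forall fun x => ?_⟩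
    · simp only [Set.mem_ofPred_eq] at hx hx'; omega
    · have h2 := reflTime_sub_one_ne hn hl x
      rcases lt_or_gt_of_ne h2 with h3 | h3
      · exact Or.inr h3
      · exact Or.inl h3

/-- The rightmost factor acts first, so the generator with index `i` acts at time `n - 1 - i`. Times
decrease along ℤ except on entering the class of `1`, which is therefore all of Ξ. -/
theorem isSingletonMod_standard :
    ∃ X Ξ, IsCoxeterPartition (standardCoxeter hn) X Ξ ∧ IsSingletonMod n Ξ := by
  have hl : (List.finRange n).Perm (List.finRange n) := List.Perm.refl _
  have hpart := isCoxeterPartition_time hn hl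
  refine ⟨_, _, hpart, ?_⟩
  rw [IsSingletonMod, Set.ncard_eq_one]
  refine ⟨1, Set.eq_singleton_iff_nonempty_unique_mem.2 ⟨hpart.nonempty_Ξ.image _, ?_⟩⟩
  rintro _ ⟨x, hx, rfl⟩
  by_contra hx1
  have key : ∀ i : Fin n, (List.finRange n).reverse.idxOf i = n - 1 - i := by
    intro i
    have h1 : n - 1 - (i : ℕ) < (List.finRange n).reverse.length := by simp; omega
    have h2 : (List.finRange n).reverse[n - 1 - (i : ℕ)] = i := by
      rw [List.getElem_reverse]
      simp only [List.getElem_finRange, List.length_finRange]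
      ext
      simp only [Fin.val_cast]
      omega
    conv_lhs => rw [← h2]
    exact (List.nodup_reverse.2 (List.nodup_finRange n)).idxOf_getElem _ h1
  simp only [Set.mem_ofPred_eq, reflTime, key] at hx
  have e1 := reflIndex_coe hn x
  have e2 := reflIndex_coe hn (x - 1)
  have h0 : ¬ (x - 1) % n = 0 := by
    intro h
    apply hx1
    have h' : ((1 : ℤ) : ZMod n) = x := by
      rw [ZMod.intCast_eq_intCast_iff_dvd_sub]
      exact Int.dvd_of_emod_eq_zero h
    exact h'.symm.trans Int.cast_one
  have h1 := Int.emod_nonneg (x - 1) (b := n) (by omega)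
  have h2 := Int.emod_lt_of_pos (x - 1) (b := n) (by omega)
  have h3 : (x - 1 - 1) % n = (x - 1) % n - 1 := by
    rw [Int.sub_emod, Int.emod_eq_of_lt (a := 1) (by omega) (by omega)]
    exact Int.emod_eq_of_lt (by omega) (by omega)
  omega

end Time

/-! ### Coxeter elements and their absolute length -/

theorem mem_congr_of_periodic {n : ℕ} {A : Set ℤ} (hA : ∀ x : ℤ, x + (n : ℤ) ∈ A ↔ x ∈ A)
    {x y : ℤ} (h : (n : ℤ) ∣ x - y) : x ∈ A ↔ y ∈ A := by
  obtain ⟨k, hk⟩ := h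
  obtain rfl : x = y + n * k := by linarith
  induction k using Int.induction_on with
  | zero => simp
  | succ k ih => rw [mul_add, mul_one, ← add_assoc, hA]; exact ih (by ring)
  | pred k ih => rw [← hA, mul_sub, mul_one, add_assoc, sub_add_cancel]; exact ih (by ring)

namespace AffineW

variable {n : ℕ}

open scoped Classical in
/-- The indicator function of the image modulo `n` of an `n`-periodic set. -/
noncomputable def ind (n : ℕ) (A : Set ℤ) : ZMod n → ℚ := fun z => if (z.cast : ℤ) ∈ A then 1 else 0

open scoped Classical in
theorem ind_intCast {A : Set ℤ} (hA : ∀ x : ℤ, x + (n : ℤ) ∈ A ↔ x ∈ A) (x : ℤ) :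
    ind n A (x : ZMod n) = if x ∈ A then 1 else 0 := by
  rw [ind, if_congr (mem_congr_of_periodic hA (y := x) ?_) rfl rfl]
  rw [← ZMod.intCast_eq_intCast_iff_dvd_sub, intCast_cast]

theorem ind_of_mem {A : Set ℤ} (hA : ∀ x : ℤ, x + (n : ℤ) ∈ A ↔ x ∈ A) {x : ℤ} (hx : x ∈ A) :
    ind n A (x : ZMod n) = 1 := by rw [ind_intCast hA, if_pos hx]

theorem ind_of_notMem {A : Set ℤ} (hA : ∀ x : ℤ, x + (n : ℤ) ∈ A ↔ x ∈ A) {x : ℤ} (hx : x ∉ A) :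
    ind n A (x : ZMod n) = 0 := by rw [ind_intCast hA, if_neg hx]

variable [NeZero n]

theorem ind_mem_invar {A : Set ℤ} (hA : ∀ x : ℤ, x + (n : ℤ) ∈ A ↔ x ∈ A) {w : AffineW n}
    (hw : ∀ x, w.1 x ∈ A ↔ x ∈ A) : ind n A ∈ invar w := by
  classical
  rw [mem_invar_iff_intCast]
  intro x
  rw [ind_intCast hA, ind_intCast hA, if_congr (hw x) rfl rfl]

theorem shift_ind_pos {A : Set ℤ} (hA : ∀ x : ℤ, x + (n : ℤ) ∈ A ↔ x ∈ A) {w : AffineW n}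
    (hne : A.Nonempty) (hw : ∀ x ∈ A, x < w.1 x) : 0 < shift w (ind n A) := by
  have h : ∀ x ∈ A, 0 < ind n A (x : ZMod n) * disp w (x : ZMod n) := fun x hx => by
    rw [ind_of_mem hA hx, disp_intCast, one_mul, sub_pos]
    exact_mod_cast hw x hx
  obtain ⟨x, hx⟩ := hne
  refine Finset.sum_pos' (fun z _ => ?_) ⟨(x : ZMod n), Finset.mem_univ _, h x hx⟩
  obtain ⟨y, rfl⟩ := ZMod.intCast_surjective z
  by_cases hy : y ∈ A
  · exact (h y hy).le
  · rw [ind_of_notMem hA hy, zero_mul]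

end AffineW

namespace IsCoxeterPartition

variable {n : ℕ} {c : AffineW n} {X Ξ : Set ℤ} (h : IsCoxeterPartition c X Ξ)

include h

theorem mem_or (x : ℤ) : x ∈ X ∨ x ∈ Ξ := by
  have := h.isCompl.sup_eq_top
  have hx : x ∈ X ⊔ Ξ := by rw [this]; trivial
  exact hx

theorem notMem_Ξ {x : ℤ} (hx : x ∈ X) : x ∉ Ξ := fun hx' =>
  Set.disjoint_left.1 h.isCompl.disjoint hx hx'

theorem notMem_X {x : ℤ} (hx : x ∈ Ξ) : x ∉ X := fun hx' => h.notMem_Ξ hx' hx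

theorem lt_apply {x : ℤ} (hx : x ∈ X) : x < c.1 x := (h.next_X x hx).1.2

theorem apply_lt {x : ℤ} (hx : x ∈ Ξ) : c.1 x < x := (h.prev_Ξ x hx).1.2

theorem apply_mem_X {x : ℤ} : c.1 x ∈ X ↔ x ∈ X := by
  refine ⟨fun hx => (h.mem_or x).resolve_right fun hx' => ?_, fun hx => (h.next_X x hx).1.1⟩
  exact h.notMem_Ξ hx (h.prev_Ξ x hx').1.1

theorem apply_mem_Ξ {x : ℤ} : c.1 x ∈ Ξ ↔ x ∈ Ξ := by
  refine ⟨fun hx => (h.mem_or x).resolve_left fun hx' => ?_, fun hx => (h.prev_Ξ x hx).1.1⟩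
  exact h.notMem_X hx (h.next_X x hx').1.1

theorem mem_X_iff {x : ℤ} : x ∈ X ↔ x < c.1 x := by
  refine ⟨h.lt_apply, fun hx => (h.mem_or x).resolve_right fun hx' => ?_⟩
  have := h.apply_lt hx'
  omega

theorem mem_Ξ_iff {x : ℤ} : x ∈ Ξ ↔ c.1 x < x := by
  refine ⟨h.apply_lt, fun hx => (h.mem_or x).resolve_left fun hx' => ?_⟩
  have := h.lt_apply hx'
  omega

theorem unique {X' Ξ' : Set ℤ} (h' : IsCoxeterPartition c X' Ξ') : X' = X ∧ Ξ' = Ξ := by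
  constructor
  · ext x; rw [h.mem_X_iff, h'.mem_X_iff]
  · ext x; rw [h.mem_Ξ_iff, h'.mem_Ξ_iff]

theorem inv : IsCoxeterPartition c⁻¹ Ξ X where
  nonempty_X := h.nonempty_Ξ
  nonempty_Ξ := h.nonempty_X
  add_mem_X := h.add_mem_Ξ
  add_mem_Ξ := h.add_mem_X
  isCompl := h.isCompl.symm
  next_X x hx := by
    obtain ⟨y, rfl⟩ : ∃ y, x = c.1 y := ⟨(c⁻¹).1 x, by simp⟩
    rw [AffineW.inv_apply_self]
    rw [h.apply_mem_Ξ] at hx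
    refine ⟨⟨hx, h.apply_lt hx⟩, fun z hz => ?_⟩
    by_contra! hzy
    have := (h.prev_Ξ y hx).2 ⟨hz.1, hzy⟩
    have := hz.2
    omega
  prev_Ξ x hx := by
    obtain ⟨y, rfl⟩ : ∃ y, x = c.1 y := ⟨(c⁻¹).1 x, by simp⟩
    rw [AffineW.inv_apply_self]
    rw [h.apply_mem_X] at hx
    refine ⟨⟨hx, h.lt_apply hx⟩, fun z hz => ?_⟩
    by_contra! hzy
    have := (h.next_X y hx).2 ⟨hz.1, hzy⟩
    have := hz.2
    omega

theorem apply_eq_of_mem_X {α : Type*} {f : ℤ → α} (hf : ∀ x, f (c.1 x) = f x) {x y : ℤ}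
    (hx : x ∈ X) (hy : y ∈ X) : f x = f y := by
  have key : ∀ (d : ℕ) (x y : ℤ), x ∈ X → y ∈ X → y - x = d → f x = f y := by
    intro d
    induction d using Nat.strong_induction_on with
    | _ d ih =>
      intro x y hx hy hd
      rcases Nat.eq_zero_or_pos d with rfl | hd0
      · obtain rfl : y = x := by simpa [sub_eq_zero] using hd
        rfl
      · have h1 := h.lt_apply hx
        have h2 := (h.next_X x hx).2 ⟨hy, by omega⟩
        rw [← hf x]
        exact ih (y - c.1 x).toNat (by omega) _ _ (h.apply_mem_X.2 hx) hy (by omega)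
  rcases le_total x y with hxy | hxy
  · exact key (y - x).toNat x y hx hy (by omega)
  · exact (key (x - y).toNat y x hy hx (by omega)).symm

theorem apply_eq_of_mem_Ξ {α : Type*} {f : ℤ → α} (hf : ∀ x, f (c.1 x) = f x) {x y : ℤ}
    (hx : x ∈ Ξ) (hy : y ∈ Ξ) : f x = f y :=
  h.inv.apply_eq_of_mem_X (fun x => by rw [← hf ((c⁻¹).1 x), AffineW.apply_inv_self]) hx hy

open AffineW

variable [NeZero n]

theorem invar_inf_agree_eq {x ξ : ℤ} (hx : x ∈ X) (hξ : ξ ∈ Ξ) :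
    invar c ⊓ agree x ξ = Submodule.span ℚ {1} := by
  ext f
  rw [Submodule.mem_inf, mem_agree, mem_invar_iff_intCast, Submodule.mem_span_singleton]
  constructor
  · rintro ⟨h1, h2⟩
    refine ⟨f (x : ZMod n), funext fun z => ?_⟩
    obtain ⟨y, rfl⟩ := ZMod.intCast_surjective z
    rw [Pi.smul_apply, Pi.one_apply, smul_eq_mul, mul_one]
    rcases h.mem_or y with hy | hy
    · exact h.apply_eq_of_mem_X (f := fun y : ℤ => f (y : ZMod n)) h1 hx hy
    · rw [h2]
      exact h.apply_eq_of_mem_Ξ (f := fun y : ℤ => f (y : ZMod n)) h1 hξ hy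
  · rintro ⟨t, rfl⟩
    exact ⟨fun x => rfl, rfl⟩

theorem finrank_invar : Module.finrank ℚ (invar c) = 2 := by
  obtain ⟨x, hx⟩ := h.nonempty_X
  obtain ⟨ξ, hξ⟩ := h.nonempty_Ξ
  rw [finrank_inf_agree_lt (S := invar c) (a := x) (b := ξ), h.invar_inf_agree_eq hx hξ,
    finrank_span_singleton one_ne_zero]
  intro hle
  have := hle (ind_mem_invar h.add_mem_X fun _ => h.apply_mem_X)
  rw [mem_agree, ind_of_mem h.add_mem_X hx, ind_of_notMem h.add_mem_X (h.notMem_X hξ)] at this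
  exact one_ne_zero this

/-- An invariant function is a combination of the indicator of X and a constant. The constant has
shift zero and the indicator positive shift, so `U` contains only constants, and `n + 2 ≤ 2 +
l_R(c)`. -/
theorem le_length (hn : 2 ≤ n) : n ≤ reflLength (reflections hn) c := by
  obtain ⟨x, hx⟩ := h.nonempty_X
  obtain ⟨ξ, hξ⟩ := h.nonempty_Ξ
  obtain ⟨U, -, hU2, hU3, hU4⟩ := exists_subspace hn c
  have hU : U ≤ agree x ξ := by
    intro f hf
    have hinv := mem_invar_iff_intCast.1 (hU2 hf)
    have e : f = (f x - f ξ) • ind n X + f ξ • (1 : ZMod n → ℚ) := by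
      funext z
      obtain ⟨y, rfl⟩ := ZMod.intCast_surjective z
      simp only [Pi.add_apply, Pi.smul_apply, Pi.one_apply, smul_eq_mul, mul_one]
      rcases h.mem_or y with hy | hy
      · rw [ind_of_mem h.add_mem_X hy,
          h.apply_eq_of_mem_X (f := fun y : ℤ => f (y : ZMod n)) hinv hx hy]
        ring
      · rw [ind_of_notMem h.add_mem_X (h.notMem_X hy),
          h.apply_eq_of_mem_Ξ (f := fun y : ℤ => f (y : ZMod n)) hinv hξ hy]
        ring
    have h1 : shift c f = (f x - f ξ) * shift c (ind n X) := by
      have h2 : ∀ z, f z * disp c z =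
          (f x - f ξ) * (ind n X z * disp c z) + f ξ * disp c z := fun z => by
        conv_lhs => rw [e]
        simp only [Pi.add_apply, Pi.smul_apply, Pi.one_apply, smul_eq_mul, mul_one]
        ring
      rw [shift, Finset.sum_congr rfl fun z _ => h2 z, Finset.sum_add_distrib,
        ← Finset.mul_sum, ← Finset.mul_sum, sum_disp, mul_zero, add_zero]
      rfl
    have h2 := shift_ind_pos h.add_mem_X h.nonempty_X fun y hy => h.lt_apply hy
    rw [hU3 f hf, eq_comm, mul_eq_zero] at h1
    exact sub_eq_zero.1 (h1.resolve_right h2.ne')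
  have h1 : U ≤ Submodule.span ℚ {1} := by
    rw [← h.invar_inf_agree_eq hx hξ]
    exact le_inf hU2 hU
  have h2 := Submodule.finrank_mono h1
  rw [finrank_span_singleton one_ne_zero] at h2
  rw [h.finrank_invar] at hU4
  omega

end IsCoxeterPartition

theorem IsCoxeterElement.length_le {n : ℕ} {hn : 2 ≤ n} {c : AffineW n}
    (hc : IsCoxeterElement hn c) : reflLength (reflections hn) c ≤ n := by
  obtain ⟨l, hl, rfl⟩ := hc
  refine (reflLength_prod_le _ fun r hr => ?_).trans (by simp [hl.length_eq])
  obtain ⟨i, -, rfl⟩ := List.mem_map.1 hr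
  exact ⟨i, 1, by simp⟩

theorem IsCoxeterElement.exists_partition {n : ℕ} {hn : 2 ≤ n} {c : AffineW n}
    (hc : IsCoxeterElement hn c) : ∃ X Ξ, IsCoxeterPartition c X Ξ := by
  obtain ⟨l, hl, rfl⟩ := hc
  exact ⟨_, _, isCoxeterPartition_time hn hl⟩

theorem IsCoxeterElement.inv {n : ℕ} {hn : 2 ≤ n} {c : AffineW n}
    (hc : IsCoxeterElement hn c) : IsCoxeterElement hn c⁻¹ := by
  obtain ⟨l, hl, rfl⟩ := hc
  refine ⟨l.reverse, l.reverse_perm.trans hl, ?_⟩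
  rw [List.prod_inv_reverse, List.map_map, List.map_reverse]
  congr 2

theorem IsCoxeterElement.length_eq {n : ℕ} {hn : 2 ≤ n} {c : AffineW n}
    (hc : IsCoxeterElement hn c) : reflLength (reflections hn) c = n := by
  have : NeZero n := ⟨by omega⟩
  obtain ⟨X, Ξ, h⟩ := hc.exists_partition
  exact le_antisymm hc.length_le (h.le_length hn)

/-! ### Noncrossing relations -/

/-- `X` is an `n`-periodic set of integers whose complement is one class modulo `n`. -/
structure IsPunctured (n : ℕ) (X : Set ℤ) : Prop where
  add_mem : ∀ x : ℤ, x + (n : ℤ) ∈ X ↔ x ∈ X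
  dvd_sub : ∀ x y : ℤ, x ∉ X → y ∉ X → (n : ℤ) ∣ x - y
  compl_nonempty : ∃ ξ, ξ ∉ X

open scoped Classical in
/-- The position of an integer for the linear order in which `X` comes first, in increasing order,
followed by its complement, in decreasing order. -/
noncomputable def pos (X : Set ℤ) (x : ℤ) : ℤ ×ₗ ℤ :=
  if x ∈ X then toLex (0, x) else toLex (1, -x)

section Position

variable {X : Set ℤ} {x y : ℤ}

theorem pos_lt_iff : pos X x < pos X y ↔
    (x ∈ X ∧ y ∈ X ∧ x < y) ∨ (x ∈ X ∧ y ∉ X) ∨ (x ∉ X ∧ y ∉ X ∧ y < x) := by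
  unfold pos
  split_ifs with h1 h2 h2 <;> simp [Prod.Lex.toLex_lt_toLex, h1, h2]

theorem pos_injective : Function.Injective (pos X) := by
  intro x y h
  by_contra hne
  have h1 : ¬ pos X x < pos X y := by rw [h]; exact lt_irrefl _
  have h2 : ¬ pos X y < pos X x := by rw [h]; exact lt_irrefl _
  rw [pos_lt_iff] at h1 h2
  grind

theorem pos_le_iff : pos X x ≤ pos X y ↔
    (x ∈ X ∧ y ∈ X ∧ x ≤ y) ∨ (x ∈ X ∧ y ∉ X) ∨ (x ∉ X ∧ y ∉ X ∧ y ≤ x) := by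
  rw [← not_lt, pos_lt_iff]
  grind

theorem pos_ne (h : x ≠ y) : pos X x ≠ pos X y := fun h' => h (pos_injective h')

namespace IsPunctured

variable {n : ℕ} (hX : IsPunctured n X)

include hX

theorem add_mul_mem (x k : ℤ) : x + k * n ∈ X ↔ x ∈ X :=
  mem_congr_of_periodic hX.add_mem ⟨k, by ring⟩

theorem pos_add_mul_lt (x y k : ℤ) :
    pos X (x + k * n) < pos X (y + k * n) ↔ pos X x < pos X y := by
  simp only [pos_lt_iff, hX.add_mul_mem, add_lt_add_iff_right]

theorem pos_add_mul_le (x y k : ℤ) :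
    pos X (x + k * n) ≤ pos X (y + k * n) ↔ pos X x ≤ pos X y := by
  simp only [pos_le_iff, hX.add_mul_mem, add_le_add_iff_right]

end IsPunctured

end Position

/-- A periodic noncrossing equivalence relation, in which an infinite class meets `X` and contains
the complement of `X`. -/
structure IsNoncrossing (n : ℕ) (X : Set ℤ) (r : ℤ → ℤ → Prop) : Prop where
  equiv : Equivalence r
  add_iff : ∀ x y, r (x + n) (y + n) ↔ r x y
  nc : ∀ a b c d, pos X a < pos X b → pos X b < pos X c → pos X c < pos X d → r a c → r b d → r a b
  inf_X : ∀ u ∈ X, r u (u + n) → ∀ ξ, ξ ∉ X → r u ξ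
  inf_compl : ∀ ξ, ξ ∉ X → r ξ (ξ + n) → ∃ x ∈ X, r x ξ

namespace IsNoncrossing

variable {n : ℕ} {X : Set ℤ} {r : ℤ → ℤ → Prop} (hr : IsNoncrossing n X r)

include hr

theorem refl (x : ℤ) : r x x := hr.equiv.refl x

theorem symm {x y : ℤ} (h : r x y) : r y x := hr.equiv.symm h

theorem trans {x y z : ℤ} (h : r x y) (h' : r y z) : r x z := hr.equiv.trans h h'

theorem add_mul_iff (x y k : ℤ) : r (x + k * n) (y + k * n) ↔ r x y := by
  induction k using Int.induction_on with
  | zero => simp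
  | succ k ih => rw [← ih, ← hr.add_iff (x + k * n)]; ring_nf
  | pred k ih => rw [← ih, ← hr.add_iff]; ring_nf

/-- If `r u (u + n)` then `u` is related to all its translates. -/
theorem add_mul_of_add {u : ℤ} (h : r u (u + n)) (k : ℤ) : r u (u + k * n) := by
  induction k using Int.induction_on with
  | zero => simpa using hr.refl u
  | succ k ih =>
    refine hr.trans ih ?_
    have := (hr.add_mul_iff _ _ k).2 h
    rwa [show u + ((k : ℤ) + 1) * n = u + n + k * n by ring]
  | pred k ih =>
    refine hr.trans ih (hr.symm ?_)
    have := (hr.add_mul_iff _ _ (-k - 1)).2 h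
    rwa [show u + n + (-(k : ℤ) - 1) * n = u + -k * n by ring] at this

theorem add_of_rel {u v : ℤ} (huv : r u v) (h : r u (u + n)) : r v (v + n) :=
  hr.trans (hr.symm huv) (hr.trans h ((hr.add_iff _ _).2 huv))

theorem nc' {a b c d : ℤ} (h1 : pos X a < pos X b) (h2 : pos X b < pos X c)
    (h3 : pos X c < pos X d) (hac : r a c) (hbd : r b d) : r a b ∧ r a d ∧ r b c :=
  have h := hr.nc a b c d h1 h2 h3 hac hbd
  ⟨h, hr.trans h hbd, hr.trans (hr.symm h) hac⟩

variable (hX : IsPunctured n X)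

include hX

/-- If `u` is related to a nontrivial translate then it is related to `u + n`. -/
theorem add_of_add_mul (hn : 0 < n) {u k : ℤ} (hk : k ≠ 0) (h : r u (u + k * n)) :
    r u (u + n) := by
  have hn' : (0 : ℤ) < n := by exact_mod_cast hn
  have key : ∀ (k u : ℤ), 0 < k → r u (u + k * n) → r u (u + n) := by
    intro k u hk h
    rcases eq_or_lt_of_le (show 1 ≤ k by omega) with rfl | hk1
    · simpa using h
    have h' := (hr.add_iff _ _).2 h
    have e1 : (n : ℤ) < k * n := by nlinarith
    have h1 := hX.add_mem u
    have h2 := hX.add_mul_mem u k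
    have h3 := hX.add_mem (u + k * n)
    by_cases hu : u ∈ X
    · refine (hr.nc' (a := u) (b := u + n) (c := u + k * n) (d := u + k * n + n) ?_ ?_ ?_ h h').1
      all_goals rw [pos_lt_iff]; left; simp only [h1, h2, h3, hu, true_and]; omega
    · have h4 := (hr.nc' (a := u + k * n + n) (b := u + k * n) (c := u + n) (d := u)
        ?_ ?_ ?_ (hr.symm h') (hr.symm h)).2.2
      · exact hr.trans h h4
      all_goals
        rw [pos_lt_iff]; right; right
        simp only [h1, h2, h3, hu, not_false_eq_true, true_and]
        omega
  rcases lt_or_gt_of_ne hk with hk | hk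
  · have h1 := (hr.add_mul_iff _ _ (-k)).2 h
    rw [show u + k * n + -k * n = u by ring] at h1
    have h2 := key (-k) u (by omega) (hr.symm h1)
    exact h2
  · exact key k u hk h

/-- Every infinite class contains the complement of `X`. Consequently there is at most one infinite
class. -/
theorem rel_compl {u ξ : ℤ} (h : r u (u + n)) (hξ : ξ ∉ X) : r u ξ := by
  by_cases hu : u ∈ X
  · exact hr.inf_X u hu h ξ hξ
  · obtain ⟨k, hk⟩ := hX.dvd_sub ξ u hξ hu
    rw [show ξ = u + k * n by linarith]
    exact hr.add_mul_of_add h k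

theorem unbalanced_iff {u : ℤ} (h : r u (u + n)) (v : ℤ) :
    r v (v + n) ↔ r u v := by
  obtain ⟨ξ, hξ⟩ := hX.compl_nonempty
  refine ⟨fun hv => hr.trans (hr.rel_compl hX h hξ) (hr.symm (hr.rel_compl hX hv hξ)),
    fun hv => hr.add_of_rel hv h⟩

end IsNoncrossing

/-- The class of each integer for `r` is a cycle of `w`, or a pair of infinite cycles, on which
`w` maps an element to the next one. -/
structure IsNextMap {n : ℕ} (X : Set ℤ) (w : AffineW n) (r : ℤ → ℤ → Prop) : Prop extends
    IsNoncrossing n X r where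
  apply : ∀ u, r u (w.1 u)
  up : ∀ u v, r u v → pos X u < pos X (w.1 u) → pos X v ≤ pos X u ∨ pos X (w.1 u) ≤ pos X v
  wrap : ∀ u v, r u v → pos X (w.1 u) ≤ pos X u → pos X (w.1 u) ≤ pos X v ∧ pos X v ≤ pos X u

/-! ### Splitting a class -/

/-- `x` lies in the interval `(a, b]`. -/
def Between (X : Set ℤ) (a b x : ℤ) : Prop := pos X a < pos X x ∧ pos X x ≤ pos X b

/-- The relation obtained by cutting the classes of `r` along the translates of `(a, b]`. -/
def splitRel (n : ℕ) (X : Set ℤ) (a b : ℤ) (r : ℤ → ℤ → Prop) (u v : ℤ) : Prop :=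
  r u v ∧ ∀ k : ℤ, Between X a b (u + k * n) ↔ Between X a b (v + k * n)

/-- The conditions on `(a, b)` under which splitting is possible. -/
structure IsCut (n : ℕ) (X : Set ℤ) (a b : ℤ) (r : ℤ → ℤ → Prop) : Prop where
  lt : pos X a < pos X b
  rel : r a b
  not_dvd : ¬ (n : ℤ) ∣ b - a
  lt_add : r a (a + n) → b ∈ X → b < a + n

section Split

variable {n : ℕ} {X : Set ℤ} {a b : ℤ} {r : ℤ → ℤ → Prop} (hX : IsPunctured n X)

theorem splitRel.rel {u v : ℤ} (h : splitRel n X a b r u v) : r u v := h.1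

theorem splitRel.between {u v : ℤ} (h : splitRel n X a b r u v) :
    Between X a b u ↔ Between X a b v := by simpa using h.2 0

/-- A class other than that of `a` and `b` cannot cross the pair `(a, b)`, so it lies on one side of
the interval. -/
theorem IsNoncrossing.between_iff (hr : IsNoncrossing n X r) (hab : r a b) {u v : ℤ}
    (huv : r u v) (hua : ¬ r u a) : Between X a b u ↔ Between X a b v := by
  have key : ∀ u v, r u v → ¬ r u a → Between X a b u → Between X a b v := by
    rintro u v huv hua ⟨h1, h2⟩
    by_contra hv
    have hub : pos X u ≠ pos X b := pos_ne fun h => hua (h ▸ hr.symm hab)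
    have hva : pos X v ≠ pos X a := pos_ne fun h => hua (h ▸ huv)
    have h3 : pos X v < pos X a ∨ pos X b < pos X v := by
      by_contra! h4
      exact hv ⟨lt_of_le_of_ne h4.1 hva.symm, h4.2⟩
    rcases h3 with h3 | h3
    · exact hua (hr.symm (hr.nc' h3 h1 (lt_of_le_of_ne h2 hub) (hr.symm huv) hab).2.2)
    · exact hua (hr.symm (hr.nc' h1 (lt_of_le_of_ne h2 hub) h3 hab huv).1)
  exact ⟨key u v huv hua, key v u (hr.symm huv) fun h => hua (hr.trans huv h)⟩

namespace IsCut

variable (hc : IsCut n X a b r)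

include hc

theorem between_right : Between X a b b := ⟨hc.lt, le_rfl⟩

include hX

/-- Outside `X` all integers are congruent, while `a` and `b` are not; and nothing in `X` comes
after an element outside `X`. -/
theorem mem : a ∈ X := by
  by_contra ha
  have h := hc.lt
  rw [pos_lt_iff] at h
  have hb : b ∉ X := by tauto
  exact hc.not_dvd (hX.dvd_sub b a hb ha)

theorem between_iff_of_mem (hb : b ∈ X) (x : ℤ) :
    Between X a b x ↔ x ∈ X ∧ a < x ∧ x ≤ b := by
  have ha := hc.mem hX
  simp only [Between, pos_lt_iff, pos_le_iff]
  tauto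

theorem between_iff_of_notMem (hb : b ∉ X) (x : ℤ) :
    Between X a b x ↔ (x ∈ X ∧ a < x) ∨ (x ∉ X ∧ b ≤ x) := by
  have ha := hc.mem hX
  simp only [Between, pos_lt_iff, pos_le_iff]
  tauto

end IsCut

theorem exists_add_mul_gt {n : ℕ} (hn : 0 < n) (u a : ℤ) : ∃ k : ℤ, a < u + k * n := by
  refine ⟨|a - u| + 1, ?_⟩
  have h1 : (1 : ℤ) ≤ n := by exact_mod_cast hn
  have h2 := le_abs_self (a - u)
  have h3 := abs_nonneg (a - u)
  nlinarith

theorem exists_add_mul_lt {n : ℕ} (hn : 0 < n) (u a : ℤ) : ∃ k : ℤ, u + k * n < a := by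
  obtain ⟨k, hk⟩ := exists_add_mul_gt hn (-u) (-a)
  exact ⟨-k, by linarith⟩

include hX in
theorem IsNoncrossing.split (hn : 0 < n) (hr : IsNoncrossing n X r) (hc : IsCut n X a b r) :
    IsNoncrossing n X (splitRel n X a b r) := by
  have hconst : ∀ u, splitRel n X a b r u (u + n) → ∀ k : ℤ,
      Between X a b (u + k * n) ↔ Between X a b u := by
    intro u h k
    induction k using Int.induction_on with
    | zero => simp
    | succ k ih => rw [← ih, h.2 k]; ring_nf
    | pred k ih => rw [← ih, h.2 (-k - 1)]; ring_nf
  have hab := hc.rel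
  refine ⟨⟨fun x => ⟨hr.refl x, fun _ => Iff.rfl⟩, fun h => ⟨hr.symm h.1, fun k => (h.2 k).symm⟩,
    fun h h' => ⟨hr.trans h.1 h'.1, fun k => (h.2 k).trans (h'.2 k)⟩⟩, ?_, ?_, ?_, ?_⟩
  · intro x y
    refine and_congr (hr.add_iff x y) ⟨fun h k => ?_, fun h k => ?_⟩
    · have := h (k - 1)
      rwa [show x + n + (k - 1) * n = x + k * n by ring,
        show y + n + (k - 1) * n = y + k * n by ring] at this
    · have := h (k + 1)
      rwa [show x + (k + 1) * n = x + n + k * n by ring,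
        show y + (k + 1) * n = y + n + k * n by ring] at this
  · intro x y z t hxy hyz hzt hxz hyt
    refine ⟨hr.nc x y z t hxy hyz hzt hxz.1 hyt.1, fun k => ?_⟩
    have h1 := hxz.2 k
    have h2 := hyt.2 k
    rw [← hX.pos_add_mul_lt _ _ k] at hxy hyz hzt
    simp only [Between] at *
    constructor
    · intro h
      have h3 := h1.1 h
      exact ⟨h.1.trans hxy, hyz.le.trans h3.2⟩
    · intro h
      have h3 := h2.1 h
      exact h1.2 ⟨h.1.trans hyz, hzt.le.trans h3.2⟩
  · intro u hu huu ξ hξ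
    have huξ := hr.inf_X u hu huu.1 ξ hξ
    refine ⟨huξ, fun k => ?_⟩
    by_cases hua : r u a
    · by_cases hb : b ∈ X
      · have h1 : ¬ Between X a b (ξ + k * n) := by
          rw [hc.between_iff_of_mem hX hb, hX.add_mul_mem]
          exact fun h => hξ h.1
        obtain ⟨j, hj⟩ := exists_add_mul_gt hn u b
        have h2 : ¬ Between X a b (u + j * n) := by
          rw [hc.between_iff_of_mem hX hb]
          exact fun h => by omega
        rw [hconst u huu] at h2
        rw [hconst u huu]
        exact iff_of_false h2 h1
      -- With `b` outside `X`, the interval contains exactly the elements of `X` above `a`, so the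
      -- translates of `u` fall on both sides and the class of `u` cannot stay infinite.
      · exfalso
        obtain ⟨j, hj⟩ := exists_add_mul_gt hn u a
        obtain ⟨i, hi⟩ := exists_add_mul_lt hn u a
        have h1 := (hconst u huu j).trans (hconst u huu i).symm
        simp only [hc.between_iff_of_notMem hX hb, hX.add_mul_mem, hu, not_true_eq_false,
          false_and, or_false, true_and] at h1
        omega
    · refine hr.between_iff hab ((hr.add_mul_iff _ _ k).2 huξ) fun h => hua ?_
      exact hr.trans (hr.add_mul_of_add huu.1 k) h
  · intro ξ hξ hξξ
    obtain ⟨x, hx, hxξ⟩ := hr.inf_compl ξ hξ hξξ.1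
    by_cases hξa : r ξ a
    · by_cases hb : b ∈ X
      -- By the condition `b < a + n` no translate of `a` lies in the interval, so `a` stays with
      -- the elements outside `X`.
      · refine ⟨a, hc.mem hX, hr.symm hξa, fun k => ?_⟩
        have hlt := hc.lt_add (hr.add_of_rel hξa hξξ.1) hb
        rw [hc.between_iff_of_mem hX hb, hc.between_iff_of_mem hX hb, hX.add_mul_mem,
          hX.add_mul_mem]
        refine iff_of_false (fun h => ?_) fun h => hξ h.1
        have hk : 0 < k := by
          by_contra! hk
          have : k * n ≤ 0 := mul_nonpos_of_nonpos_of_nonneg hk (by omega)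
          omega
        have : (n : ℤ) ≤ k * n := le_mul_of_one_le_left (by omega) hk
        omega
      · exfalso
        obtain ⟨j, hj⟩ := exists_add_mul_gt hn ξ b
        obtain ⟨i, hi⟩ := exists_add_mul_lt hn ξ b
        have h1 := (hconst ξ hξξ j).trans (hconst ξ hξξ i).symm
        simp only [hc.between_iff_of_notMem hX hb, hX.add_mul_mem, hξ, not_false_eq_true,
          false_and, false_or, true_and] at h1
        omega
    · refine ⟨x, hx, hxξ, fun k => (hr.between_iff hab
        ((hr.add_mul_iff _ _ k).2 (hr.symm hxξ)) fun h => hξa ?_).symm⟩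
      exact hr.trans (hr.add_mul_of_add hξξ.1 k) h

variable {w : AffineW n}

-- In its class the next map enters `(a, b]` from `a` and leaves it from `b`. The reflection
-- exchanges the images of these two points, so that each part closes up. The delicate points are
-- the other translates of `a` and `b` when their class is infinite.
include hX in
theorem IsNextMap.between_split (hn : 0 < n) (hw : IsNextMap X w r) (hc : IsCut n X a b r)
    (u : ℤ) : r u ((w * affineTransp n a b hc.not_dvd).1 u) ∧
      (Between X a b u ↔ Between X a b ((w * affineTransp n a b hc.not_dvd).1 u)) := by
  have hr := hw.toIsNoncrossing
  have hab := hc.rel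
  have hlt := hc.lt
  have hn' : (1 : ℤ) ≤ n := by exact_mod_cast hn
  have ha := hc.mem hX
  have hwa : pos X a < pos X (w.1 a) := by
    by_contra! h
    exact absurd (hw.wrap a b hab h).2 (not_le.2 hlt)
  have hwab : pos X (w.1 a) ≤ pos X b := (hw.up a b hab hwa).resolve_left (not_le.2 hlt)
  have hwb : pos X b < pos X (w.1 b) ∨ pos X (w.1 b) ≤ pos X a := by
    rcases lt_or_ge (pos X b) (pos X (w.1 b)) with h | h
    · exact Or.inl h
    · exact Or.inr (hw.wrap b a (hr.symm hab) h).1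
  have hmul : ∀ k : ℤ, 0 < k → (n : ℤ) ≤ k * n := fun k hk =>
    le_mul_of_one_le_left (by omega) hk
  have hmul' : ∀ k : ℤ, k < 0 → k * n ≤ -(n : ℤ) := fun k hk => by
    have := hmul (-k) (by omega)
    linarith
  rw [AffineW.mul_apply]
  rcases transp_cases hc.not_dvd u with ⟨k, rfl, hk⟩ | ⟨k, rfl, hk⟩ | ⟨hua, hub, hu⟩
  · rw [hk, AffineW.apply_add_mul]
    have hrel : r (a + k * n) (w.1 b + k * n) :=
      (hr.add_mul_iff _ _ k).2 (hr.trans hab (hw.apply b))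
    refine ⟨hrel, ?_⟩
    by_cases hk0 : k = 0
    · subst hk0
      simp only [zero_mul, add_zero, Between]
      constructor
      · exact fun h => absurd h.1 (lt_irrefl _)
      · rintro ⟨h1, h2⟩
        rcases hwb with h | h
        · exact absurd h (not_lt.2 h2)
        · exact absurd h1 (not_lt.2 h)
    by_cases hka : r (a + k * n) a
    · have hinf : r a (a + n) := hr.add_of_add_mul hX hn hk0 (hr.symm hka)
      by_cases hb : b ∈ X
      · have hba := hc.lt_add hinf hb
        have h1 : pos X b < pos X (a + n) := by
          rw [pos_lt_iff, hX.add_mem]; exact Or.inl ⟨hb, ha, hba⟩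
        have h2 : r b (a + n) := hr.trans (hr.symm hab) hinf
        have h3 : pos X b < pos X (w.1 b) := by
          by_contra! h
          exact absurd (hw.wrap b _ h2 h).2 (not_le.2 h1)
        have h4 := (hw.up b _ h2 h3).resolve_left (not_le.2 h1)
        rw [pos_lt_iff] at h3
        rw [pos_le_iff, hX.add_mem] at h4
        rw [hc.between_iff_of_mem hX hb, hc.between_iff_of_mem hX hb]
        rcases lt_or_gt_of_ne hk0 with hk0 | hk0
        · have := hmul' k hk0
          exact iff_of_false (fun h => by omega) fun h => by grind
        · have := hmul k hk0
          exact iff_of_false (fun h => by omega) fun h => by grind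
      · have h0 : b - n ∉ X := fun h => hb (by
          rw [← hX.add_mem, sub_add_cancel] at h; exact h)
        have h1 : pos X b < pos X (b - n) := by
          rw [pos_lt_iff]; exact Or.inr (Or.inr ⟨hb, h0, by omega⟩)
        have h2 : r b (b - n) := by
          have := hr.add_mul_of_add (hr.add_of_rel hab hinf) (-1)
          rwa [show b + -1 * (n : ℤ) = b - n by ring] at this
        have h3 : pos X b < pos X (w.1 b) := by
          by_contra! h
          exact absurd (hw.wrap b _ h2 h).2 (not_le.2 h1)
        have h4 := (hw.up b _ h2 h3).resolve_left (not_le.2 h1)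
        -- The complement of `X` is one class modulo `n`, so on an infinite class the element
        -- following `b` is its nearest translate.
        have h5 : w.1 b = b - n := by
          rw [pos_lt_iff] at h3
          rw [pos_le_iff] at h4
          have h6 : w.1 b ∉ X := by tauto
          obtain ⟨j, hj⟩ := hX.dvd_sub (w.1 b) b h6 hb
          have h7 : w.1 b < b := by tauto
          have h8 : b - n ≤ w.1 b := by tauto
          have h9 : j < 0 := by nlinarith
          have := hmul' j h9
          linarith
        rw [h5, hc.between_iff_of_notMem hX hb, hc.between_iff_of_notMem hX hb, hX.add_mul_mem,
          hX.add_mul_mem]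
        simp only [ha, h0, not_true_eq_false, not_false_eq_true, false_and, or_false, false_or,
          true_and]
        rcases lt_or_gt_of_ne hk0 with hk0 | hk0
        · have := hmul' k hk0; omega
        · have := hmul k hk0; omega
    · exact hr.between_iff hab hrel hka
  · rw [hk, AffineW.apply_add_mul]
    have hrel : r (b + k * n) (w.1 a + k * n) :=
      (hr.add_mul_iff _ _ k).2 (hr.trans (hr.symm hab) (hw.apply a))
    refine ⟨hrel, ?_⟩
    by_cases hk0 : k = 0
    · subst hk0
      simp only [zero_mul, add_zero]
      exact iff_of_true hc.between_right ⟨hwa, hwab⟩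
    by_cases hka : r (b + k * n) a
    · have hinf : r a (a + n) := hr.add_of_rel (hr.symm hab)
        (hr.add_of_add_mul hX hn hk0 (hr.symm (hr.trans hka hab)))
      by_cases hb : b ∈ X
      · have hba := hc.lt_add hinf hb
        rw [pos_lt_iff] at hwa
        rw [pos_le_iff] at hwab
        rw [hc.between_iff_of_mem hX hb, hc.between_iff_of_mem hX hb]
        rcases lt_or_gt_of_ne hk0 with hk0 | hk0
        · have := hmul' k hk0
          exact iff_of_false (fun h => by omega) fun h => by grind
        · have := hmul k hk0
          exact iff_of_false (fun h => by omega) fun h => by grind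
      · have h1 : pos X a < pos X (a + n) := by
          rw [pos_lt_iff, hX.add_mem]; exact Or.inl ⟨ha, ha, by omega⟩
        have h4 := (hw.up a _ hinf hwa).resolve_left (not_le.2 h1)
        rw [pos_lt_iff] at hwa
        rw [pos_le_iff, hX.add_mem] at h4
        have h5 : w.1 a ∈ X := by tauto
        have h6 : a < w.1 a := by tauto
        have h7 : w.1 a ≤ a + n := by tauto
        rw [hc.between_iff_of_notMem hX hb, hc.between_iff_of_notMem hX hb, hX.add_mul_mem,
          hX.add_mul_mem]
        simp only [hb, h5, not_true_eq_false, not_false_eq_true, false_and, or_false, false_or,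
          true_and]
        rcases lt_or_gt_of_ne hk0 with hk0 | hk0
        · have := hmul' k hk0; omega
        · have := hmul k hk0; omega
    · exact hr.between_iff hab hrel fun h => hka h
  · rw [hu]
    refine ⟨hw.apply u, ?_⟩
    by_cases hra : r u a
    · have hua' : pos X u ≠ pos X a := pos_ne fun h => hua (by simp [h])
      have hub' : pos X u ≠ pos X b := pos_ne fun h => hub (by simp [h])
      have hrb := hr.trans hra hab
      have hup := hw.up u
      have hwr := hw.wrap u
      rcases lt_or_ge (pos X u) (pos X (w.1 u)) with h | h
      · have h1 := hup a hra h
        have h2 := hup b hrb h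
        unfold Between
        constructor
        · rintro ⟨h3, h4⟩
          exact ⟨h3.trans h, h2.resolve_left fun h5 => hub' (le_antisymm h4 h5)⟩
        · rintro ⟨h3, h4⟩
          refine ⟨?_, h.le.trans h4⟩
          rcases h1 with h1 | h1
          · exact lt_of_le_of_ne h1 hua'.symm
          · exact absurd h3 (not_lt.2 h1)
      · have h1 := hwr a hra h
        have h2 := hwr b hrb h
        unfold Between
        refine iff_of_false (fun h3 => hub' (le_antisymm h3.2 h2.2)) fun h3 => ?_
        exact absurd h3.1 (not_lt.2 h1.1)
    · exact hr.between_iff hab (hw.apply u) hra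

include hX in
theorem IsNextMap.split (hn : 0 < n) (hw : IsNextMap X w r) (hc : IsCut n X a b r) :
    IsNextMap X (w * affineTransp n a b hc.not_dvd) (splitRel n X a b r) := by
  have hr := hw.toIsNoncrossing
  have hr' := hr.split hX hn hc
  have hab := hc.rel
  have hlt := hc.lt
  let w' := w * affineTransp n a b hc.not_dvd
  have hbtw := hw.between_split hX hn hc
  have happ : ∀ u, splitRel n X a b r u (w'.1 u) := by
    refine fun u => ⟨(hbtw u).1, fun k => ?_⟩
    rw [← AffineW.apply_add_mul]
    exact (hbtw _).2
  have hwa : w'.1 a = w.1 b := by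
    change (w * affineTransp n a b hc.not_dvd).1 a = _
    rw [AffineW.mul_apply, transp_left']
  have hwb : w'.1 b = w.1 a := by
    change (w * affineTransp n a b hc.not_dvd).1 b = _
    rw [AffineW.mul_apply, transp_right']
  have main : ∀ u v, splitRel n X a b r u v →
      (pos X u < pos X (w'.1 u) → pos X v ≤ pos X u ∨ pos X (w'.1 u) ≤ pos X v) ∧
      (pos X (w'.1 u) ≤ pos X u → pos X (w'.1 u) ≤ pos X v ∧ pos X v ≤ pos X u) := by
    -- Both properties are invariant under translation, which leaves only the points `a`, `b` and
    -- those not congruent to either.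
    have red : ∀ u k : ℤ, (∀ v, splitRel n X a b r u v →
      (pos X u < pos X (w'.1 u) → pos X v ≤ pos X u ∨ pos X (w'.1 u) ≤ pos X v) ∧
      (pos X (w'.1 u) ≤ pos X u → pos X (w'.1 u) ≤ pos X v ∧ pos X v ≤ pos X u)) →
      ∀ v, splitRel n X a b r (u + k * n) v →
      (pos X (u + k * n) < pos X (w'.1 (u + k * n)) →
        pos X v ≤ pos X (u + k * n) ∨ pos X (w'.1 (u + k * n)) ≤ pos X v) ∧
      (pos X (w'.1 (u + k * n)) ≤ pos X (u + k * n) →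
        pos X (w'.1 (u + k * n)) ≤ pos X v ∧ pos X v ≤ pos X (u + k * n)) := by
      intro u k h v huv
      obtain ⟨v, rfl⟩ : ∃ v', v = v' + k * n := ⟨v - k * n, by ring⟩
      rw [hr'.add_mul_iff] at huv
      simp only [AffineW.apply_add_mul, hX.pos_add_mul_lt, hX.pos_add_mul_le]
      exact h v huv
    intro u
    rcases transp_cases hc.not_dvd u with ⟨k, rfl, -⟩ | ⟨k, rfl, -⟩ | ⟨-, -, hu⟩
    · refine red a k fun v hv => ?_
      rw [hwa]
      have h1 := hv.between
      have h2 : ¬ Between X a b v := fun h => lt_irrefl _ (h1.2 h).1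
      have h3 : pos X v ≤ pos X a ∨ pos X b < pos X v := by
        by_contra! h4
        exact h2 h4
      have h4 := hr.trans (hr.symm hab) hv.rel
      have h5 := hw.up b v h4
      have h6 := hw.wrap b v h4
      have h7 := hw.wrap b a (hr.symm hab)
      constructor
      · intro h8
        rcases h3 with h3 | h3
        · exact Or.inl h3
        · rcases lt_or_ge (pos X b) (pos X (w.1 b)) with h9 | h9
          · exact Or.inr ((h5 h9).resolve_left (not_le.2 h3))
          · exact Or.inr (h6 h9).1
      · intro h8
        have h9 : pos X (w.1 b) ≤ pos X b := h8.trans hlt.le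
        refine ⟨(h6 h9).1, ?_⟩
        rcases h3 with h3 | h3
        · exact h3
        · exact absurd (h6 h9).2 (not_le.2 h3)
    · refine red b k fun v hv => ?_
      rw [hwb]
      have h2 : Between X a b v := hv.between.1 hc.between_right
      have h4 := hr.trans hab hv.rel
      have h5 := hw.up a v h4
      have hwa' : pos X a < pos X (w.1 a) := by
        by_contra! h
        exact absurd (hw.wrap a b hab h).2 (not_le.2 hlt)
      have h6 := (h5 hwa').resolve_left (not_le.2 h2.1)
      exact ⟨fun _ => Or.inl h2.2, fun _ => ⟨h6, h2.2⟩⟩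
    · intro v hv
      have : w'.1 u = w.1 u := by
        change (w * affineTransp n a b hc.not_dvd).1 u = _
        rw [AffineW.mul_apply, hu]
      rw [this]
      exact ⟨hw.up u v hv.rel, hw.wrap u v hv.rel⟩
  exact { hr' with
    apply := happ
    up := fun u v h => (main u v h).1
    wrap := fun u v h => (main u v h).2 }

end Split

/-! ### The rank of a noncrossing relation -/

namespace AffineW

variable {n : ℕ} [NeZero n]

theorem shift_add (w : AffineW n) (f g : ZMod n → ℚ) : shift w (f + g) = shift w f + shift w g := by
  simp only [shift, Pi.add_apply, add_mul, Finset.sum_add_distrib]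

/-- Modulo `n` a reflection is known only up to a translation of one endpoint; the shift detects
that translation. -/
theorem shift_mul_transp_add (w : AffineW n) {a b k : ℤ} (h : ¬ (n : ℤ) ∣ b - a)
    (h' : ¬ (n : ℤ) ∣ b + k * n - a) (f : ZMod n → ℚ) :
    shift (w * affineTransp n a (b + k * n) h') f =
      shift (w * affineTransp n a b h) f + (f a - f b) * (k * n) := by
  have e : ((b + k * n : ℤ) : ZMod n) = b := by simp
  have h1 : ∀ (d : ℤ) (hd : ¬ (n : ℤ) ∣ d - a), shift (w * affineTransp n a d hd) f =
      ∑ z, f z * disp w (Equiv.swap (a : ZMod n) d z) + (f a - f d) * (d - a) := by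
    intro d hd
    rw [← shift_transp hd, shift, shift, ← Finset.sum_add_distrib]
    exact Finset.sum_congr rfl fun z _ => by rw [disp_mul, bar_transp]; ring
  rw [h1, h1, e]
  push_cast
  ring

theorem invar_mul_transp_add (w : AffineW n) {a b k : ℤ} (h : ¬ (n : ℤ) ∣ b - a)
    (h' : ¬ (n : ℤ) ∣ b + k * n - a) :
    invar (w * affineTransp n a (b + k * n) h') = invar (w * affineTransp n a b h) := by
  have e : ((b + k * n : ℤ) : ZMod n) = b := by simp
  ext f
  simp only [mem_invar, bar_mul, bar_transp, e]

/-- A multiplicatively closed subspace of codimension at most one. -/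
theorem shift_add_eq_zero {w : AffineW n} {U : Submodule ℚ (ZMod n → ℚ)}
    (hU1 : ∀ f ∈ U, ∀ g ∈ U, f * g ∈ U) (hU2 : U ≤ invar w) (hU3 : ∀ f ∈ U, shift w f = 0)
    (hU4 : Module.finrank ℚ (invar w) ≤ Module.finrank ℚ U + 1) {f g : ZMod n → ℚ}
    (hf : f ∈ invar w) (hg : g ∈ invar w) (hff : f * f = f) (hgg : g * g = g) (hfg : f * g = 0)
    (hf0 : shift w f ≠ 0) (hg0 : shift w g ≠ 0) : shift w f + shift w g = 0 := by
  have hgU : g ∉ U := fun h => hg0 (hU3 g h)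
  have hlt : U < U ⊔ Submodule.span ℚ {g} := lt_of_le_of_ne le_sup_left fun h => hgU (by
    rw [h]; exact Submodule.mem_sup_right (Submodule.mem_span_singleton_self g))
  have hle : U ⊔ Submodule.span ℚ {g} ≤ invar w := sup_le hU2 (by simpa using hg)
  have heq := Submodule.eq_of_le_of_finrank_le hle
    (hU4.trans (Submodule.finrank_lt_finrank_of_lt hlt))
  rw [← heq] at hf
  obtain ⟨u, hu, v, hv, rfl⟩ := Submodule.mem_sup.1 hf
  obtain ⟨t, rfl⟩ := Submodule.mem_span_singleton.1 hv
  -- The invariants are the sum of `U` and the line of `g`, so `f = u + t g` with `u` in `U`. Then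
  -- `u² - u = (t² + t) g` lies in `U`, which forces `t = 0` or `t = -1`. The first would give `f`
  -- shift zero, and the second puts `f + g` in `U`.
  have hu' : u = u + t • g + (-t) • g := by module
  have hug : u * g = (-t) • g := by
    have : (u + t • g) * g = u * g + t • (g * g) := by rw [add_mul, smul_mul_assoc]
    rw [hfg, hgg] at this
    rw [neg_smul]
    exact eq_neg_of_add_eq_zero_left this.symm
  have huu : u * u = u + (t * t + t) • g := by
    have : (u + t • g) * (u + t • g) = u * u + (2 * t) • (u * g) + (t * t) • (g * g) := by
      simp only [add_mul, mul_add, smul_mul_assoc, mul_smul_comm, mul_comm g u]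
      module
    rw [hff, hug, hgg] at this
    have h2 : u * u = u + t • g - (2 * t) • (-t) • g - (t * t) • g := by rw [this]; module
    rw [h2]
    module
  have h1 : (t * t + t) • g ∈ U := by
    have := U.sub_mem (hU1 u hu u hu) hu
    rwa [huu, add_sub_cancel_left] at this
  have h2 : t * t + t = 0 := by
    by_contra h
    apply hgU
    have := U.smul_mem (t * t + t)⁻¹ h1
    rwa [smul_smul, inv_mul_cancel₀ h, one_smul] at this
  have h3 : t = 0 ∨ t = -1 := by
    have : t * (t + 1) = 0 := by linarith
    rcases mul_eq_zero.1 this with h | h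
    · exact Or.inl h
    · exact Or.inr (by linarith)
  rcases h3 with rfl | rfl
  · exact absurd (hU3 u hu) (by simpa using hf0)
  · rw [← shift_add, show u + (-1 : ℚ) • g + g = u by module]
    exact hU3 u hu

end AffineW

open AffineW

section Rank

variable {n : ℕ} {X : Set ℤ} {r : ℤ → ℤ → Prop}

/-- The image in `ℤ/nℤ` of the class of `b`, as a set of integers. -/
def cls (n : ℕ) (r : ℤ → ℤ → Prop) (b : ℤ) : Set ℤ := {x | ∃ k : ℤ, r x (b + k * n)}

open scoped Classical in
/-- Twice the number of infinite classes. -/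
noncomputable def twiceInf (n : ℕ) (r : ℤ → ℤ → Prop) : ℕ := if ∃ u : ℤ, r u (u + n) then 2 else 0

theorem twiceInf_of_exists {u : ℤ} (h : r u (u + n)) : twiceInf n r = 2 := if_pos ⟨u, h⟩

theorem twiceInf_of_forall (h : ∀ u : ℤ, ¬ r u (u + n)) : twiceInf n r = 0 :=
  if_neg fun ⟨u, hu⟩ => h u hu

namespace IsNoncrossing

variable (hr : IsNoncrossing n X r)

include hr

theorem cls_periodic (b x : ℤ) : x + (n : ℤ) ∈ cls n r b ↔ x ∈ cls n r b := by
  constructor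
  · rintro ⟨k, hk⟩
    refine ⟨k - 1, (hr.add_iff _ _).1 ?_⟩
    rwa [show b + (k - 1) * n + n = b + k * n by ring]
  · rintro ⟨k, hk⟩
    refine ⟨k + 1, ?_⟩
    rw [show b + (k + 1) * n = b + k * n + n by ring]
    exact (hr.add_iff _ _).2 hk

theorem self_mem_cls (b : ℤ) : b ∈ cls n r b := ⟨0, by simpa using hr.refl b⟩

theorem mem_cls_of_rel {b x y : ℤ} (h : r x y) (hy : y ∈ cls n r b) : x ∈ cls n r b := by
  obtain ⟨k, hk⟩ := hy
  exact ⟨k, hr.trans h hk⟩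

end IsNoncrossing

/-- The part of `b` lies in `(a, b]`, which misses `a`. If it reached a translate of `a`, the class
would be infinite, and then `(a, b]` is too short to contain a translate of `a`. -/
theorem IsCut.notMem_cls (hX : IsPunctured n X) (hn : 0 < n) (hr : IsNoncrossing n X r) {a b : ℤ}
    (hc : IsCut n X a b r) (hb : r a (a + n) → b ∈ X) : a ∉ cls n (splitRel n X a b r) b := by
  rintro ⟨k, hk⟩
  by_cases hk0 : k = 0
  · subst hk0
    rw [zero_mul, add_zero] at hk
    exact lt_irrefl _ (hk.between.2 hc.between_right).1
  · have h3 : r b (b + n) := hr.add_of_add_mul hX hn hk0 (hr.trans (hr.symm hc.rel) hk.rel)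
    have h4 : r a (a + n) := hr.add_of_rel (hr.symm hc.rel) h3
    have hlt := hc.lt_add h4 (hb h4)
    have h5 := hk.2 (-k)
    rw [show b + k * n + -k * n = b by ring, iff_true_right hc.between_right,
      hc.between_iff_of_mem hX (hb h4)] at h5
    obtain ⟨-, h6, h7⟩ := h5
    have hk1 : 0 < -k := by
      by_contra! hk
      have : -k * n ≤ 0 := mul_nonpos_of_nonpos_of_nonneg hk (by omega)
      omega
    have : (n : ℤ) ≤ -k * n := le_mul_of_one_le_left (by omega) hk1
    omega

theorem IsCut.not_splitRel_add (hX : IsPunctured n X) (hn : 0 < n) (hr : IsNoncrossing n X r)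
    {a b : ℤ} (hc : IsCut n X a b r) (hb : r a (a + n) → b ∈ X) :
    ¬ splitRel n X a b r b (b + n) := by
  intro h
  have h3 := hb (hr.add_of_rel (hr.symm hc.rel) h.rel)
  have h4 := h.between.1 hc.between_right
  rw [hc.between_iff_of_mem hX h3] at h4
  omega

namespace IsNextMap

variable {w : AffineW n} (hw : IsNextMap X w r)

include hw

theorem apply_mem_cls (b x : ℤ) : w.1 x ∈ cls n r b ↔ x ∈ cls n r b :=
  ⟨hw.mem_cls_of_rel (hw.apply x), hw.mem_cls_of_rel (hw.symm (hw.apply x))⟩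

variable [NeZero n] (hX : IsPunctured n X)

include hX

/-- In the infinite class each element is followed by a translate on the same side of `X`, so the
next element does not change sides. Once an infinite class exists it contains the complement of `X`,
and all finite classes lie in `X`. -/
theorem apply_mem_inf {u x : ℤ} (hu : r u (u + n)) : w.1 x ∈ X ↔ x ∈ X := by
  have hn : (0 : ℤ) < n := by exact_mod_cast NeZero.pos n
  have key : ∀ x : ℤ, r x (x + n) → x ∈ X → w.1 x ∈ X ∧ x < w.1 x := by
    intro x hx hxX
    have h1 : pos X x < pos X (x + n) := by
      rw [pos_lt_iff, hX.add_mem]; exact Or.inl ⟨hxX, hxX, by omega⟩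
    have h2 : pos X x < pos X (w.1 x) := by
      by_contra! h
      exact absurd (hw.wrap x _ hx h).2 (not_le.2 h1)
    have h3 := (hw.up x _ hx h2).resolve_left (not_le.2 h1)
    rw [pos_le_iff, hX.add_mem] at h3
    rw [pos_lt_iff] at h2
    tauto
  by_cases hx : r x (x + n)
  · refine ⟨fun h => ?_, fun h => (key x hx h).1⟩
    by_contra hxX
    have h0 : x - n ∉ X := fun h => hxX (by
      rw [← hX.add_mem, sub_add_cancel] at h; exact h)
    have h1 : pos X x < pos X (x - n) := by
      rw [pos_lt_iff]; exact Or.inr (Or.inr ⟨hxX, h0, by omega⟩)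
    have h2 : r x (x - n) := by
      have := hw.add_mul_of_add hx (-1)
      rwa [show x + -1 * (n : ℤ) = x - n by ring] at this
    have h3 : pos X x < pos X (w.1 x) := by
      by_contra! h
      exact absurd (hw.wrap x _ h2 h).2 (not_le.2 h1)
    rw [pos_lt_iff] at h3
    tauto
  · have hmem : ∀ y, ¬ r y (y + n) → y ∈ X := by
      intro y hy
      by_contra hyX
      exact hy (hw.add_of_rel (hw.rel_compl hX hu hyX) hu)
    exact iff_of_true (hmem _ fun h => hx (hw.add_of_rel (hw.symm (hw.apply x)) h)) (hmem _ hx)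

theorem lt_apply_inf {x : ℤ} (hx : r x (x + n)) (hxX : x ∈ X) : x < w.1 x := by
  have hn : (0 : ℤ) < n := by exact_mod_cast NeZero.pos n
  have h1 : pos X x < pos X (x + n) := by
    rw [pos_lt_iff, hX.add_mem]; exact Or.inl ⟨hxX, hxX, by omega⟩
  have h2 : pos X x < pos X (w.1 x) := by
    by_contra! h
    exact absurd (hw.wrap x _ hx h).2 (not_le.2 h1)
  rw [pos_lt_iff, hw.apply_mem_inf hX hx] at h2
  tauto

theorem apply_lt_inf {x : ℤ} (hx : r x (x + n)) (hxX : x ∉ X) : w.1 x < x := by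
  have hn : (0 : ℤ) < n := by exact_mod_cast NeZero.pos n
  have h0 : x - n ∉ X := fun h => hxX (by
    rw [← hX.add_mem, sub_add_cancel] at h; exact h)
  have h1 : pos X x < pos X (x - n) := by
    rw [pos_lt_iff]; exact Or.inr (Or.inr ⟨hxX, h0, by omega⟩)
  have h2 : r x (x - n) := by
    have := hw.add_mul_of_add hx (-1)
    rwa [show x + -1 * (n : ℤ) = x - n by ring] at this
  have h3 : pos X x < pos X (w.1 x) := by
    by_contra! h
    exact absurd (hw.wrap x _ h2 h).2 (not_le.2 h1)
  rw [pos_lt_iff] at h3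
  tauto

/-- On a finite class each residue has a unique representative, and the displacement is the
difference of consecutive representatives, so the sum telescopes along `bar w`. -/
theorem shift_ind_cls {b : ℤ} (hb : ¬ r b (b + n)) : shift w (ind n (cls n r b)) = 0 := by
  classical
  have huniq : ∀ x y : ℤ, r x b → r y b → (x : ZMod n) = y → x = y := by
    intro x y hx hy hxy
    rw [ZMod.intCast_eq_intCast_iff_dvd_sub] at hxy
    obtain ⟨k, hk⟩ := hxy
    by_contra hne
    have hk0 : k ≠ 0 := by rintro rfl; apply hne; linarith
    have e : y = x + k * n := by linarith
    have h1 := hw.add_of_add_mul hX (NeZero.pos n) hk0 (e ▸ hw.trans hx (hw.symm hy))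
    exact hb (hw.add_of_rel hx h1)
  let β : ZMod n → ℤ := fun z => if h : ∃ y : ℤ, (y : ZMod n) = z ∧ r y b then h.choose else 0
  have hβ : ∀ x : ℤ, r x b → β x = x := by
    intro x hx
    have h : ∃ y : ℤ, (y : ZMod n) = (x : ZMod n) ∧ r y b := ⟨x, rfl, hx⟩
    simp only [β, dif_pos h]
    exact huniq _ _ h.choose_spec.2 hx h.choose_spec.1
  have hβ0 : ∀ x : ℤ, x ∉ cls n r b → β x = 0 := by
    intro x hx
    simp only [β]
    rw [dif_neg]
    rintro ⟨y, hy, hyb⟩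
    apply hx
    rw [mem_congr_of_periodic (hw.cls_periodic b) (y := y)]
    · exact ⟨0, by simpa using hyb⟩
    · rwa [← ZMod.intCast_eq_intCast_iff_dvd_sub]
  have hterm : ∀ z, ind n (cls n r b) z * disp w z = (β (bar w z) : ℚ) - β z := by
    intro z
    obtain ⟨x, rfl⟩ := ZMod.intCast_surjective z
    by_cases hx : x ∈ cls n r b
    · obtain ⟨k, hk⟩ := hx
      obtain ⟨y, rfl⟩ : ∃ y, x = y + k * n := ⟨x - k * n, by ring⟩
      rw [hw.add_mul_iff] at hk
      have e : ((y + k * n : ℤ) : ZMod n) = y := by simp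
      rw [e, ind_of_mem (hw.cls_periodic b) ⟨0, by simpa using hk⟩, bar_intCast, disp_intCast,
        hβ y hk, hβ _ (hw.trans (hw.symm (hw.apply y)) hk), one_mul]
    · rw [ind_of_notMem (hw.cls_periodic b) hx, bar_intCast, hβ0 x hx,
        hβ0 _ (by rwa [hw.apply_mem_cls])]
      simp
  rw [shift, Finset.sum_congr rfl fun z _ => hterm z, Finset.sum_sub_distrib,
    Equiv.sum_comp (bar w) fun z => (β z : ℚ), sub_self]

omit hX in
theorem ind_cls_mem (b : ℤ) : ind n (cls n r b) ∈ invar w :=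
  ind_mem_invar (hw.cls_periodic b) (hw.apply_mem_cls b)

theorem ind_X_mem {u : ℤ} (hu : r u (u + n)) : ind n X ∈ invar w :=
  ind_mem_invar hX.add_mem fun _ => hw.apply_mem_inf hX hu

/-- Splitting lowers the rank by one. -/
theorem rank_split {a b : ℤ} (hc : IsCut n X a b r) :
    Module.finrank ℚ (invar (w * affineTransp n a b hc.not_dvd)) + twiceInf n r =
      Module.finrank ℚ (invar w) + twiceInf n (splitRel n X a b r) + 1 := by
  have hn := NeZero.pos n
  have hw' := hw.split hX hn hc
  have ha := hc.mem hX
  -- A cut of the infinite class with `b` outside `X` joins its two cycles modulo `n` and destroys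
  -- the infinite class: one invariant dimension is lost against a drop of two in `twiceInf`. Any
  -- other cut splits one cycle and preserves `twiceInf`.
  by_cases hS : r a (a + n) ∧ b ∉ X
  · have h1 := twiceInf_of_exists hS.1
    have h2 : twiceInf n (splitRel n X a b r) = 0 := by
      refine twiceInf_of_forall fun u hu => ?_
      have hb : splitRel n X a b r b (b + n) := by
        obtain ⟨x, hx⟩ := hX.compl_nonempty
        have h3 := hw'.add_of_rel (hw'.rel_compl hX hu hS.2) hu
        exact h3
      have h3 := hw'.add_mul_of_add hb (-1)
      have h4 := h3.between.1 hc.between_right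
      rw [hc.between_iff_of_notMem hX hS.2, hX.add_mul_mem] at h4
      have := hS.2
      have hn' : (0 : ℤ) < n := by exact_mod_cast hn
      rcases h4 with h4 | h4
      · tauto
      · linarith [h4.2]
    have h3 : ¬ invar w ≤ agree a b := fun h => by
      have := h (hw.ind_X_mem hX hS.1)
      rw [mem_agree, ind_of_mem hX.add_mem ha, ind_of_notMem hX.add_mem hS.2] at this
      exact one_ne_zero this
    have := finrank_invar_mul_transp_of_not_le w hc.not_dvd h3
    omega
  · have h1 : twiceInf n (splitRel n X a b r) = twiceInf n r := by
      by_cases hu : ∃ u : ℤ, r u (u + n)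
      · obtain ⟨u, hu⟩ := hu
        rw [twiceInf_of_exists hu]
        by_cases haa : r a (a + n)
        · refine twiceInf_of_exists (u := a) ⟨haa, fun k => ?_⟩
          have hb : b ∈ X := by tauto
          have hlt := hc.lt_add haa hb
          have hmul : ∀ k : ℤ, 0 < k → (n : ℤ) ≤ k * n := fun k hk =>
            le_mul_of_one_le_left (by omega) hk
          have hk : ∀ k : ℤ, ¬ Between X a b (a + k * n) := by
            intro k
            rw [hc.between_iff_of_mem hX hb]
            rintro ⟨-, h2, h3⟩
            have hk0 : 0 < k := by
              by_contra! hk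
              have : k * n ≤ 0 := mul_nonpos_of_nonpos_of_nonneg hk (by omega)
              omega
            have := hmul k hk0
            omega
          refine iff_of_false (hk k) ?_
          rw [show a + n + k * n = a + (k + 1) * n by ring]
          exact hk _
        · refine twiceInf_of_exists (u := u) ⟨hu, fun k => ?_⟩
          refine hw.between_iff hc.rel ((hw.add_mul_iff _ _ k).2 hu) fun h => haa ?_
          exact hw.add_of_rel (hw.trans (hw.add_mul_of_add hu k) h) hu
      · push Not at hu
        rw [twiceInf_of_forall hu, twiceInf_of_forall fun u h => hu u h.rel]
    have h2 : ¬ invar (w * affineTransp n a b hc.not_dvd) ≤ agree a b := by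
      intro h
      have := h (hw'.ind_cls_mem b)
      rw [mem_agree, ind_of_mem (hw'.cls_periodic b) (hw'.self_mem_cls b)] at this
      rw [ind_of_notMem (hw'.cls_periodic b)
        (hc.notMem_cls hX hn hw.toIsNoncrossing fun h => by tauto)] at this
      exact zero_ne_one this
    have h3 := finrank_invar_mul_transp_of_not_le _ hc.not_dvd h2
    rw [mul_assoc, transp_mul_self, mul_one] at h3
    omega

end IsNextMap

end Rank

/-! ### Reflections that lower the length -/

open AffineW

section Indicator

variable {n : ℕ} {A B : Set ℤ}

theorem ind_mul_self : ind n A * ind n A = ind n A := by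
  classical
  funext z
  simp only [Pi.mul_apply, ind]
  split_ifs <;> simp

theorem ind_mul_eq_zero (h : ∀ x ∈ A, x ∉ B) : ind n A * ind n B = 0 := by
  classical
  funext z
  simp only [Pi.mul_apply, ind, Pi.zero_apply]
  split_ifs with h1 h2
  · exact absurd h2 (h _ h1)
  all_goals simp

variable (hA : ∀ x : ℤ, x + (n : ℤ) ∈ A ↔ x ∈ A) {a b : ℤ} (h : ¬ (n : ℤ) ∣ b - a)
  (ha : a ∉ A) (hb : b ∉ A) (w : AffineW n)

include hA ha hb

theorem mul_transp_apply_of_mem {x : ℤ} (hx : x ∈ A) :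
    (w * affineTransp n a b h).1 x = w.1 x := by
  rw [AffineW.mul_apply, transp_other h (fun hd => ?_) fun hd => ?_]
  · exact ha ((mem_congr_of_periodic hA hd).1 hx)
  · exact hb ((mem_congr_of_periodic hA hd).1 hx)

theorem mul_transp_apply_mem_iff (hw : ∀ x, w.1 x ∈ A ↔ x ∈ A) (x : ℤ) :
    (w * affineTransp n a b h).1 x ∈ A ↔ x ∈ A := by
  by_cases hx : x ∈ A
  · rw [mul_transp_apply_of_mem hA h ha hb w hx, hw]
  · rw [AffineW.mul_apply, hw]
    have key : ∀ y k : ℤ, y + k * n ∈ A ↔ y ∈ A := fun y k =>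
      mem_congr_of_periodic hA ⟨k, by ring⟩
    rcases transp_cases h x with ⟨k, rfl, hk⟩ | ⟨k, rfl, hk⟩ | ⟨-, -, hk⟩
    · rw [hk, key, key]; tauto
    · rw [hk, key, key]; tauto
    · rw [hk]

end Indicator

section Forced

variable {n : ℕ} {X : Set ℤ} {r : ℤ → ℤ → Prop} {w : AffineW n}

/-- A reflection exchanging two classes modulo `n` that meet a common class of `r` is, up to a
translation, a cut of `r`. -/
theorem IsNoncrossing.exists_isCut_add_mul (hX : IsPunctured n X) (hn : 0 < n)
    (hr : IsNoncrossing n X r) {a b k : ℤ} (h : ¬ (n : ℤ) ∣ b - a) (hab : r a (b + k * n))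
    (hinf : r a (a + n) → a ∈ X ∧ b ∈ X) :
    ∃ (a' b' j : ℤ) (_ : IsCut n X a' b' r) (h' : ¬ (n : ℤ) ∣ b' + j * n - a'),
      affineTransp n a' (b' + j * n) h' = affineTransp n a b h ∧ (r a' (a' + n) → b' ∈ X) ∧
        (r a (a + n) → r a' (a' + n)) := by
  have hdvd : ∀ i : ℤ, ¬ (n : ℤ) ∣ b + i * n - a := by
    rintro i ⟨c, hc⟩
    exact h ⟨c - i, by linarith⟩
  by_cases haa : r a (a + n)
  · obtain ⟨ha, hb⟩ := hinf haa
    have hn' : (0 : ℤ) < n := by exact_mod_cast hn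
    have e := Int.emod_add_mul_ediv (b - a) n
    have h1 := Int.emod_nonneg (b - a) hn'.ne'
    have h2 := Int.emod_lt_of_pos (b - a) hn'
    have h3 : (b - a) % n ≠ 0 := fun h0 => h (Int.dvd_of_emod_eq_zero h0)
    -- The translate of `b` lying strictly between `a` and `a + n`, as a cut of an infinite class
    -- requires.
    set i := -((b - a) / n) with hi
    have e' : b + i * n = a + (b - a) % n := by rw [hi]; linarith
    have hbX : b + i * n ∈ X := (hX.add_mul_mem b i).2 hb
    have hai : r a (b + i * n) := by
      have h4 := hr.add_mul_of_add (hr.add_of_rel hab haa) (i - k)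
      rw [show b + k * n + (i - k) * n = b + i * n by ring] at h4
      exact hr.trans hab h4
    have e2 : b + i * n + -i * n = b := by ring
    refine ⟨a, b + i * n, -i, ⟨?_, hai, hdvd i, fun _ _ => by omega⟩, by rwa [e2], ?_,
      fun _ => hbX, id⟩
    · rw [pos_lt_iff]; exact Or.inl ⟨ha, hbX, by omega⟩
    · congr 1
  · have hfin : ∀ c d : ℤ, r c a → r c (c + n) → d ∈ X → d < c + n := fun c d hca hcc =>
      absurd (hr.add_of_rel hca hcc) haa
    rcases lt_or_gt_of_ne (pos_ne (X := X) (x := a) (y := b + k * n)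
      fun h0 => hdvd k (by rw [← h0, sub_self]; exact dvd_zero _)) with hlt | hlt
    · have e2 : b + k * n + -k * n = b := by ring
      refine ⟨a, b + k * n, -k, ⟨hlt, hab, hdvd k, hfin _ _ (hr.refl _)⟩, by rwa [e2], ?_,
        fun h0 => absurd h0 haa, id⟩
      congr 1
    · have h4 : ¬ (n : ℤ) ∣ a - (b + k * n) := by
        rw [← dvd_neg, neg_sub]; exact hdvd k
      have h5 : ¬ (n : ℤ) ∣ a + k * n - (b + k * n) := by
        rwa [add_sub_add_right_eq_sub, ← dvd_neg, neg_sub]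
      refine ⟨b + k * n, a, k, ⟨hlt, hr.symm hab, h4, hfin _ _ (hr.symm hab)⟩, h5, ?_,
        fun h0 => absurd (hr.add_of_rel (hr.symm hab) h0) haa, fun h0 => absurd h0 haa⟩
      rw [← transp_comm h, ← transp_add_mul (a := b) (b := a) _ k]

variable [NeZero n] (hn : 2 ≤ n) (hX : IsPunctured n X) (hw : IsNextMap X w r)

include hX hw

/-- The complement of `X` is one class modulo `n`, and an infinite class moves it down to the
nearest translate, by `n`. -/
theorem IsNextMap.shift_ind_compl {u : ℤ} (hu : r u (u + n)) : shift w (ind n Xᶜ) = -n := by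
  have hn' : (0 : ℤ) < n := by exact_mod_cast NeZero.pos n
  obtain ⟨ξ, hξ⟩ := hX.compl_nonempty
  have hXc : ∀ x : ℤ, x + (n : ℤ) ∈ Xᶜ ↔ x ∈ Xᶜ := fun x => not_congr (hX.add_mem x)
  have hξξ := hw.add_of_rel (hw.rel_compl hX hu hξ) hu
  have h0 : ξ - n ∉ X := fun h => hξ (by
    rw [← hX.add_mem, sub_add_cancel] at h; exact h)
  have h1 := hw.apply_lt_inf hX hξξ hξ
  have h2 : w.1 ξ ∉ X := by rwa [hw.apply_mem_inf hX hξξ]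
  have h3 : w.1 ξ = ξ - n := by
    have h4 : pos X ξ < pos X (w.1 ξ) := by
      rw [pos_lt_iff]; exact Or.inr (Or.inr ⟨hξ, h2, h1⟩)
    have h5 : r ξ (ξ - n) := by
      have := hw.add_mul_of_add hξξ (-1)
      rwa [show ξ + -1 * (n : ℤ) = ξ - n by ring] at this
    have h6 := (hw.up ξ _ h5 h4).resolve_left (by
      rw [not_le, pos_lt_iff]; exact Or.inr (Or.inr ⟨hξ, h0, by omega⟩))
    rw [pos_le_iff] at h6
    obtain ⟨j, hj⟩ := hX.dvd_sub (w.1 ξ) ξ h2 hξ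
    have h7 : ξ - n ≤ w.1 ξ := by tauto
    have h8 : j < 0 := by nlinarith
    have h9 : -1 ≤ j := by nlinarith
    have h10 : j = -1 := by omega
    rw [h10] at hj
    linarith
  rw [shift, Finset.sum_eq_single (ξ : ZMod n)]
  · rw [ind_of_mem hXc hξ, disp_intCast, h3]
    push_cast; ring
  · intro z _ hz
    obtain ⟨x, rfl⟩ := ZMod.intCast_surjective z
    have hx : x ∉ Xᶜ := fun hx => hz ((ZMod.intCast_eq_intCast_iff_dvd_sub _ _ _).2
      (hX.dvd_sub _ _ hξ hx))
    rw [ind_of_notMem hXc hx, zero_mul]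
  · simp

/-- The set of elements of `X` in an infinite class. -/
theorem IsNextMap.infinite_part {a b u : ℤ} (hu : r u (u + n))
    (h : ¬ (n : ℤ) ∣ b - a) (ha : ¬ (a ∈ X ∧ r a (a + n))) (hb : ¬ (b ∈ X ∧ r b (b + n))) :
    ind n {x | x ∈ X ∧ r x (x + n)} ∈ invar (w * affineTransp n a b h) ∧
      0 < shift (w * affineTransp n a b h) (ind n {x | x ∈ X ∧ r x (x + n)}) := by
  set A : Set ℤ := {x | x ∈ X ∧ r x (x + n)} with hAdef
  have hA : ∀ x : ℤ, x + (n : ℤ) ∈ A ↔ x ∈ A := fun x =>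
    and_congr (hX.add_mem x) (hw.add_iff x (x + n))
  have hwA : ∀ x, w.1 x ∈ A ↔ x ∈ A := fun x => by
    refine and_congr (hw.apply_mem_inf hX hu) ⟨fun h => ?_, fun h => ?_⟩
    · exact hw.add_of_rel (hw.symm (hw.apply x)) h
    · exact hw.add_of_rel (hw.apply x) h
  have hne : A.Nonempty := by
    obtain ⟨ξ, hξ⟩ := hX.compl_nonempty
    have h1 := hw.add_of_rel (hw.rel_compl hX hu hξ) hu
    obtain ⟨x, hx, hxξ⟩ := hw.inf_compl ξ hξ h1
    exact ⟨x, hx, hw.add_of_rel (hw.symm hxξ) h1⟩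
  refine ⟨ind_mem_invar hA (mul_transp_apply_mem_iff hA h ha hb w hwA),
    shift_ind_pos hA hne fun x hx => ?_⟩
  rw [mul_transp_apply_of_mem hA h ha hb w hx]
  exact hw.lt_apply_inf hX hx.2 hx.1

/-- A reflection inside `X` does not touch the complement, which keeps its shift. -/
theorem IsNextMap.compl_part {a b u : ℤ} (hu : r u (u + n))
    (h : ¬ (n : ℤ) ∣ b - a) (ha : a ∈ X) (hb : b ∈ X) :
    ind n Xᶜ ∈ invar (w * affineTransp n a b h) ∧
      shift (w * affineTransp n a b h) (ind n Xᶜ) = -n := by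
  have hXc : ∀ x : ℤ, x + (n : ℤ) ∈ Xᶜ ↔ x ∈ Xᶜ := fun x => not_congr (hX.add_mem x)
  have hwX : ∀ x, w.1 x ∈ Xᶜ ↔ x ∈ Xᶜ := fun x => not_congr (hw.apply_mem_inf hX hu)
  refine ⟨ind_mem_invar hXc (mul_transp_apply_mem_iff hXc h (not_not.2 ha) (not_not.2 hb) w hwX),
    ?_⟩
  rw [← hw.shift_ind_compl hX hu, shift, shift]
  refine Finset.sum_congr rfl fun z _ => ?_
  obtain ⟨x, rfl⟩ := ZMod.intCast_surjective z
  by_cases hx : x ∈ Xᶜ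
  · rw [disp_intCast, disp_intCast, mul_transp_apply_of_mem hXc h (not_not.2 ha) (not_not.2 hb) w hx]
  · rw [ind_of_notMem hXc hx, zero_mul, zero_mul]

/-- If `a` were not in the infinite class, the reflection would leave the infinite part of `X`
untouched, and the indicator of that part would have positive shift. -/
theorem IsNextMap.exists_isCut_of_mem {a b u : ℤ} (hu : r u (u + n)) (h : ¬ (n : ℤ) ∣ b - a)
    (ha : a ∈ X) (hb : b ∉ X)
    (hs : ∀ f ∈ invar (w * affineTransp n a b h), shift (w * affineTransp n a b h) f = 0) :
    IsCut n X a b r := by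
  have haa : r a (a + n) := by
    by_contra haa
    obtain ⟨h1, h2⟩ := hw.infinite_part hX hu h (fun h => haa h.2) fun h => hb h.1
    exact h2.ne' (hs _ h1)
  refine ⟨?_, hw.inf_X a ha haa b hb, h, fun _ h' => absurd h' hb⟩
  rw [pos_lt_iff]; exact Or.inr (Or.inl ⟨ha, hb⟩)

/-- A reflection that lowers the length of `w` is a cut. -/
theorem IsNextMap.exists_isCut
    (hrk : reflLength (reflections hn) w + Module.finrank ℚ (invar w) = n + twiceInf n r)
    {a b : ℤ} (h : ¬ (n : ℤ) ∣ b - a)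
    (hl : reflLength (reflections hn) (w * affineTransp n a b h) + 1 =
      reflLength (reflections hn) w) :
    ∃ (a' b' : ℤ) (hc : IsCut n X a' b' r),
      affineTransp n a' b' hc.not_dvd = affineTransp n a b h := by
  obtain ⟨U, hU1, hU2, hU3, hU4⟩ := exists_subspace hn (w * affineTransp n a b h)
  have hUle := Submodule.finrank_mono hU2
  -- If `a` and `b` lie in different cycles modulo `n`, the reflection joins them. The dimension
  -- count then forces an infinite class and makes `U` all the invariants, so every shift vanishes
  -- and exactly one of `a`, `b` lies in `X`.
  by_cases hag : invar w ≤ agree a b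
  swap
  · have h1 := finrank_invar_mul_transp_of_not_le w h hag
    by_cases hinf : ∃ u : ℤ, r u (u + n)
    swap
    · push Not at hinf
      rw [twiceInf_of_forall hinf] at hrk
      omega
    obtain ⟨u, hu⟩ := hinf
    rw [twiceInf_of_exists hu] at hrk
    have hUeq : U = invar (w * affineTransp n a b h) :=
      Submodule.eq_of_le_of_finrank_le hU2 (by omega)
    have hs : ∀ f ∈ invar (w * affineTransp n a b h),
        shift (w * affineTransp n a b h) f = 0 := fun f hf => hU3 f (hUeq ▸ hf)
    by_cases ha : a ∈ X
    · by_cases hb : b ∈ X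
      · obtain ⟨h2, h3⟩ := hw.compl_part hX hu h ha hb
        rw [hs _ h2] at h3
        have : (n : ℚ) ≠ 0 := by exact_mod_cast NeZero.ne n
        exact absurd (neg_eq_zero.1 h3.symm) this
      · exact ⟨a, b, hw.exists_isCut_of_mem hX hu h ha hb hs, rfl⟩
    · have hb : b ∈ X := by
        by_contra hb
        exact h (hX.dvd_sub _ _ hb ha)
      rw [← transp_comm] at hs ⊢
      exact ⟨b, a, hw.exists_isCut_of_mem hX hu _ hb ha hs, rfl⟩
  have hab : a ∈ cls n r b := by
    by_contra hab
    have := hag (hw.ind_cls_mem b)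
    rw [mem_agree, ind_of_notMem (hw.cls_periodic b) hab,
      ind_of_mem (hw.cls_periodic b) (hw.self_mem_cls b)] at this
    exact zero_ne_one this
  obtain ⟨k, hk⟩ := hab
  have habX : ∀ u : ℤ, r u (u + n) → a ∈ X ∧ b ∈ X := by
    intro u hu
    have h2 := hag (hw.ind_X_mem hX hu)
    rw [mem_agree] at h2
    by_cases ha : a ∈ X
    · refine ⟨ha, ?_⟩
      by_contra hb
      rw [ind_of_mem hX.add_mem ha, ind_of_notMem hX.add_mem hb] at h2
      exact one_ne_zero h2
    · exfalso
      refine h (hX.dvd_sub _ _ ?_ ha)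
      intro hb
      rw [ind_of_notMem hX.add_mem ha, ind_of_mem hX.add_mem hb] at h2
      exact zero_ne_one h2
  -- Modulo `n` the reflection is the cut `(a', b')`; its true second endpoint is `b' + j n`. The
  -- class of `b'` after the cut has shift zero for the cut, hence shift `-j n` for the reflection,
  -- and this restricts `j`.
  obtain ⟨a', b', j, hc, h', ht, hb', hba⟩ :=
    hw.exists_isCut_add_mul hX (NeZero.pos n) h hk (habX a)
  have hv := hw.split hX (NeZero.pos n) hc
  set r' := splitRel n X a' b' r with hr'
  have hfin : ¬ r' b' (b' + n) := hc.not_splitRel_add hX (NeZero.pos n) hw.toIsNoncrossing hb'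
  have hf0 := hv.shift_ind_cls hX hfin
  have hf1 := hv.ind_cls_mem b'
  have hshift := shift_mul_transp_add w hc.not_dvd h' (ind n (cls n r' b'))
  rw [ht, hf0, ind_of_mem (hv.cls_periodic b') (hv.self_mem_cls b'),
    ind_of_notMem (hv.cls_periodic b')
      (hc.notMem_cls hX (NeZero.pos n) hw.toIsNoncrossing hb'), zero_add] at hshift
  have hinv := invar_mul_transp_add w hc.not_dvd h'
  rw [ht] at hinv
  rw [← hinv] at hf1
  have hrs := hw.rank_split hX hc
  rw [← hinv] at hrs
  have hnQ : (n : ℚ) ≠ 0 := by exact_mod_cast NeZero.ne n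
  have hj0 : j = 0 → ∃ (a' b' : ℤ) (hc : IsCut n X a' b' r),
      affineTransp n a' b' hc.not_dvd = affineTransp n a b h := by
    rintro rfl
    refine ⟨a', b', hc, ?_⟩
    rw [← ht]
    congr 1
    ring
  -- Without an infinite class `U` is the whole space of invariants, so `j = 0`. With one, `U` still
  -- has codimension at most one.
  by_cases hinf : ∃ u : ℤ, r u (u + n)
  swap
  · push Not at hinf
    rw [twiceInf_of_forall hinf, twiceInf_of_forall fun u h => hinf u h.rel] at hrs
    rw [twiceInf_of_forall hinf] at hrk
    have hUeq : U = invar (w * affineTransp n a b h) :=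
      Submodule.eq_of_le_of_finrank_le hU2 (by omega)
    rw [hU3 _ (hUeq ▸ hf1)] at hshift
    refine hj0 ?_
    have : (j : ℚ) * n = 0 := by linarith
    exact_mod_cast (mul_eq_zero.1 this).resolve_right hnQ
  obtain ⟨u, hu⟩ := hinf
  obtain ⟨ha, hb⟩ := habX u hu
  rw [twiceInf_of_exists hu] at hrk hrs
  obtain ⟨hg1, hg2⟩ := hw.compl_part hX hu h ha hb
  have hdim : Module.finrank ℚ (invar (w * affineTransp n a b h)) ≤ Module.finrank ℚ U + 1 := by
    have := finrank_invar_mul_transp_le w h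
    omega
  have hinf' : ∃ u : ℤ, r' u (u + n) := by
    by_contra hinf'
    push Not at hinf'
    rw [twiceInf_of_forall hinf'] at hrs
    have hUeq : U = invar (w * affineTransp n a b h) :=
      Submodule.eq_of_le_of_finrank_le hU2 (by omega)
    rw [hU3 _ (hUeq ▸ hg1)] at hg2
    exact hnQ (neg_eq_zero.1 hg2.symm)
  obtain ⟨u', hu'⟩ := hinf'
  by_cases hj : j = 0
  · exact hj0 hj
  have hjQ : (j : ℚ) ≠ 0 := by exact_mod_cast hj
  have hf2 : shift (w * affineTransp n a b h) (ind n (cls n r' b')) ≠ 0 := by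
    rw [hshift, zero_sub, neg_one_mul, neg_ne_zero]
    exact mul_ne_zero hjQ hnQ
  have hdis : ∀ x ∈ cls n r' b', x ∉ Xᶜ := by
    rintro x ⟨k, hk⟩ hxX
    have h1 := hv.add_of_rel hk (hv.add_of_rel (hv.rel_compl hX hu' hxX) hu')
    refine hfin ((hv.add_mul_iff _ _ k).1 ?_)
    rwa [show b' + n + k * n = b' + k * n + n by ring]
  -- The class of `b'` and the complement of `X` are orthogonal idempotents with nonzero shifts `-j
  -- n` and `-n`; these must cancel, so `j = -1`.
  have h1 := shift_add_eq_zero hU1 hU2 hU3 hdim hf1 hg1 ind_mul_self ind_mul_self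
    (ind_mul_eq_zero hdis) hf2 (by rw [hg2]; exact neg_ne_zero.2 hnQ)
  rw [hshift, hg2] at h1
  have h2 : (j : ℚ) = -1 := by
    have : ((j : ℚ) + 1) * n = 0 := by linarith
    have := (mul_eq_zero.1 this).resolve_right hnQ
    linarith
  obtain rfl : j = -1 := by exact_mod_cast h2
  -- On the infinite class the reflection exchanging `a'` and `b' - n` is again a cut: `(b' - n,
  -- a']` is the complementary arc modulo `n`.
  by_cases haa : r a' (a' + n)
  · have hb'' := hb' haa
    have hlt := hc.lt_add haa hb''
    have ha'' := hc.mem hX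
    have h3 : r (b' - n) b' := by
      have := hw.add_mul_of_add (hw.add_of_rel hc.rel haa) (-1)
      rw [show b' + -1 * (n : ℤ) = b' - n by ring] at this
      exact hw.symm this
    have h4 : b' - n ∈ X := by rwa [← hX.add_mem, sub_add_cancel]
    have h5 : ¬ (n : ℤ) ∣ b' + -1 * n - a' := h'
    have h6 : ¬ (n : ℤ) ∣ a' - (b' - n) := by
      rw [← dvd_neg]
      rwa [show b' + -1 * (n : ℤ) - a' = -(a' - (b' - n)) by ring] at h5
    refine ⟨b' - n, a', ⟨?_, hw.trans h3 (hw.symm hc.rel), h6, fun _ _ => ?_⟩, ?_⟩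
    · rw [pos_lt_iff]; exact Or.inl ⟨h4, ha'', by omega⟩
    · have h7 := hc.lt
      rw [pos_lt_iff] at h7
      have : a' < b' := by tauto
      omega
    · rw [← transp_comm h6, ← ht]
      congr 1
      ring
  -- If the cut class is finite, the infinite part of `X` is a further orthogonal idempotent. Its
  -- shift is positive and cannot cancel the shift `n` of the class of `b'`.
  · exfalso
    have hax : ¬ r a (a + n) := fun h0 => haa (hba h0)
    have hbx : ¬ r b (b + n) := fun h0 => by
      have h3 := (hw.add_mul_iff _ _ k).2 h0
      rw [show b + n + k * n = b + k * n + n by ring] at h3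
      exact hax (hw.add_of_rel (hw.symm hk) h3)
    obtain ⟨h3, h4⟩ := hw.infinite_part hX hu h (fun h0 => hax h0.2) fun h0 => hbx h0.2
    have h5 := shift_add_eq_zero hU1 hU2 hU3 hdim hf1 h3 ind_mul_self ind_mul_self
      (ind_mul_eq_zero ?_) hf2 h4.ne'
    · rw [hshift] at h5
      have : (0 : ℚ) < n := by exact_mod_cast NeZero.pos n
      push_cast at h5
      linarith
    · rintro x ⟨i, hi⟩ ⟨-, hx⟩
      have h6 := hw.add_of_rel hi.rel hx
      rw [show b' + i * n + n = b' + n + i * n by ring, hw.add_mul_iff] at h6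
      exact haa (hw.add_of_rel (hw.symm hc.rel) h6)

end Forced

/-! ### Existence of cuts -/

section Exists

variable {n : ℕ} {X : Set ℤ} {r s : ℤ → ℤ → Prop} (hX : IsPunctured n X) (hn : 0 < n)

/-- The elements of `X` in a finite class span less than `n`. -/
theorem IsNoncrossing.lt_add_of_finite (hr : IsNoncrossing n X r) (hX : IsPunctured n X) {x y : ℤ}
    (hx : x ∈ X) (hy : y ∈ X) (hxy : r x y) (hfin : ¬ r x (x + n)) : y < x + n := by
  by_contra! h
  rcases eq_or_lt_of_le h with rfl | h
  · exact hfin hxy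
  · have h1 := (hr.add_iff _ _).2 hxy
    have e1 := (hX.add_mem x).2 hx
    have e2 := (hX.add_mem y).2 hy
    have hn' : (0 : ℤ) ≤ n := by positivity
    rcases eq_or_lt_of_le hn' with h0 | h0
    · exact hfin (by rw [← h0, add_zero]; exact hr.refl x)
    · refine hfin (hr.nc x (x + n) y (y + n) ?_ ?_ ?_ hxy h1)
      all_goals rw [pos_lt_iff]
      · exact Or.inl ⟨hx, e1, by omega⟩
      · exact Or.inl ⟨e1, hy, by omega⟩
      · exact Or.inl ⟨hy, e2, by omega⟩

include hX hn

theorem IsNoncrossing.eq_of_notMem (hr : IsNoncrossing n X r) {x y : ℤ} (hx : x ∉ X)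
    (hy : y ∉ X) (hxy : r x y) (hfin : ¬ r x (x + n)) : x = y := by
  obtain ⟨k, hk⟩ := hX.dvd_sub y x hy hx
  by_contra hne
  have hk0 : k ≠ 0 := by rintro rfl; apply hne; linarith
  refine hfin (hr.add_of_add_mul hX hn hk0 ?_)
  rwa [show x + k * n = y by linarith]

/-- A part of a class has a last element, if the class is finite or the part is bounded by an
element of `X`. -/
theorem IsNoncrossing.exists_pos_max (hr : IsNoncrossing n X r) {S : Set ℤ} (hne : S.Nonempty)
    (hS : ∀ x ∈ S, ∀ y ∈ S, r x y)
    (hb : (∀ x ∈ S, ¬ r x (x + n)) ∨ ∃ a ∈ X, ∀ x ∈ S, pos X x ≤ pos X a) :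
    ∃ b ∈ S, ∀ x ∈ S, pos X x ≤ pos X b := by
  by_cases hSX : ∃ ξ ∈ S, ξ ∉ X
  · obtain ⟨ξ, hξ, hξX⟩ := hSX
    refine ⟨ξ, hξ, fun x hx => ?_⟩
    rcases hb with hb | ⟨a, ha, hb⟩
    · by_cases hxX : x ∈ X
      · rw [pos_le_iff]; exact Or.inr (Or.inl ⟨hxX, hξX⟩)
      · rw [hr.eq_of_notMem hX hn hxX hξX (hS x hx ξ hξ) (hb x hx)]
    · have := hb ξ hξ
      rw [pos_le_iff] at this
      tauto
  · push Not at hSX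
    have hbd : ∃ B : ℤ, ∀ x, x ∈ S → x ≤ B := by
      rcases hb with hb | ⟨a, ha, hb⟩
      · obtain ⟨y, hy⟩ := hne
        exact ⟨y + n, fun x hx =>
          (hr.lt_add_of_finite hX (hSX y hy) (hSX x hx) (hS y hy x hx) (hb y hy)).le⟩
      · refine ⟨a, fun x hx => ?_⟩
        have := hb x hx
        have := hSX x hx
        rw [pos_le_iff] at *
        tauto
    obtain ⟨b, hbS, hb'⟩ := Int.exists_greatest_of_bdd hbd hne
    refine ⟨b, hbS, fun x hx => ?_⟩
    rw [pos_le_iff]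
    exact Or.inl ⟨hSX x hx, hSX b hbS, hb' x hx⟩

omit hX hn in
/-- A relation contained in `s` for which `(a, b]` is saturated is contained in the splitting of
`s`. -/
theorem le_splitRel (hr : IsNoncrossing n X r) (hs : IsNoncrossing n X s)
    (hrs : ∀ u v, r u v → s u v) {a b : ℤ} (hab : s a b)
    (h : ∀ u v, r u v → s a u → Between X a b u → Between X a b v) (u v : ℤ) (huv : r u v) :
    splitRel n X a b s u v := by
  refine ⟨hrs u v huv, fun k => ?_⟩
  have h1 := (hr.add_mul_iff _ _ k).2 huv
  by_cases hua : s (u + k * n) a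
  · exact ⟨h _ _ h1 (hs.symm hua), h _ _ (hr.symm h1) (hs.symm (hs.trans (hs.symm (hrs _ _ h1)) hua))⟩
  · exact hs.between_iff hab (hrs _ _ h1) hua

theorem IsNoncrossing.exists_mem_inf (hr : IsNoncrossing n X r) {u : ℤ} (hu : r u (u + n)) (A : ℤ) :
    ∃ x ∈ X, r x (x + n) ∧ A < x ∧ x ≤ A + n := by
  obtain ⟨ξ, hξ⟩ := hX.compl_nonempty
  have h1 := hr.add_of_rel (hr.rel_compl hX hu hξ) hu
  obtain ⟨x, hx, hxξ⟩ := hr.inf_compl ξ hξ h1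
  have h2 := hr.add_of_rel (hr.symm hxξ) h1
  have hn' : (0 : ℤ) < n := by exact_mod_cast hn
  have e := Int.emod_add_mul_ediv (x - A - 1) n
  have h3 := Int.emod_nonneg (x - A - 1) hn'.ne'
  have h4 := Int.emod_lt_of_pos (x - A - 1) hn'
  set k := (x - A - 1) / n with hk
  have e' : x + (-k) * n = A + 1 + (x - A - 1) % n := by linarith
  refine ⟨x + (-k) * n, (hX.add_mul_mem x _).2 hx, ?_, by omega, by omega⟩
  exact hr.add_of_rel (hr.add_mul_of_add h2 (-k)) h2

/-- Cutting the infinite class into finite ones. -/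
theorem exists_isCut_of_balanced (hr : IsNoncrossing n X r) (hs : IsNoncrossing n X s)
    (hrs : ∀ u v, r u v → s u v) {u : ℤ} (hu : s u (u + n)) (hbal : ∀ u : ℤ, ¬ r u (u + n)) :
    ∃ (a b : ℤ) (_ : IsCut n X a b s), ∀ u v, r u v → splitRel n X a b s u v := by
  have hn' : (0 : ℤ) < n := by exact_mod_cast hn
  obtain ⟨ξ, hξ⟩ := hX.compl_nonempty
  have hξξ := hs.add_of_rel (hs.rel_compl hX hu hξ) hu
  -- A point `a` at which no class of `r` is broken, so that `(a, ξ]` can be cut off: within `X` no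
  -- class straddles `a`, and the classes meeting both sides lie wholly inside or wholly outside the
  -- interval.
  suffices h : ∃ a ∈ X, s a (a + n) ∧ (∀ x ∈ X, ∀ y ∈ X, r x y → x ≤ a → y ≤ a) ∧
      (∀ x ∈ X, ∀ η ∉ X, r x η → (a < x ↔ ξ ≤ η)) by
    obtain ⟨a, ha, haa, h1, h2⟩ := h
    have haξ := hs.rel_compl hX haa hξ
    have hc : IsCut n X a ξ s := ⟨by rw [pos_lt_iff]; exact Or.inr (Or.inl ⟨ha, hξ⟩), haξ,
      fun hd => hξ ((mem_congr_of_periodic hX.add_mem hd).2 ha), fun _ h => absurd h hξ⟩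
    refine ⟨a, ξ, hc, le_splitRel hr hs hrs haξ fun u v huv _ => ?_⟩
    rw [hc.between_iff_of_notMem hX hξ, hc.between_iff_of_notMem hX hξ]
    by_cases huX : u ∈ X <;> by_cases hvX : v ∈ X
    · have := h1 v hvX u huX (hr.symm huv)
      simp only [huX, hvX, true_and, not_true_eq_false, false_and, or_false]
      omega
    · have := h2 u huX v hvX huv
      tauto
    · have := h2 v hvX u huX (hr.symm huv)
      tauto
    · rw [hr.eq_of_notMem hX hn huX hvX huv (hbal u)]
      exact id
  -- If `ξ` is related to elements of `X`, let `m` be the last of them. They all lie in `(m - n,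
  -- m]`, so the translates of this class occupy successive windows of length `n`, and `m - n` ends
  -- one of them.
  by_cases hD : ∃ x ∈ X, r x ξ
  · let S : Set ℤ := {x | x ∈ X ∧ r x ξ}
    obtain ⟨m, ⟨hm, hmξ⟩, hmax⟩ := hr.exists_pos_max hX hn (S := S) hD
      (fun x hx y hy => hr.trans hx.2 (hr.symm hy.2)) (Or.inl fun x _ => hbal x)
    have hmax' : ∀ x ∈ X, r x ξ → x ≤ m := fun x hx hxξ => by
      have := hmax x ⟨hx, hxξ⟩
      rw [pos_le_iff] at this
      tauto
    have hmin : ∀ x ∈ X, r x ξ → m - n < x := fun x hx hxξ => by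
      have := hr.lt_add_of_finite hX hx hm (hr.trans hxξ (hr.symm hmξ)) (hbal x)
      omega
    have hma : m - n ∈ X := by rwa [← hX.add_mem, sub_add_cancel]
    have hclass : ∀ x ∈ X, ∀ k : ℤ, r x (ξ + k * n) → m - n + k * n < x ∧ x ≤ m + k * n := by
      intro x hx k h
      obtain ⟨y, rfl⟩ : ∃ y, x = y + k * n := ⟨x - k * n, by ring⟩
      rw [hr.add_mul_iff] at h
      rw [hX.add_mul_mem] at hx
      have h1 := hmax' y hx h
      have h2 := hmin y hx h
      constructor <;> linarith
    have hmξ' : r (m - n) (ξ - n) := by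
      rw [← hr.add_iff, sub_add_cancel, sub_add_cancel]; exact hmξ
    have hle : ∀ y ∈ X, r y (m - n) → y ≤ m - n := fun y hy hym => by
      have := (hclass y hy (-1) (by
        rw [show ξ + -1 * (n : ℤ) = ξ - n by ring]; exact hr.trans hym hmξ')).2
      linarith
    refine ⟨m - n, hma, ?_, ?_, ?_⟩
    · have h1 := hs.add_of_rel (hs.symm (hrs _ _ hmξ)) hξξ
      rwa [← hs.add_iff, sub_add_cancel]
    · intro x hx y hy hxy hxm
      by_contra! hym
      rcases eq_or_lt_of_le hxm with rfl | hxm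
      · have := hle y hy (hr.symm hxy)
        omega
      · have hξn : ξ - n ∉ X := fun h => hξ (by
          rw [← hX.add_mem, sub_add_cancel] at h; exact h)
        have := hr.nc x (m - n) y (ξ - n) (by rw [pos_lt_iff]; exact Or.inl ⟨hx, hma, hxm⟩)
          (by rw [pos_lt_iff]; exact Or.inl ⟨hma, hy, hym⟩)
          (by rw [pos_lt_iff]; exact Or.inr (Or.inl ⟨hy, hξn⟩)) hxy hmξ'
        have := hle y hy (hr.trans (hr.symm hxy) this)
        omega
    · intro x hx η hη hxη
      obtain ⟨k, hk⟩ := hX.dvd_sub η ξ hη hξ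
      obtain rfl : η = ξ + k * n := by linarith
      obtain ⟨h1, h2⟩ := hclass x hx k hxη
      constructor
      · intro h3
        have : 0 ≤ k := by
          by_contra! hk
          have : k * n ≤ -1 * n := mul_le_mul_of_nonneg_right (by omega) hn'.le
          linarith
        have : 0 ≤ k * n := mul_nonneg this hn'.le
        linarith
      · intro h3
        have : 0 ≤ k * n := by linarith
        linarith
  -- Now no class of `r` meets both `X` and its complement. Starting from `a0` in the infinite class
  -- of `s`, the cut is put at the largest element of `X` related to some element of `X` that is at
  -- most `a0`.
  · push Not at hD
    obtain ⟨a0, ha0, ha0ξ⟩ := hs.inf_compl ξ hξ hξξ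
    let T : Set ℤ := {t | t ∈ X ∧ ∃ v ∈ X, v ≤ a0 ∧ r v t}
    have hT0 : a0 ∈ T := ⟨ha0, a0, ha0, le_rfl, hr.refl a0⟩
    obtain ⟨a, ⟨ha, v, hv, hva0, hva⟩, hmax⟩ := Int.exists_greatest_of_bdd
      (P := fun t => t ∈ T) ⟨a0 + n, fun t ⟨ht, v, hv, hv0, hvt⟩ => by
        have := hr.lt_add_of_finite hX hv ht hvt (hbal v)
        omega⟩ ⟨a0, hT0⟩
    have ha0a := hmax a0 hT0
    refine ⟨a, ha, ?_, ?_, ?_⟩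
    · have h1 : s a0 (a0 + n) := hs.add_of_rel (hs.symm ha0ξ) hξξ
      rcases eq_or_lt_of_le ha0a with rfl | h2
      · exact h1
      rcases eq_or_lt_of_le hva0 with rfl | h3
      · exact hs.add_of_rel (hrs _ _ hva) h1
      have h4 := hs.nc v a0 a ξ (by rw [pos_lt_iff]; exact Or.inl ⟨hv, ha0, h3⟩)
        (by rw [pos_lt_iff]; exact Or.inl ⟨ha0, ha, h2⟩)
        (by rw [pos_lt_iff]; exact Or.inr (Or.inl ⟨ha, hξ⟩)) (hrs _ _ hva) ha0ξ
      exact hs.add_of_rel (hs.trans (hs.symm h4) (hrs _ _ hva)) h1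
    · intro x hx y hy hxy hxa
      by_contra! hay
      have hyT : ¬ y ∈ T := fun h => by have := hmax y h; omega
      rcases le_or_gt x a0 with h1 | h1
      · exact hyT ⟨hy, x, hx, h1, hxy⟩
      rcases eq_or_lt_of_le hxa with rfl | h2
      · exact hyT ⟨hy, v, hv, hva0, hr.trans hva hxy⟩
      · have := hr.nc v x a y (by rw [pos_lt_iff]; exact Or.inl ⟨hv, hx, by omega⟩)
          (by rw [pos_lt_iff]; exact Or.inl ⟨hx, ha, h2⟩)
          (by rw [pos_lt_iff]; exact Or.inl ⟨ha, hy, hay⟩) hva hxy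
        exact hyT ⟨hy, v, hv, hva0, hr.trans this hxy⟩
    · intro x hx η hη hxη
      exfalso
      obtain ⟨k, hk⟩ := hX.dvd_sub η ξ hη hξ
      obtain rfl : η = ξ + k * n := by linarith
      refine hD (x - k * n) ?_ ?_
      · rw [← hX.add_mul_mem _ k]; simpa using hx
      · rw [← hr.add_mul_iff _ _ k]; simpa using hxη

variable {w : AffineW n}

/-- Walking through a class of `s` by the next map never leaves a class of `r`: the last element of
the `r`-class of `u` up to `v` must be `v`, since the next map would otherwise give a later one. For
the infinite class the two sides are joined through an infinite class of `r`. -/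
theorem IsNextMap.le_of_apply (hw : IsNextMap X w s) (hr : IsNoncrossing n X r)
    (hbal : ∀ u : ℤ, s u (u + n) → ∃ v : ℤ, r v (v + n)) (hrs : ∀ u v, r u v → s u v)
    (h : ∀ a, r (w.1 a) a) (u v : ℤ) (huv : s u v) : r u v := by
  have key : ∀ u v : ℤ, s u v → pos X u < pos X v → (v ∈ X ∨ ¬ s u (u + n)) → r u v := by
    intro u v huv hlt hfin
    obtain ⟨b, ⟨hb1, hb2⟩, hb⟩ := hw.exists_pos_max hX hn (S := {x | r u x ∧ pos X x ≤ pos X v})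
      ⟨u, hr.refl u, hlt.le⟩ (fun x hx y hy => hrs _ _ (hr.trans (hr.symm hx.1) hy.1)) (by
        rcases hfin with hv | hfin
        · exact Or.inr ⟨v, hv, fun x hx => hx.2⟩
        · exact Or.inl fun x hx hxx => hfin (hw.add_of_rel (hw.symm (hrs _ _ hx.1)) hxx))
    rcases eq_or_lt_of_le hb2 with h1 | h1
    · rwa [← pos_injective h1]
    · exfalso
      have hbv : s b v := hw.trans (hw.symm (hrs _ _ hb1)) huv
      have h2 : pos X b < pos X (w.1 b) := by
        by_contra! h2
        exact absurd (hw.wrap b v hbv h2).2 (not_le.2 h1)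
      have h3 := (hw.up b v hbv h2).resolve_left (not_le.2 h1)
      exact absurd (hb _ ⟨hr.trans hb1 (hr.symm (h b)), h3⟩) (not_le.2 h2)
  have key2 : ∀ u v : ℤ, s u v → (u ∈ X ∧ v ∈ X) ∨ ¬ s u (u + n) → r u v := by
    intro u v huv hfin
    rcases lt_trichotomy (pos X u) (pos X v) with h1 | h1 | h1
    · exact key u v huv h1 (hfin.imp_left fun h => h.2)
    · rw [pos_injective h1]; exact hr.refl v
    · refine hr.symm (key v u (hw.symm huv) h1 ?_)
      rcases hfin with h2 | h2
      · exact Or.inl h2.1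
      · exact Or.inr fun h3 => h2 (hw.add_of_rel (hw.symm huv) h3)
  by_cases hfin : s u (u + n)
  · obtain ⟨z, hz⟩ := hbal u hfin
    obtain ⟨x, hx, hxx, -⟩ := hr.exists_mem_inf hX hn hz 0
    have hall : ∀ y, s u y → r x y := by
      intro y hy
      by_cases hyX : y ∈ X
      · refine key2 x y ?_ (Or.inl ⟨hx, hyX⟩)
        exact (hw.unbalanced_iff hX (hrs _ _ hxx) y).1 (hw.add_of_rel hy hfin)
      · exact hr.rel_compl hX hxx hyX
    exact hr.trans (hr.symm (hall u (hw.refl u))) (hall v huv)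
  · exact key2 u v huv (Or.inr hfin)

/-- Between a noncrossing relation and a strictly smaller one there is a splitting. -/
theorem IsNextMap.exists_isCut_of_lt (hw : IsNextMap X w s) (hr : IsNoncrossing n X r)
    (hrs : ∀ u v, r u v → s u v) (hne : ¬ ∀ u v, s u v → r u v) :
    ∃ (a b : ℤ) (_ : IsCut n X a b s), ∀ u v, r u v → splitRel n X a b s u v := by
  have hn' : (0 : ℤ) < n := by exact_mod_cast hn
  have : NeZero n := ⟨hn.ne'⟩
  have hs := hw.toIsNoncrossing
  by_cases hbal : ∀ u : ℤ, s u (u + n) → ∃ v : ℤ, r v (v + n)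
  swap
  · push Not at hbal
    obtain ⟨u, hu, hbal⟩ := hbal
    exact exists_isCut_of_balanced hX hn hr hs hrs hu hbal
  -- A step of `w` that leaves its `r`-class; the cut separates `a` from the `r`-class D of `w a`.
  obtain ⟨a, ha⟩ : ∃ a, ¬ r (w.1 a) a := by
    by_contra! h
    exact hne (hw.le_of_apply hX hn hr hbal hrs h)
  have hsa := hw.apply a
  have hinf : ∀ u v : ℤ, r u (u + n) → r v (v + n) → r u v := fun u v hu hv =>
    (hr.unbalanced_iff hX hu v).1 hv
  have haX : s a (a + n) → a ∈ X := by
    intro haa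
    by_contra haX
    obtain ⟨v, hv⟩ := hbal a haa
    have h1 := hw.apply_mem_inf hX haa (x := a)
    have h2 : w.1 a ∉ X := fun h => haX (h1.1 h)
    exact ha (hr.trans (hr.symm (hr.rel_compl hX hv h2)) (hr.rel_compl hX hv haX))
  have haD : ∀ d, r (w.1 a) d → d ≠ a := fun d hd h => ha (h ▸ hd)
  have hsD : ∀ d, r (w.1 a) d → s a d := fun d hd => hs.trans hsa (hrs _ _ hd)
  have hDfin : a ∉ X → ∀ d, r (w.1 a) d → ¬ r d (d + n) := fun haX d hd hdd =>
    ha (hr.trans hd (hr.rel_compl hX hdd haX))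
  have hdvd : ∀ d, r (w.1 a) d → (s a (a + n) → |d - a| < n ∨ d ∉ X) → ¬ (n : ℤ) ∣ d - a := by
    rintro d hd h ⟨k, hk⟩
    have hk0 : k ≠ 0 := by rintro rfl; exact haD d hd (by linarith)
    have e : d = a + k * n := by linarith
    have haa : s a (a + n) := hs.add_of_add_mul hX hn hk0 (e ▸ hsD d hd)
    rcases h haa with h | h
    · rw [hk, abs_mul, abs_of_pos hn'] at h
      have := Int.one_le_abs hk0
      nlinarith
    · rw [e, hX.add_mul_mem] at h
      exact h (haX haa)
  -- If D has elements before `a`, let `b` be the last of these and cut `(b, a]`: a class of `r`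
  -- leaving this interval would cross D, or meet the gap between `a` and its successor.
  by_cases hlow : ∃ d, r (w.1 a) d ∧ pos X d < pos X a
  · obtain ⟨b, ⟨hbD, hba⟩, hmax⟩ := hr.exists_pos_max hX hn
      (S := {d | r (w.1 a) d ∧ pos X d < pos X a}) hlow
      (fun x hx y hy => hr.trans (hr.symm hx.1) hy.1) (by
        by_cases h : a ∈ X
        · exact Or.inr ⟨a, h, fun x hx => hx.2.le⟩
        · exact Or.inl fun x hx => hDfin h x hx.1)
    have hsab := hsD b hbD
    have hspan : s a (a + n) → b ∈ X ∧ b < a ∧ a < b + n := by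
      intro haa
      have haX' := haX haa
      have hbX : b ∈ X ∧ b < a := by rw [pos_lt_iff] at hba; tauto
      refine ⟨hbX.1, hbX.2, ?_⟩
      have e := (hX.add_mem b).2 hbX.1
      by_cases hbb : r b (b + n)
      · by_contra! h
        have h1 : pos X (b + n) < pos X a := by
          rw [pos_lt_iff]
          refine Or.inl ⟨e, haX', lt_of_le_of_ne h (haD _ (hr.trans hbD hbb))⟩
        have h2 := hmax _ ⟨hr.trans hbD hbb, h1⟩
        rw [pos_le_iff] at h2
        have : b + n ≤ b := by tauto
        omega
      · have h1 := hw.lt_apply_inf hX haa haX'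
        have h2 := (hw.apply_mem_inf hX haa (x := a)).2 haX'
        have := hr.lt_add_of_finite hX hbX.1 h2 (hr.symm hbD) hbb
        omega
    have hc : IsCut n X b a s := by
      refine ⟨hba, hs.symm hsab, ?_, fun h h' => ?_⟩
      · rw [← dvd_neg, neg_sub]
        refine hdvd b hbD fun haa => Or.inl ?_
        have := hspan haa
        rw [abs_lt]
        omega
      · exact (hspan (hs.add_of_rel (hs.symm hsab) h)).2.2
    refine ⟨b, a, hc, le_splitRel hr hs hrs hc.rel fun u v huv hbu hu => ?_⟩
    have hau := hs.trans hsab hbu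
    have hav := hs.trans hau (hrs _ _ huv)
    have huD : ¬ r (w.1 a) u := by
      intro huD
      rcases eq_or_lt_of_le hu.2 with h | h
      · exact haD u huD (pos_injective h)
      · exact absurd (hmax u ⟨huD, h⟩) (not_le.2 hu.1)
    have hvD : ¬ r (w.1 a) v := fun h => huD (hr.trans h (hr.symm huv))
    have hvb : pos X v ≠ pos X b := pos_ne fun h => hvD (h ▸ hbD)
    have hva' : pos X v ≠ pos X (w.1 a) := pos_ne fun h => hvD (h ▸ hr.refl _)
    rcases lt_or_ge (pos X a) (pos X (w.1 a)) with hup | hup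
    · have h1 := hw.up a v hav hup
      have hua' := hu.2.trans_lt hup
      refine ⟨?_, h1.resolve_right fun h2 => ?_⟩
      · by_contra! h2
        have := hr.nc v b u (w.1 a) (lt_of_le_of_ne h2 hvb) hu.1 hua' (hr.symm huv) (hr.symm hbD)
        exact hvD (hr.trans hbD (hr.symm this))
      · have := hr.nc b u (w.1 a) v hu.1 hua' (lt_of_le_of_ne h2 hva'.symm) (hr.symm hbD) huv
        exact huD (hr.trans hbD this)
    · have h1 := hw.wrap a v hav hup
      refine ⟨?_, h1.2⟩
      by_contra! h2
      have := hr.nc (w.1 a) v b u (lt_of_le_of_ne h1.1 hva'.symm) (lt_of_le_of_ne h2 hvb) hu.1 hbD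
        (hr.symm huv)
      exact hvD this
  -- Otherwise D lies after `a` and is finite; the cut is `(a, b]` with `b` the last element of D.
  · push Not at hlow
    have hlow' : ∀ d, r (w.1 a) d → pos X a < pos X d := fun d hd =>
      lt_of_le_of_ne (hlow d hd) (pos_ne (haD d hd).symm)
    have hup := hlow' _ (hr.refl _)
    have haX' : a ∈ X := by
      by_contra h
      have h2 : w.1 a ∉ X := by rw [pos_lt_iff] at hup; tauto
      obtain ⟨k, hk⟩ := hX.dvd_sub (w.1 a) a h2 h
      have hk0 : k ≠ 0 := by
        rintro rfl
        exact haD _ (hr.refl _) (by linarith)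
      have e : w.1 a = a + k * n := by linarith
      exact h (haX (hs.add_of_add_mul hX hn hk0 (e ▸ hsa)))
    have hfin : ∀ x, r (w.1 a) x → ¬ r x (x + n) := by
      intro d hd hdd
      obtain ⟨x, hx, hxx, h1, h2⟩ := hr.exists_mem_inf hX hn hdd (a - n)
      have h3 := hlow' x (hr.trans hd (hinf _ _ hdd hxx))
      rw [pos_lt_iff] at h3
      have : a < x := by tauto
      omega
    obtain ⟨b, hbD, hmax⟩ := hr.exists_pos_max hX hn
      (S := {d | r (w.1 a) d}) ⟨w.1 a, hr.refl _⟩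
      (fun x hx y hy => hr.trans (hr.symm hx) hy) (Or.inl hfin)
    have hsab := hsD b hbD
    have hab := hlow' b hbD
    have hspan : s a (a + n) → b ∈ X → a < b ∧ b < a + n := by
      intro haa hbX
      refine ⟨by rw [pos_lt_iff] at hab; tauto, ?_⟩
      obtain ⟨v, hv⟩ := hbal a haa
      obtain ⟨x, hx, hxx, h1, h2⟩ := hr.exists_mem_inf hX hn hv a
      have hsax := (hs.unbalanced_iff hX haa x).1 (hrs _ _ hxx)
      have hxD : ¬ r (w.1 a) x := fun h => hfin x h hxx
      have hax : pos X a < pos X x := by rw [pos_lt_iff]; exact Or.inl ⟨haX', hx, h1⟩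
      have h3 := (hw.up a x hsax hup).resolve_left (not_le.2 hax)
      have h4 := lt_of_le_of_ne h3 (pos_ne fun h => hxD (h ▸ hr.refl _))
      by_contra! h5
      have hxb : x ≠ b := fun h => hxD (h ▸ hbD)
      obtain ⟨k, hk⟩ := exists_add_mul_gt hn x b
      have h6 := hr.nc (w.1 a) x b (x + k * n) h4
        (by rw [pos_lt_iff]; exact Or.inl ⟨hx, hbX, by omega⟩)
        (by rw [pos_lt_iff]; exact Or.inl ⟨hbX, (hX.add_mul_mem x k).2 hx, hk⟩) hbD
        (hr.add_mul_of_add hxx k)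
      exact hxD h6
    have hc : IsCut n X a b s := by
      refine ⟨hab, hsab, hdvd b hbD fun haa => ?_, fun haa hbX => (hspan haa hbX).2⟩
      by_cases hbX : b ∈ X
      · left
        have := hspan haa hbX
        rw [abs_lt]
        omega
      · exact Or.inr hbX
    refine ⟨a, b, hc, le_splitRel hr hs hrs hc.rel fun u v huv hau hu => ?_⟩
    have hav := hs.trans hau (hrs _ _ huv)
    by_cases huD : r (w.1 a) u
    · have hvD := hr.trans huD huv
      exact ⟨hlow' v hvD, hmax v hvD⟩
    have hvD : ¬ r (w.1 a) v := fun h => huD (hr.trans h (hr.symm huv))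
    have h1 := (hw.up a u hau hup).resolve_left (not_le.2 hu.1)
    have h2 := lt_of_le_of_ne h1 (pos_ne fun h => huD (h ▸ hr.refl _))
    have h3 := lt_of_le_of_ne hu.2 (pos_ne fun h => huD (h ▸ hbD))
    have hva' : pos X v ≠ pos X (w.1 a) := pos_ne fun h => hvD (h ▸ hr.refl _)
    constructor
    · by_contra! h4
      have := hr.nc v (w.1 a) u b (h4.trans_lt hup) h2 h3 (hr.symm huv) hbD
      exact hvD (hr.symm this)
    · by_contra! h4
      exact huD (hr.nc (w.1 a) u b v h2 h3 h4 hbD huv)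

end Exists

/-! ### The divisors of a Coxeter element and noncrossing relations -/

open AffineW

section Model

variable {n : ℕ} {X : Set ℤ}

theorem isNoncrossing_eq (hn : 0 < n) : IsNoncrossing n X Eq where
  equiv := eq_equivalence
  add_iff x y := by simp
  nc := by
    rintro a b c d h1 h2 h3 rfl -
    exact absurd (h1.trans h2) (lt_irrefl _)
  inf_X u _ h := by omega
  inf_compl ξ _ h := by omega

/-- The largest noncrossing relation contained in two given ones. -/
def meetRel (X : Set ℤ) (r s : ℤ → ℤ → Prop) (u v : ℤ) : Prop :=
  r u v ∧ s u v ∧ (u = v ∨ ∃ x ∈ X, r x u ∧ s x u)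

variable {r s : ℤ → ℤ → Prop}

/-- The plain intersection may have an infinite class that avoids `X`, against `inf_compl`. The last
clause of `meetRel` breaks such a class into singletons, which does not affect any class meeting
`X`. -/
theorem IsNoncrossing.meet (hX : IsPunctured n X) (hn : 0 < n) (hr : IsNoncrossing n X r)
    (hs : IsNoncrossing n X s) : IsNoncrossing n X (meetRel X r s) where
  equiv := by
    refine ⟨fun x => ⟨hr.refl x, hs.refl x, Or.inl rfl⟩, ?_, ?_⟩
    · rintro x y ⟨h1, h2, h3⟩
      refine ⟨hr.symm h1, hs.symm h2, h3.imp Eq.symm ?_⟩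
      rintro ⟨z, hz, h4, h5⟩
      exact ⟨z, hz, hr.trans h4 h1, hs.trans h5 h2⟩
    · rintro x y z ⟨h1, h2, h3⟩ ⟨h4, h5, h6⟩
      refine ⟨hr.trans h1 h4, hs.trans h2 h5, ?_⟩
      rcases h3 with rfl | h3
      · exact h6
      · exact Or.inr h3
  add_iff x y := by
    refine and_congr (hr.add_iff x y) (and_congr (hs.add_iff x y)
      (or_congr (add_left_inj _) ⟨?_, ?_⟩))
    · rintro ⟨z, hz, h1, h2⟩
      refine ⟨z - n, ?_, ?_, ?_⟩
      · rwa [← hX.add_mem, sub_add_cancel]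
      · rwa [← hr.add_iff, sub_add_cancel]
      · rwa [← hs.add_iff, sub_add_cancel]
    · rintro ⟨z, hz, h1, h2⟩
      exact ⟨z + n, (hX.add_mem z).2 hz, (hr.add_iff _ _).2 h1, (hs.add_iff _ _).2 h2⟩
  nc := by
    rintro a b c d h1 h2 h3 ⟨h4, h5, h6⟩ ⟨h7, h8, -⟩
    refine ⟨hr.nc a b c d h1 h2 h3 h4 h7, hs.nc a b c d h1 h2 h3 h5 h8, Or.inr ?_⟩
    exact h6.resolve_left fun h => lt_irrefl _ (h ▸ h1.trans h2)
  inf_X u hu h ξ hξ :=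
    ⟨hr.inf_X u hu h.1 ξ hξ, hs.inf_X u hu h.2.1 ξ hξ, Or.inr ⟨u, hu, hr.refl u, hs.refl u⟩⟩
  inf_compl ξ hξ h := by
    obtain ⟨x, hx, h1, h2⟩ := h.2.2.resolve_left (by omega)
    exact ⟨x, hx, h1, h2, Or.inr ⟨x, hx, hr.refl x, hs.refl x⟩⟩

/-- Two distinct related elements outside `X` are congruent, so their class is infinite and meets
`X`; the last clause of `meetRel` therefore excludes no pair related by `t`. -/
theorem meetRel_of_le (hX : IsPunctured n X) (hn : 0 < n) {t : ℤ → ℤ → Prop}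
    (ht : IsNoncrossing n X t) (hr : ∀ u v, t u v → r u v) (hs : ∀ u v, t u v → s u v) (u v : ℤ)
    (h : t u v) : meetRel X r s u v := by
  refine ⟨hr _ _ h, hs _ _ h, ?_⟩
  by_cases huv : u = v
  · exact Or.inl huv
  right
  by_cases hu : u ∈ X
  · exact ⟨u, hu, hr _ _ (ht.refl u), hs _ _ (ht.refl u)⟩
  by_cases hv : v ∈ X
  · exact ⟨v, hv, hr _ _ (ht.symm h), hs _ _ (ht.symm h)⟩
  have hinf : t u (u + n) := by
    by_contra hfin
    exact huv (ht.eq_of_notMem hX hn hu hv h hfin)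
  obtain ⟨x, hx, hxu⟩ := ht.inf_compl u hu hinf
  exact ⟨x, hx, hr _ _ hxu, hs _ _ hxu⟩

theorem IsNextMap.eq_of_isNextMap {v w : AffineW n} (hv : IsNextMap X v r) (hw : IsNextMap X w r) :
    v = w := by
  have key : ∀ {v w : AffineW n}, IsNextMap X v r → IsNextMap X w r → ∀ u,
      pos X (v.1 u) ≤ pos X (w.1 u) := by
    intro v w hv hw u
    rcases lt_or_ge (pos X u) (pos X (v.1 u)) with h | h
    · have h1 : pos X u < pos X (w.1 u) := by
        by_contra! h1
        exact absurd (hw.wrap u _ (hv.apply u) h1).2 (not_le.2 h)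
      exact (hv.up u _ (hw.apply u) h).resolve_left (not_le.2 h1)
    · exact (hv.wrap u _ (hw.apply u) h).1
  exact AffineW.ext_apply fun u => pos_injective (le_antisymm (key hv hw u) (key hw hv u))

variable [NeZero n] (hn : 2 ≤ n)

/-- `w` is the next-element map of `r`, and its length is the rank of `r`. -/
structure IsModel (X : Set ℤ) (w : AffineW n) (r : ℤ → ℤ → Prop) : Prop extends
    IsNextMap X w r where
  length_add : reflLength (reflections hn) w + Module.finrank ℚ (invar w) = n + twiceInf n r

variable (hX : IsPunctured n X)

include hX

/-- Cut classes until all are singletons. Each cut costs one reflection, and `rank_split` counts the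
cuts. -/
theorem IsNextMap.length_le {w : AffineW n} (hw : IsNextMap X w r) :
    reflLength (reflections hn) w + Module.finrank ℚ (invar w) ≤ n + twiceInf n r := by
  have hn' := NeZero.pos n
  have hR := isReflectionSet_reflections hn
  have hfin : ∀ w : AffineW n, Module.finrank ℚ (invar w) ≤ n := fun w => by
    refine (Submodule.finrank_le _).trans ?_
    rw [Module.finrank_fintype_fun_eq_card, ZMod.card]
  have key : ∀ (k : ℕ) (w : AffineW n) (r : ℤ → ℤ → Prop), IsNextMap X w r →
      n + twiceInf n r = Module.finrank ℚ (invar w) + k → reflLength (reflections hn) w ≤ k := by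
    intro k
    induction k with
    | zero =>
      intro w r hw hk
      by_cases h : ∀ u v, r u v → u = v
      · have : w = 1 := AffineW.ext_apply fun u => (h _ _ (hw.apply u)).symm
        rw [this, reflLength_one]
      · obtain ⟨a, b, hc, -⟩ := hw.exists_isCut_of_lt hX hn' (isNoncrossing_eq hn')
          (fun u v h => h ▸ hw.refl u) h
        have h1 := hw.rank_split hX hc
        have h2 := hfin (w * affineTransp n a b hc.not_dvd)
        omega
    | succ k ih =>
      intro w r hw hk
      by_cases h : ∀ u v, r u v → u = v
      · have : w = 1 := AffineW.ext_apply fun u => (h _ _ (hw.apply u)).symm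
        rw [this, reflLength_one]
        exact Nat.zero_le _
      · obtain ⟨a, b, hc, -⟩ := hw.exists_isCut_of_lt hX hn' (isNoncrossing_eq hn')
          (fun u v h => h ▸ hw.refl u) h
        have h1 := hw.rank_split hX hc
        have h2 := ih _ _ (hw.split hX hn' hc) (by omega)
        have h3 := hR.length_mul_le (w * affineTransp n a b hc.not_dvd)
          (affineTransp n a b hc.not_dvd)
        rw [mul_assoc, transp_mul_self, mul_one] at h3
        have h4 := reflLength_le_one (transp_mem_reflections hn hc.not_dvd)
        omega
  obtain ⟨k, hk⟩ := Nat.exists_eq_add_of_le ((hfin w).trans (Nat.le_add_right n (twiceInf n r)))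
  have := key k w r hw hk
  omega

namespace IsModel

variable {hn} {w : AffineW n} {t : ℤ → ℤ → Prop}

theorem split (hw : IsModel hn X w r) {a b : ℤ} (hc : IsCut n X a b r) :
    IsModel hn X (w * affineTransp n a b hc.not_dvd) (splitRel n X a b r) ∧
      reflLength (reflections hn) (w * affineTransp n a b hc.not_dvd) + 1 =
        reflLength (reflections hn) w := by
  have hn' := NeZero.pos n
  have hw' := hw.toIsNextMap.split hX hn' hc
  have h1 := hw'.length_le hn hX
  have h2 := hw.rank_split hX hc
  have h3 := (isReflectionSet_reflections hn).length_mul_le (w * affineTransp n a b hc.not_dvd)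
    (affineTransp n a b hc.not_dvd)
  rw [mul_assoc, transp_mul_self, mul_one] at h3
  have h4 := reflLength_le_one (transp_mem_reflections hn hc.not_dvd)
  have h5 := hw.length_add
  refine ⟨⟨hw', by omega⟩, by omega⟩

theorem split_absLE (hw : IsModel hn X w r) {a b : ℤ} (hc : IsCut n X a b r) :
    AbsLE (reflections hn) (w * affineTransp n a b hc.not_dvd) w := by
  have h1 := (hw.split hX hc).2
  have h2 := (isReflectionSet_reflections hn).absLE_of_mul
    (p := w * affineTransp n a b hc.not_dvd) (q := affineTransp n a b hc.not_dvd)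
  rw [mul_assoc, transp_mul_self, mul_one] at h2
  refine h2 ?_
  have h4 := reflLength_le_one (transp_mem_reflections hn hc.not_dvd)
  omega

/-- Every divisor of a model is a model. -/
theorem exists_of_absLE {p : AffineW n} (hw : IsModel hn X w r)
    (hp : AbsLE (reflections hn) p w) : ∃ s, IsModel hn X p s ∧ ∀ u v, s u v → r u v := by
  have hR := isReflectionSet_reflections hn
  have key : ∀ (k : ℕ) (w : AffineW n) (r : ℤ → ℤ → Prop), IsModel hn X w r →
      AbsLE (reflections hn) p w → reflLength (reflections hn) (p⁻¹ * w) = k →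
      ∃ s, IsModel hn X p s ∧ ∀ u v, s u v → r u v := by
    intro k
    induction k with
    | zero =>
      intro w r hw hp hk
      rw [hR.length_eq_zero, inv_mul_eq_one] at hk
      exact ⟨r, hk ▸ hw, fun _ _ h => h⟩
    | succ k ih =>
      intro w r hw hp hk
      -- The last reflection of a shortest word for `p⁻¹ w` lowers the length of `w`, so it is a
      -- cut, and `p` still divides the result.
      obtain ⟨l, hl, hlR, hlp⟩ := hR.exists_list (p⁻¹ * w)
      rw [hk] at hl
      obtain ⟨l', t, rfl⟩ : ∃ l' t, l = l' ++ [t] := by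
        refine ⟨l.dropLast, l.getLast ?_, (List.dropLast_append_getLast _).symm⟩
        rintro rfl
        simp at hl
      have hl' : l'.length = k := by simpa using hl
      obtain ⟨a, b, h, ht⟩ := exists_eq_transp hn (hlR t (by simp))
      rw [List.prod_append, List.prod_singleton] at hlp
      have hwt : p⁻¹ * (w * t) = l'.prod := by
        rw [← mul_assoc, ← hlp, mul_assoc, ht, transp_mul_self, mul_one]
      have h1 : reflLength (reflections hn) (p⁻¹ * (w * t)) ≤ k := by
        rw [hwt, ← hl']
        exact reflLength_prod_le _ fun x hx => hlR x (by simp [hx])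
      have h2 := hR.length_mul_le p (p⁻¹ * (w * t))
      rw [mul_inv_cancel_left] at h2
      have h3 := hR.length_mul_le (w * t) t
      rw [mul_assoc, ht, transp_mul_self, mul_one, ← ht] at h3
      have h4 := reflLength_le_one (hlR t (by simp))
      have h5 : reflLength (reflections hn) w = reflLength (reflections hn) p + (k + 1) := by
        rw [← hk]; exact hp
      have h6 : reflLength (reflections hn) (w * affineTransp n a b h) + 1 =
          reflLength (reflections hn) w := by
        rw [← ht]; omega
      obtain ⟨a', b', hc, hab⟩ := hw.exists_isCut hn hX hw.length_add h h6
      have hs := (hw.split hX hc).1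
      rw [hab, ← ht] at hs
      obtain ⟨s, hs1, hs2⟩ := ih _ _ hs (by unfold AbsLE; omega) (by omega)
      exact ⟨s, hs1, fun u v h => (hs2 u v h).rel⟩
  exact key _ w r hw hp rfl

/-- Every noncrossing relation below a model comes from a divisor. -/
theorem exists_of_le (hw : IsModel hn X w r) (hs : IsNoncrossing n X s)
    (hsr : ∀ u v, s u v → r u v) : ∃ p, IsModel hn X p s ∧ AbsLE (reflections hn) p w := by
  have hR := isReflectionSet_reflections hn
  have key : ∀ (k : ℕ) (w : AffineW n) (r : ℤ → ℤ → Prop), IsModel hn X w r →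
      reflLength (reflections hn) w = k → (∀ u v, s u v → r u v) →
      ∃ p, IsModel hn X p s ∧ AbsLE (reflections hn) p w := by
    intro k
    induction k using Nat.strong_induction_on with
    | _ k ih =>
      intro w r hw hk hsr
      by_cases h : ∀ u v, r u v → s u v
      · have : r = s := funext fun u => funext fun v => propext ⟨h u v, hsr u v⟩
        exact ⟨w, this ▸ hw, absLE_refl _ _⟩
      · obtain ⟨a, b, hc, hle⟩ := hw.exists_isCut_of_lt hX (NeZero.pos n) hs hsr h
        obtain ⟨h1, h2⟩ := hw.split hX hc
        obtain ⟨p, hp1, hp2⟩ := ih _ (by omega) _ _ h1 rfl hle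
        exact ⟨p, hp1, hR.absLE_trans hp2 (hw.split_absLE hX hc)⟩
  exact key _ w r hw rfl hsr

/-- The relation of a model is determined by the map. -/
theorem le_of_isModel (hr : IsModel hn X w r) (hs : IsModel hn X w s) (u v : ℤ) (huv : r u v) :
    s u v := by
  have hn' := NeZero.pos n
  have htwice : twiceInf n r = twiceInf n s := by
    have h1 := hr.length_add
    have h2 := hs.length_add
    omega
  have hm := hr.toIsNoncrossing.meet hX hn' hs.toIsNoncrossing
  -- The infinite classes of `r` and `s` meet in `X`. Otherwise the common class of `x` would be
  -- finite with a last element `b` in `X`, while `w b` belongs to it and comes later.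
  have hinf : ∀ u : ℤ, r u (u + n) → ∃ x ∈ X, r x (x + n) ∧ s x (x + n) := by
    intro u hu
    obtain ⟨x, hx, hxx, -⟩ := hr.exists_mem_inf hX hn' hu 0
    refine ⟨x, hx, hxx, ?_⟩
    by_contra hfin
    have hs2 : ∃ v : ℤ, s v (v + n) := by
      by_contra hs2
      push Not at hs2
      rw [twiceInf_of_exists hu, twiceInf_of_forall hs2] at htwice
      omega
    obtain ⟨v, hv⟩ := hs2
    obtain ⟨b, ⟨hb1, hb2⟩, hb⟩ := hs.exists_pos_max hX hn' (S := {y | r x y ∧ s x y})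
      ⟨x, hr.refl x, hs.refl x⟩ (fun y hy z hz => hs.trans (hs.symm hy.2) hz.2)
      (Or.inl fun y hy hyy => hfin (hs.add_of_rel (hs.symm hy.2) hyy))
    have hbb := hr.add_of_rel hb1 hxx
    have hbX : b ∈ X := by
      by_contra hbX
      exact hfin (hs.add_of_rel (hs.symm hb2) (hs.add_of_rel (hs.rel_compl hX hv hbX) hv))
    have h1 := hb _ ⟨hr.trans hb1 (hr.apply b), hs.trans hb2 (hs.apply b)⟩
    have h2 := hr.lt_apply_inf hX hbb hbX
    rw [pos_le_iff, hr.apply_mem_inf hX hbb] at h1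
    have : w.1 b ≤ b := by tauto
    omega
  have hmX : ∀ x ∈ X, ∀ y, r x y → s x y → meetRel X r s x y := fun x hx y h1 h2 =>
    ⟨h1, h2, Or.inr ⟨x, hx, hr.refl x, hs.refl x⟩⟩
  have happ : ∀ a, meetRel X r s (w.1 a) a := by
    intro a
    by_cases ha : a ∈ X
    · exact hm.symm (hmX a ha _ (hr.apply a) (hs.apply a))
    by_cases hwa : w.1 a ∈ X
    · exact hmX _ hwa a (hr.symm (hr.apply a)) (hs.symm (hs.apply a))
    by_cases haa : r a (a + n)
    · obtain ⟨x, hx, hrx, hsx⟩ := hinf a haa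
      exact hm.trans (hm.symm (hmX x hx _ (hr.rel_compl hX hrx hwa) (hs.rel_compl hX hsx hwa)))
        (hmX x hx _ (hr.rel_compl hX hrx ha) (hs.rel_compl hX hsx ha))
    · rw [← hr.eq_of_notMem hX hn' ha hwa (hr.apply a) haa]
      exact hm.refl a
  refine (hr.le_of_apply hX hn' hm (fun u hu => ?_) (fun _ _ h => h.1) happ u v huv).2.1
  obtain ⟨x, hx, hrx, hsx⟩ := hinf u hu
  exact ⟨x, hmX x hx _ hrx hsx⟩

/-- The meet of the two relations gives a divisor of `p` and a divisor of `q` with the same next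
map, hence equal. A common divisor has relations below both sides, and these agree because the
relation of a model is unique. -/
theorem exists_inf {p q : AffineW n} (hw : IsModel hn X w t)
    (hp : AbsLE (reflections hn) p w) (hq : AbsLE (reflections hn) q w) :
    ∃ i, AbsLE (reflections hn) i p ∧ AbsLE (reflections hn) i q ∧
      ∀ z, AbsLE (reflections hn) z p → AbsLE (reflections hn) z q →
        AbsLE (reflections hn) z i := by
  have hn' := NeZero.pos n
  obtain ⟨r, hr, -⟩ := hw.exists_of_absLE hX hp
  obtain ⟨s, hs, -⟩ := hw.exists_of_absLE hX hq
  have hm := hr.toIsNoncrossing.meet hX hn' hs.toIsNoncrossing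
  obtain ⟨i, hi1, hi2⟩ := hr.exists_of_le hX hm fun _ _ h => h.1
  obtain ⟨j, hj1, hj2⟩ := hs.exists_of_le hX hm fun _ _ h => h.2.1
  obtain rfl := hi1.toIsNextMap.eq_of_isNextMap hj1.toIsNextMap
  refine ⟨i, hi2, hj2, fun z hzp hzq => ?_⟩
  obtain ⟨t1, ht1, htr⟩ := hr.exists_of_absLE hX hzp
  obtain ⟨t2, ht2, hts⟩ := hs.exists_of_absLE hX hzq
  obtain ⟨y, hy1, hy2⟩ := hi1.exists_of_le hX ht1.toIsNoncrossing fun u v h =>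
    meetRel_of_le hX hn' ht1.toIsNoncrossing htr
      (fun u v h => hts u v (ht1.le_of_isModel hX ht2 u v h)) u v h
  rwa [← hy1.toIsNextMap.eq_of_isNextMap ht1.toIsNextMap]

end IsModel

end Model

/-- In a divisor poset with greatest lower bounds there are least upper bounds. -/
theorem IsDivisorLattice.of_inf {G : Type*} [Group G] {R : Set G} (hR : IsReflectionSet R) {c : G}
    (h : ∀ p q, AbsLE R p c → AbsLE R q c →
      ∃ i, AbsLE R i p ∧ AbsLE R i q ∧ ∀ t, AbsLE R t p → AbsLE R t q → AbsLE R t i) :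
    IsDivisorLattice R c := by
  refine ⟨h, fun p q hp hq => ?_⟩
  classical
  -- An upper bound of least length is the join: its meet with another upper bound is again an upper
  -- bound, and of no smaller length.
  have hex : ∃ k s, reflLength R s = k ∧ AbsLE R s c ∧ AbsLE R p s ∧ AbsLE R q s :=
    ⟨_, c, rfl, absLE_refl R c, hp, hq⟩
  obtain ⟨s, hk, hsc, hps, hqs⟩ := Nat.find_spec hex
  refine ⟨s, hsc, hps, hqs, fun t htc hpt hqt => ?_⟩
  obtain ⟨i, his, hit, hi⟩ := h s t hsc htc
  have h1 : reflLength R s ≤ reflLength R i := hk ▸ Nat.find_min' hex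
    ⟨i, rfl, hR.absLE_trans his hsc, hi p hps hpt, hi q hqs hqt⟩
  rwa [← hR.eq_of_absLE_of_length_le his h1]

theorem IsSingletonMod.dvd_sub {n : ℕ} {A : Set ℤ} (h : IsSingletonMod n A) {x y : ℤ} (hx : x ∈ A)
    (hy : y ∈ A) : (n : ℤ) ∣ x - y := by
  obtain ⟨z, hz⟩ := Set.ncard_eq_one.1 h
  have h1 : (x : ZMod n) = z := by
    have : (x : ZMod n) ∈ (fun x : ℤ => (x : ZMod n)) '' A := ⟨x, hx, rfl⟩
    rwa [hz] at this
  have h2 : (y : ZMod n) = z := by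
    have : (y : ZMod n) ∈ (fun x : ℤ => (x : ZMod n)) '' A := ⟨y, hy, rfl⟩
    rwa [hz] at this
  rw [← ZMod.intCast_eq_intCast_iff_dvd_sub, h1, h2]

section Lattice

variable {n : ℕ} {hn : 2 ≤ n} {c : AffineW n} {X Ξ : Set ℤ}

theorem IsCoxeterPartition.isPunctured (h : IsCoxeterPartition c X Ξ) (hΞ : IsSingletonMod n Ξ) :
    IsPunctured n X where
  add_mem := h.add_mem_X
  dvd_sub x y hx hy := hΞ.dvd_sub ((h.mem_or x).resolve_left hx) ((h.mem_or y).resolve_left hy)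
  compl_nonempty := h.nonempty_Ξ.imp fun _ hξ => h.notMem_X hξ

/-- In the order with X increasing and then Ξ decreasing, `c` maps every integer to a later one on
the same side, so it is the next map of the relation with a single class. -/
theorem IsCoxeterPartition.isModel [NeZero n] (h : IsCoxeterPartition c X Ξ)
    (hc : IsCoxeterElement hn c) : IsModel hn X c fun _ _ => True where
  equiv := ⟨fun _ => trivial, fun _ => trivial, fun _ _ => trivial⟩
  add_iff _ _ := Iff.rfl
  nc _ _ _ _ _ _ _ _ _ := trivial
  inf_X _ _ _ _ _ := trivial
  inf_compl _ _ _ := h.nonempty_X.imp fun _ hx => ⟨hx, trivial⟩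
  apply _ := trivial
  up u v _ _ := by
    have hXΞ : ∀ {y}, y ∉ X → y ∈ Ξ := fun {y} hy => (h.mem_or y).resolve_left hy
    by_cases hv : pos X v ≤ pos X u
    · exact Or.inl hv
    right
    rw [not_le, pos_lt_iff] at hv
    rw [pos_le_iff]
    rcases hv with ⟨hu, hv, hlt⟩ | ⟨hu, hv⟩ | ⟨hu, hv, hlt⟩
    · exact Or.inl ⟨h.apply_mem_X.2 hu, hv, (h.next_X u hu).2 ⟨hv, hlt⟩⟩
    · exact Or.inr (Or.inl ⟨h.apply_mem_X.2 hu, hv⟩)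
    · exact Or.inr (Or.inr ⟨fun h' => hu (h.apply_mem_X.1 h'), hv,
        (h.prev_Ξ u (hXΞ hu)).2 ⟨hXΞ hv, hlt⟩⟩)
  wrap u v _ hu := by
    exfalso
    rw [pos_le_iff, h.apply_mem_X] at hu
    rcases hu with ⟨-, h1, h2⟩ | ⟨h1, h2⟩ | ⟨-, h1, h2⟩
    · have := h.lt_apply h1
      omega
    · exact h2 h1
    · have := h.apply_lt ((h.mem_or u).resolve_left h1)
      omega
  length_add := by
    rw [hc.length_eq, h.finrank_invar, twiceInf_of_exists (u := 0) trivial]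

theorem IsCoxeterElement.isDivisorLattice (hc : IsCoxeterElement hn c)
    (h : IsCoxeterPartition c X Ξ) (hs : IsSingletonMod n X ∨ IsSingletonMod n Ξ) :
    IsDivisorLattice (reflections hn) c := by
  have : NeZero n := ⟨by omega⟩
  have hR := isReflectionSet_reflections hn
  rcases hs with hs | hs
  · have h1 := IsDivisorLattice.of_inf hR fun p q hp hq =>
      (h.inv.isModel hc.inv).exists_inf (h.inv.isPunctured hs) hp hq
    have h2 := h1.inv hR
    rwa [inv_inv] at h2
  · exact IsDivisorLattice.of_inf hR fun p q hp hq =>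
      (h.isModel hc).exists_inf (h.isPunctured hs) hp hq

end Lattice

/-! ### Failure of the lattice property -/

open AffineW

section Cycle

variable {n : ℕ}

/-- On the integers whose class modulo `n` is in `S`, `w` is the map to the next element: the next
larger one if `σ = 1`, the next smaller one if `σ = -1`. -/
def IsNextOn (σ : ℤ) (S : Finset (ZMod n)) (w : AffineW n) : Prop :=
  ∀ x : ℤ, (x : ZMod n) ∈ S → ((w.1 x : ℤ) : ZMod n) ∈ S ∧ σ * x < σ * w.1 x ∧
    ∀ y : ℤ, (y : ZMod n) ∈ S → σ * x < σ * y → σ * w.1 x ≤ σ * y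

theorem exists_congr_between [NeZero n] (a y : ℤ) (h : (a : ZMod n) ≠ (y : ZMod n)) :
    ∃ b : ℤ, (b : ZMod n) = a ∧ y < b ∧ b < y + n := by
  have hn' : (0 : ℤ) < n := by exact_mod_cast NeZero.pos n
  have e := Int.emod_add_mul_ediv (a - y) n
  have h1 := Int.emod_nonneg (a - y) hn'.ne'
  have h2 := Int.emod_lt_of_pos (a - y) hn'
  have h3 : (a - y) % n ≠ 0 := fun h0 =>
    h ((ZMod.intCast_eq_intCast_iff_dvd_sub _ _ _).2 (Int.dvd_of_emod_eq_zero h0)).symm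
  refine ⟨y + (a - y) % n, ?_, by omega, by omega⟩
  rw [show y + (a - y) % n = a + -((a - y) / n) * n by linarith]
  simp

theorem IsNextOn.exists_apply_eq [NeZero n] {σ : ℤ} {S : Finset (ZMod n)} {w : AffineW n}
    (h : IsNextOn σ S w) {y : ℤ} (hy : (y : ZMod n) ∈ S) :
    (((w⁻¹).1 y : ℤ) : ZMod n) ∈ S := by
  have hmap : S.image (bar w) = S := by
    refine Finset.eq_of_subset_of_card_le ?_ ?_
    · intro u hu
      obtain ⟨z, hz, rfl⟩ := Finset.mem_image.1 hu
      obtain ⟨x, rfl⟩ := ZMod.intCast_surjective z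
      rw [bar_intCast]
      exact (h x hz).1
    · rw [Finset.card_image_of_injective _ (bar w).injective]
  rw [← hmap] at hy
  obtain ⟨z, hz, hzy⟩ := Finset.mem_image.1 hy
  obtain ⟨x, rfl⟩ := ZMod.intCast_surjective z
  have : (((w⁻¹).1 y : ℤ) : ZMod n) = x := by
    rw [← bar_intCast, ← hzy, bar_intCast, bar_intCast, AffineW.inv_apply_self]
  rwa [this]

/-- Removing an element from a cycle. -/
theorem IsNextOn.erase [NeZero n] {σ : ℤ} (hσ : σ = 1 ∨ σ = -1) {S : Finset (ZMod n)}
    {w : AffineW n} (h : IsNextOn σ S w) {y a : ℤ} (ha : (a : ZMod n) ∈ S)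
    (hay : (a : ZMod n) ≠ y) (hne : ¬ (n : ℤ) ∣ y - (w⁻¹).1 y) :
    IsNextOn σ (S.erase y) (w * affineTransp n ((w⁻¹).1 y) y hne) := by
  set z := (w⁻¹).1 y with hz
  have hwz : w.1 z = y := AffineW.apply_inv_self w y
  have hn' : (0 : ℤ) < n := by exact_mod_cast NeZero.pos n
  have hcong : ∀ u v : ℤ, (u : ZMod n) = v → ((w.1 u : ℤ) : ZMod n) = (w.1 v : ℤ) := fun u v e => by
    rw [← bar_intCast, ← bar_intCast, e]
  intro x hx
  rw [Finset.mem_erase] at hx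
  obtain ⟨hxy, hxS⟩ := hx
  obtain ⟨h1, h2, h3⟩ := h x hxS
  -- If `x` precedes a translate of `y` in the cycle, the new map skips that translate.
  by_cases hwx : ((w.1 x : ℤ) : ZMod n) = y
  · have hval : (w * affineTransp n z y hne).1 x = w.1 (w.1 x) := by
      obtain ⟨k, hk⟩ := (ZMod.intCast_eq_intCast_iff_dvd_sub _ _ _).1 hwx.symm
      have hx : x = z + k * n := by
        apply w.1.injective
        rw [AffineW.apply_add_mul, hwz]
        linarith
      rw [AffineW.mul_apply, hx, transp_left, AffineW.apply_add_mul w z, hwz]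
    obtain ⟨h4, h5, h6⟩ := h (w.1 x) h1
    rw [hval]
    refine ⟨Finset.mem_erase.2 ⟨fun h7 => ?_, h4⟩, h2.trans h5, fun v hv hxv => ?_⟩
    -- Two consecutive elements of the cycle cannot both be congruent to `y`, because a translate of
    -- `a` lies between them.
    · obtain ⟨k, hk⟩ := (ZMod.intCast_eq_intCast_iff_dvd_sub _ _ _).1 (hwx.trans h7.symm)
      have hay' : (a : ZMod n) ≠ (w.1 x : ℤ) := by rwa [hwx]
      obtain ⟨b, hb, hb1, hb2⟩ := exists_congr_between a (w.1 x) hay'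
      rcases hσ with rfl | rfl
      · have h8 := h6 b (hb ▸ ha) (by linarith)
        have : k < 1 := by
          by_contra! hk1
          nlinarith
        have : 0 < k := by
          by_contra! hk1
          nlinarith
        omega
      · have h8 := h6 (b - n) (by push_cast; simp [hb, ha]) (by linarith)
        have : -1 < k := by
          by_contra! hk1
          nlinarith
        have : k < 0 := by
          by_contra! hk1
          nlinarith
        omega
    · rw [Finset.mem_erase] at hv
      refine h6 v hv.2 (lt_of_le_of_ne (h3 v hv.2 hxv) fun h7 => hv.1 ?_)
      have : w.1 x = v := by rcases hσ with rfl | rfl <;> linarith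
      rw [← this, hwx]
  · have hval : (w * affineTransp n z y hne).1 x = w.1 x := by
      rw [AffineW.mul_apply, transp_other]
      · intro hd
        apply hwx
        rw [← hwz]
        exact hcong _ _ ((ZMod.intCast_eq_intCast_iff_dvd_sub _ _ _).2 hd).symm
      · intro hd
        exact hxy ((ZMod.intCast_eq_intCast_iff_dvd_sub _ _ _).2 hd).symm
    rw [hval]
    exact ⟨Finset.mem_erase.2 ⟨hwx, h1⟩, h2, fun v hv hxv =>
      h3 v (Finset.mem_erase.1 hv).2 hxv⟩

theorem IsNextOn.mul_transp {σ : ℤ} {S : Finset (ZMod n)} {w : AffineW n} (h : IsNextOn σ S w)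
    {z y : ℤ} (hne : ¬ (n : ℤ) ∣ y - z) (hz : (z : ZMod n) ∉ S) (hy : (y : ZMod n) ∉ S) :
    IsNextOn σ S (w * affineTransp n z y hne) := by
  intro x hx
  have hval : (w * affineTransp n z y hne).1 x = w.1 x := by
    rw [AffineW.mul_apply, transp_other]
    · intro hd
      exact hz ((ZMod.intCast_eq_intCast_iff_dvd_sub _ _ _).2 hd ▸ hx)
    · intro hd
      exact hy ((ZMod.intCast_eq_intCast_iff_dvd_sub _ _ _).2 hd ▸ hx)
  rw [hval]
  exact h x hx

/-- `w` increases to the next element on `S`, decreases to the next element on `T`, and fixes the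
other integers. -/
structure IsBicycle (w : AffineW n) (S T : Finset (ZMod n)) : Prop where
  disjoint : Disjoint S T
  up : IsNextOn 1 S w
  down : IsNextOn (-1) T w
  fix : ∀ x : ℤ, (x : ZMod n) ∉ S → (x : ZMod n) ∉ T → w.1 x = x

namespace IsBicycle

variable [NeZero n] {w : AffineW n} {S T : Finset (ZMod n)}

theorem not_dvd_sub {σ : ℤ} (hσ : σ = 1 ∨ σ = -1) {S : Finset (ZMod n)}
    (h : IsNextOn σ S w) {y a : ℤ} (hy : (y : ZMod n) ∈ S) (ha : (a : ZMod n) ∈ S)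
    (hay : (a : ZMod n) ≠ y) : ¬ (n : ℤ) ∣ y - (w⁻¹).1 y := by
  rintro ⟨k, hk⟩
  have hn' : (0 : ℤ) < n := by exact_mod_cast NeZero.pos n
  have hzS := h.exists_apply_eq hy
  set z := (w⁻¹).1 y with hz
  have hwz : w.1 z = y := AffineW.apply_inv_self w y
  obtain ⟨-, h2, h3⟩ := h z hzS
  have hzy : (z : ZMod n) = y := (ZMod.intCast_eq_intCast_iff_dvd_sub _ _ _).2 ⟨k, hk⟩
  obtain ⟨b, hb, hb1, hb2⟩ := exists_congr_between a z (by rwa [hzy])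
  rw [hwz] at h2 h3
  rcases hσ with rfl | rfl
  · have h8 := h3 b (hb ▸ ha) (by linarith)
    have : k < 1 := by
      by_contra! hk1
      nlinarith
    have : 0 < k := by
      by_contra! hk1
      nlinarith
    omega
  · have h8 := h3 (b - n) (by push_cast; simp [hb, ha]) (by linarith)
    have : -1 < k := by
      by_contra! hk1
      nlinarith
    have : k < 0 := by
      by_contra! hk1
      nlinarith
    omega

theorem erase_up (h : IsBicycle w S T) {y a : ℤ} (hy : (y : ZMod n) ∈ S) (ha : (a : ZMod n) ∈ S)
    (hay : (a : ZMod n) ≠ y) :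
    ∃ (z : ℤ) (hne : ¬ (n : ℤ) ∣ y - z), IsBicycle (w * affineTransp n z y hne) (S.erase y) T := by
  have hne := not_dvd_sub (Or.inl rfl) h.up hy ha hay
  have hzS := h.up.exists_apply_eq hy
  have hT : ∀ u ∈ S, u ∉ T := fun u hu hu' => Finset.disjoint_left.1 h.disjoint hu hu'
  refine ⟨_, hne, h.disjoint.mono_left (Finset.erase_subset _ _), h.up.erase (Or.inl rfl) ha hay hne,
    h.down.mul_transp hne (hT _ hzS) (hT _ hy), fun x hxS hxT => ?_⟩
  set z := (w⁻¹).1 y with hz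
  have hwz : w.1 z = y := AffineW.apply_inv_self w y
  by_cases hxy : (x : ZMod n) = y
  · obtain ⟨k, hk⟩ := (ZMod.intCast_eq_intCast_iff_dvd_sub _ _ _).1 hxy.symm
    obtain rfl : x = y + k * n := by linarith
    rw [AffineW.mul_apply, transp_right, AffineW.apply_add_mul, hwz]
  · have hxS' : (x : ZMod n) ∉ S := fun h => hxS (Finset.mem_erase.2 ⟨hxy, h⟩)
    rw [AffineW.mul_apply, transp_other]
    · exact h.fix x hxS' hxT
    · intro hd
      exact hxS' ((ZMod.intCast_eq_intCast_iff_dvd_sub _ _ _).2 hd ▸ hzS)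
    · intro hd
      exact hxy ((ZMod.intCast_eq_intCast_iff_dvd_sub _ _ _).2 hd).symm

theorem erase_down (h : IsBicycle w S T) {y a : ℤ} (hy : (y : ZMod n) ∈ T) (ha : (a : ZMod n) ∈ T)
    (hay : (a : ZMod n) ≠ y) :
    ∃ (z : ℤ) (hne : ¬ (n : ℤ) ∣ y - z), IsBicycle (w * affineTransp n z y hne) S (T.erase y) := by
  have hne := not_dvd_sub (Or.inr rfl) h.down hy ha hay
  have hzT := h.down.exists_apply_eq hy
  have hS : ∀ u ∈ T, u ∉ S := fun u hu hu' => Finset.disjoint_left.1 h.disjoint hu' hu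
  refine ⟨_, hne, h.disjoint.mono_right (Finset.erase_subset _ _),
    h.up.mul_transp hne (hS _ hzT) (hS _ hy), h.down.erase (Or.inr rfl) ha hay hne,
    fun x hxS hxT => ?_⟩
  set z := (w⁻¹).1 y with hz
  have hwz : w.1 z = y := AffineW.apply_inv_self w y
  by_cases hxy : (x : ZMod n) = y
  · obtain ⟨k, hk⟩ := (ZMod.intCast_eq_intCast_iff_dvd_sub _ _ _).1 hxy.symm
    obtain rfl : x = y + k * n := by linarith
    rw [AffineW.mul_apply, transp_right, AffineW.apply_add_mul, hwz]
  · have hxT' : (x : ZMod n) ∉ T := fun h => hxT (Finset.mem_erase.2 ⟨hxy, h⟩)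
    rw [AffineW.mul_apply, transp_other]
    · exact h.fix x hxS hxT'
    · intro hd
      exact hxT' ((ZMod.intCast_eq_intCast_iff_dvd_sub _ _ _).2 hd ▸ hzT)
    · intro hd
      exact hxy ((ZMod.intCast_eq_intCast_iff_dvd_sub _ _ _).2 hd).symm

/-- Residues are removed one at a time, each at the cost of one reflection; nonemptiness of the
targets leaves a residue `a` in the cycle at every step. -/
theorem exists_erase (hn : 2 ≤ n) (S' T' : Finset (ZMod n)) (hS' : S'.Nonempty) (hT' : T'.Nonempty)
    (k : ℕ) : ∀ (w : AffineW n) (S T : Finset (ZMod n)), IsBicycle w S T → S' ⊆ S → T' ⊆ T →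
      S.card + T.card = S'.card + T'.card + k →
      ∃ v, IsBicycle v S' T' ∧ reflLength (reflections hn) (v⁻¹ * w) ≤ k := by
  have hR := isReflectionSet_reflections hn
  have hstep : ∀ (w v t : AffineW n), t ∈ reflections hn → t * t = 1 → ∀ k,
      reflLength (reflections hn) (v⁻¹ * (w * t)) ≤ k →
      reflLength (reflections hn) (v⁻¹ * w) ≤ k + 1 := by
    intro w v t ht htt k hk
    have h1 := hR.length_mul_le (v⁻¹ * (w * t)) t
    rw [mul_assoc, mul_assoc, htt, mul_one] at h1
    have := reflLength_le_one ht
    omega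
  induction k with
  | zero =>
    intro w S T h hS hT hcard
    have h1 := Finset.card_le_card hS
    have h2 := Finset.card_le_card hT
    obtain rfl := Finset.eq_of_subset_of_card_le hS (by omega)
    obtain rfl := Finset.eq_of_subset_of_card_le hT (by omega)
    exact ⟨w, h, by rw [inv_mul_cancel, reflLength_one]⟩
  | succ k ih =>
    intro w S T h hS hT hcard
    by_cases hSS : S = S'
    · have hTT : T' ⊂ T := by
        refine lt_of_le_of_ne hT ?_
        rintro rfl
        rw [hSS] at hcard
        omega
      obtain ⟨y, hyT, hyT'⟩ := Finset.exists_of_ssubset hTT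
      obtain ⟨a, ha⟩ := hT'
      obtain ⟨y, rfl⟩ := ZMod.intCast_surjective y
      obtain ⟨a, rfl⟩ := ZMod.intCast_surjective a
      have hay : (a : ZMod n) ≠ y := fun h => hyT' (h ▸ ha)
      obtain ⟨z, hne, hw⟩ := h.erase_down hyT (hT ha) hay
      have hcard' := Finset.card_erase_of_mem hyT
      have hpos := Finset.card_pos.2 ⟨_, hyT⟩
      obtain ⟨v, hv1, hv2⟩ := ih _ _ _ hw hS (Finset.subset_erase.2 ⟨hT, hyT'⟩) (by omega)
      exact ⟨v, hv1, hstep _ _ _ (transp_mem_reflections hn hne) (transp_mul_self hne) _ hv2⟩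
    · have hSS' : S' ⊂ S := lt_of_le_of_ne hS (Ne.symm hSS)
      obtain ⟨y, hyS, hyS'⟩ := Finset.exists_of_ssubset hSS'
      obtain ⟨a, ha⟩ := hS'
      obtain ⟨y, rfl⟩ := ZMod.intCast_surjective y
      obtain ⟨a, rfl⟩ := ZMod.intCast_surjective a
      have hay : (a : ZMod n) ≠ y := fun h => hyS' (h ▸ ha)
      obtain ⟨z, hne, hw⟩ := h.erase_up hyS (hS ha) hay
      have hcard' := Finset.card_erase_of_mem hyS
      have hpos := Finset.card_pos.2 ⟨_, hyS⟩
      obtain ⟨v, hv1, hv2⟩ := ih _ _ _ hw (Finset.subset_erase.2 ⟨hS, hyS'⟩) hT (by omega)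
      exact ⟨v, hv1, hstep _ _ _ (transp_mem_reflections hn hne) (transp_mul_self hne) _ hv2⟩

end IsBicycle

end Cycle

/-! ### Coxeter elements without the lattice property -/

open AffineW

section NotLattice

variable {n : ℕ}

/-- The element of `W` that translates the class of `b` by `n` and the class of `α` by `-n`. -/
def transl (n : ℕ) (b α : ℤ) (h : ¬ (n : ℤ) ∣ α - b) : AffineW n :=
  affineTransp n b α h * affineTransp n b (α + n) (by
    rwa [show α + n - b = α - b + n by ring, dvd_add_self_right])

theorem eq_transl {b α : ℤ} (h : ¬ (n : ℤ) ∣ α - b) {w : AffineW n} (hb : w.1 b = b + n)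
    (hα : w.1 α = α - n) (hw : ∀ x, ¬ (n : ℤ) ∣ x - b → ¬ (n : ℤ) ∣ x - α → w.1 x = x) :
    w = transl n b α h := by
  have h' : ¬ (n : ℤ) ∣ α + n - b := by
    rwa [show α + n - b = α - b + n by ring, dvd_add_self_right]
  have h1 : (transl n b α h).1 b = b + n := by
    rw [transl, AffineW.mul_apply, transp_left']
    simpa using transp_right h 1
  have h2 : (transl n b α h).1 α = α - n := by
    have e := transp_right h' (-1)
    rw [show α + n + -1 * n = α by ring] at e
    rw [transl, AffineW.mul_apply, e, transp_left]
    ring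
  refine AffineW.ext_apply fun x => ?_
  by_cases hxb : (n : ℤ) ∣ x - b
  · obtain ⟨k, hk⟩ := hxb
    obtain rfl : x = b + k * n := by linarith
    rw [AffineW.apply_add_mul, AffineW.apply_add_mul, hb, h1]
  by_cases hxα : (n : ℤ) ∣ x - α
  · obtain ⟨k, hk⟩ := hxα
    obtain rfl : x = α + k * n := by linarith
    rw [AffineW.apply_add_mul, AffineW.apply_add_mul, hα, h2]
  · rw [hw x hxb hxα, transl, AffineW.mul_apply, transp_other h' hxb, transp_other h hxb hxα]
    rwa [show x - (α + n) = x - α - n by ring, dvd_sub_self_right]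

variable (hn : 2 ≤ n)

theorem reflLength_transl_le {b α : ℤ} (h : ¬ (n : ℤ) ∣ α - b) :
    reflLength (reflections hn) (transl n b α h) ≤ 2 := by
  have h1 := (isReflectionSet_reflections hn).length_mul_le (affineTransp n b α h)
    (affineTransp n b (α + n) (by
      rwa [show α + n - b = α - b + n by ring, dvd_add_self_right]))
  have h2 := reflLength_le_one (transp_mem_reflections hn h)
  have h3 := reflLength_le_one (transp_mem_reflections hn (a := b) (b := α + n) (by
      rwa [show α + n - b = α - b + n by ring, dvd_add_self_right]))
  unfold transl
  omega

/-- If a product of two reflections translates `x`, then the first one moves `x`. -/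
theorem apply_ne_of_mul_translates {t u : AffineW n} (hu : u ∈ reflections hn) {x j : ℤ}
    (hj : j ≠ 0) (h : (t * u).1 x = x + j * n) : t.1 x ≠ x := by
  intro ht
  have hn' : (n : ℤ) ≠ 0 := by omega
  have h1 : u.1 x = x + j * n := by
    apply t.1.injective
    rw [← AffineW.mul_apply, h, AffineW.apply_add_mul, ht]
  obtain ⟨p, q, hpq, rfl⟩ := exists_eq_transp hn hu
  rcases transp_cases hpq x with ⟨k, rfl, hk⟩ | ⟨k, rfl, hk⟩ | ⟨-, -, hx⟩
  · exact hpq ⟨j, by linarith⟩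
  · exact hpq ⟨-j, by linarith⟩
  · rw [hx] at h1
    have : j * n = 0 := by linarith
    exact (mul_ne_zero hj hn') this

variable {hn} {c : AffineW n} {X Ξ : Set ℤ}

/-- `p` maps `a` to `b`, `b` to `a + n`, `α` to `α - n`, and fixes the other classes. -/
structure IsTriple (p : AffineW n) (a b α : ℤ) : Prop where
  hab : ¬ (n : ℤ) ∣ b - a
  haα : ¬ (n : ℤ) ∣ α - a
  hbα : ¬ (n : ℤ) ∣ α - b
  apply_a : p.1 a = b
  apply_b : p.1 b = a + n
  apply_α : p.1 α = α - n
  apply_other : ∀ x, ¬ (n : ℤ) ∣ x - a → ¬ (n : ℤ) ∣ x - b → ¬ (n : ℤ) ∣ x - α → p.1 x = x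

namespace IsTriple

variable {p : AffineW n} {a b α : ℤ} (h : IsTriple p a b α)

include h

/-- Reading the cycle from `b` provides the second reflection below `p` without a new argument. -/
theorem rotate : IsTriple p b (a + n) α where
  hab := by
    rw [show a + n - b = -(b - a) + n by ring, dvd_add_self_right, dvd_neg]
    exact h.hab
  haα := h.hbα
  hbα := by
    rw [show α - (a + n) = α - a - n by ring, dvd_sub_self_right]
    exact h.haα
  apply_a := h.apply_b
  apply_b := by
    have := apply_add_mul p a 1
    rw [one_mul] at this
    rw [this, h.apply_a]
  apply_α := h.apply_α
  apply_other x hb ha hα := by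
    refine h.apply_other x ?_ hb hα
    rwa [show x - (a + n) = x - a - n by ring, dvd_sub_self_right] at ha

theorem transp_mul : affineTransp n a b h.hab * p = transl n b α h.hbα := by
  refine eq_transl h.hbα ?_ ?_ fun x hxb hxα => ?_
  · rw [AffineW.mul_apply, h.apply_b]
    simpa using transp_left h.hab 1
  · rw [AffineW.mul_apply, h.apply_α, transp_other]
    · rw [show α - n - a = α - a - n by ring, dvd_sub_self_right]
      exact h.haα
    · rw [show α - n - b = α - b - n by ring, dvd_sub_self_right]
      exact h.hbα
  · rw [AffineW.mul_apply]
    by_cases hxa : (n : ℤ) ∣ x - a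
    · obtain ⟨k, hk⟩ := hxa
      obtain rfl : x = a + k * n := by linarith
      rw [AffineW.apply_add_mul, h.apply_a, transp_right]
    · rw [h.apply_other x hxa hxb hxα, transp_other _ hxa hxb]

theorem length_le : reflLength (reflections hn) p ≤ 3 := by
  have h1 := (isReflectionSet_reflections hn).length_mul_le (affineTransp n a b h.hab)
    (affineTransp n a b h.hab * p)
  rw [← mul_assoc, transp_mul_self, one_mul, h.transp_mul] at h1
  have h2 := reflLength_le_one (transp_mem_reflections hn h.hab)
  have h3 := reflLength_transl_le hn h.hbα
  omega

variable (hl : reflLength (reflections hn) p = 3)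

include hl

theorem length_transp : reflLength (reflections hn) (affineTransp n a b h.hab) = 1 := by
  have h1 := (isReflectionSet_reflections hn).length_mul_le (affineTransp n a b h.hab)
    (affineTransp n a b h.hab * p)
  rw [← mul_assoc, transp_mul_self, one_mul, h.transp_mul, hl] at h1
  have h2 := reflLength_le_one (transp_mem_reflections hn h.hab)
  have h3 := reflLength_transl_le hn h.hbα
  omega

theorem transp_absLE : AbsLE (reflections hn) (affineTransp n a b h.hab) p := by
  have h1 := (isReflectionSet_reflections hn).length_mul_le (affineTransp n a b h.hab)
    (affineTransp n a b h.hab * p)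
  rw [← mul_assoc, transp_mul_self, one_mul, hl] at h1
  have h3 := reflLength_transl_le hn h.hbα
  rw [← h.transp_mul] at h3
  have h4 := h.length_transp hl
  rw [AbsLE, transp_inv, hl]
  omega

end IsTriple

/-- Two reflections below two elements of length three have no least upper bound below both. -/
theorem not_exists_between {p q s : AffineW n} {a b α β : ℤ} (hp : IsTriple p a b α)
    (hq : IsTriple q a b β) (hαβ : ¬ (n : ℤ) ∣ β - α) (hpl : reflLength (reflections hn) p = 3)
    (hql : reflLength (reflections hn) q = 3)
    (h1 : AbsLE (reflections hn) (affineTransp n a b hp.hab) s)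
    (h2 : AbsLE (reflections hn) (affineTransp n b (a + n) hp.rotate.hab) s)
    (h3 : AbsLE (reflections hn) s p) (h4 : AbsLE (reflections hn) s q) : False := by
  have hR := isReflectionSet_reflections hn
  have hn' : (0 : ℤ) < n := by omega
  have hl1 := hp.length_transp hpl
  have hl2 := hp.rotate.length_transp hpl
  -- The length of `s` must be two: in length one the two reflections would coincide, and in length
  -- three `p` and `q` would.
  have hs1 : 1 < reflLength (reflections hn) s := by
    by_contra! hs
    have e1 := hR.eq_of_absLE_of_length_le h1 (by omega)
    have e2 := hR.eq_of_absLE_of_length_le h2 (by omega)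
    have e3 := transp_right' hp.rotate.hab
    have e4 := transp_left hp.hab 1
    rw [e2, ← e1] at e3
    rw [one_mul] at e4
    rw [e4] at e3
    omega
  have hs3 : reflLength (reflections hn) s < 3 := by
    by_contra! hs
    have e1 := hR.eq_of_absLE_of_length_le h3 (by omega)
    have e2 := hR.eq_of_absLE_of_length_le h4 (by omega)
    have e3 := hp.apply_α
    rw [← e1, e2, hq.apply_other α hp.haα hp.hbα (by rwa [← dvd_neg, neg_sub])] at e3
    omega
  have ht : (affineTransp n a b hp.hab)⁻¹ * s ∈ reflections hn :=
    hR.mem_of_length_eq_one (by unfold AbsLE at h1; omega)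
  have hu : s⁻¹ * p ∈ reflections hn := hR.mem_of_length_eq_one (by unfold AbsLE at h3; omega)
  have hu' : s⁻¹ * q ∈ reflections hn := hR.mem_of_length_eq_one (by unfold AbsLE at h4; omega)
  set t := (affineTransp n a b hp.hab)⁻¹ * s with htdef
  have htu : t * (s⁻¹ * p) = affineTransp n a b hp.hab * p := by
    rw [htdef, transp_inv]; group
  have htu' : t * (s⁻¹ * q) = affineTransp n a b hp.hab * q := by
    rw [htdef, transp_inv]; group
  have hα' : ¬ (n : ℤ) ∣ α - n - a ∧ ¬ (n : ℤ) ∣ α - n - b := by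
    rw [show α - n - a = α - a - n by ring, show α - n - b = α - b - n by ring,
      dvd_sub_self_right, dvd_sub_self_right]
    exact ⟨hp.haα, hp.hbα⟩
  have hβ' : ¬ (n : ℤ) ∣ β - n - a ∧ ¬ (n : ℤ) ∣ β - n - b := by
    rw [show β - n - a = β - a - n by ring, show β - n - b = β - b - n by ring,
      dvd_sub_self_right, dvd_sub_self_right]
    exact ⟨hq.haα, hq.hbα⟩
  -- The products of `t` with `s⁻¹ p` and with `s⁻¹ q` translate `b`, as well as `α` and `β`
  -- respectively. As both second factors are reflections, `t` moves all three classes, whereas a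
  -- reflection moves only two.
  have mb : t.1 b ≠ b := by
    refine apply_ne_of_mul_translates hn hu (j := 1) one_ne_zero ?_
    rw [htu, AffineW.mul_apply, hp.apply_b]
    simpa using transp_left hp.hab 1
  have mα : t.1 α ≠ α := by
    refine apply_ne_of_mul_translates hn hu (j := -1) (by omega) ?_
    rw [htu, AffineW.mul_apply, hp.apply_α, transp_other _ hα'.1 hα'.2]
    ring
  have mβ : t.1 β ≠ β := by
    refine apply_ne_of_mul_translates hn hu' (j := -1) (by omega) ?_
    rw [htu', AffineW.mul_apply, hq.apply_α, transp_other _ hβ'.1 hβ'.2]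
    ring
  obtain ⟨x, y, hxy, hxyt⟩ := exists_eq_transp hn ht
  rw [hxyt] at mb mα mβ
  have key : ∀ z : ℤ, (affineTransp n x y hxy).1 z ≠ z → (n : ℤ) ∣ z - x ∨ (n : ℤ) ∣ z - y := by
    intro z hz
    by_contra! h
    exact hz (transp_other hxy h.1 h.2)
  have hsub : ∀ {u v z : ℤ}, ¬ (n : ℤ) ∣ u - v → (n : ℤ) ∣ u - z → ¬ (n : ℤ) ∣ v - z := by
    intro u v z h h1 h2
    have := dvd_sub h1 h2
    rw [sub_sub_sub_cancel_right] at this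
    exact h this
  have hαb := hsub (z := x) hp.hbα
  have hαb' := hsub (z := y) hp.hbα
  have hβb := hsub (z := x) hq.hbα
  have hβb' := hsub (z := y) hq.hbα
  have hβα := hsub (z := x) hαβ
  have hβα' := hsub (z := y) hαβ
  have k1 := key b mb
  have k2 := key α mα
  have k3 := key β mβ
  rcases k1 with k1 | k1 <;> rcases k2 with k2 | k2 <;> rcases k3 with k3 | k3 <;>
    first
    | exact hαb k2 k1
    | exact hαb' k2 k1
    | exact hβb k3 k1
    | exact hβb' k3 k1
    | exact hβα k3 k2
    | exact hβα' k3 k2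

/-- A divisor of length three of a Coxeter element. -/
theorem IsCoxeterPartition.exists_divisor (hc : IsCoxeterElement hn c)
    (h : IsCoxeterPartition c X Ξ) {a b α : ℤ} (ha : a ∈ X) (hb : b ∈ X) (hα : α ∈ Ξ)
    (hab : a < b) (hba : b < a + n) :
    ∃ p : AffineW n, AbsLE (reflections hn) p c ∧ reflLength (reflections hn) p = 3 ∧
      IsTriple p a b α := by
  classical
  have : NeZero n := ⟨by omega⟩
  have hn' : (0 : ℤ) < n := by omega
  let S : Finset (ZMod n) := {z | (z.cast : ℤ) ∈ X}
  let T : Finset (ZMod n) := {z | (z.cast : ℤ) ∈ Ξ}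
  have hcast : ∀ x : ℤ, (n : ℤ) ∣ ((x : ZMod n).cast : ℤ) - x := fun x => by
    rw [← ZMod.intCast_eq_intCast_iff_dvd_sub, intCast_cast]
  have hS : ∀ x : ℤ, (x : ZMod n) ∈ S ↔ x ∈ X := fun x => by
    rw [Finset.mem_filter_univ]; exact mem_congr_of_periodic h.add_mem_X (hcast x)
  have hT : ∀ x : ℤ, (x : ZMod n) ∈ T ↔ x ∈ Ξ := fun x => by
    rw [Finset.mem_filter_univ]; exact mem_congr_of_periodic h.add_mem_Ξ (hcast x)
  have hdisj : Disjoint S T := by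
    rw [Finset.disjoint_left]
    intro z
    obtain ⟨x, rfl⟩ := ZMod.intCast_surjective z
    rw [hS, hT]
    exact h.notMem_Ξ
  have hcard : S.card + T.card = n := by
    rw [← Finset.card_union_of_disjoint hdisj]
    have : S ∪ T = Finset.univ := by
      ext z
      obtain ⟨x, rfl⟩ := ZMod.intCast_surjective z
      simp only [Finset.mem_union, hS, hT, Finset.mem_univ, iff_true]
      exact h.mem_or x
    rw [this, Finset.card_univ, ZMod.card]
  have hbic : IsBicycle c S T := by
    refine ⟨hdisj, fun x hx => ?_, fun x hx => ?_, fun x hxS hxT => ?_⟩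
    · rw [hS] at hx
      refine ⟨(hS _).2 (h.apply_mem_X.2 hx), by linarith [h.lt_apply hx], fun y hy hxy => ?_⟩
      have := (h.next_X x hx).2 ⟨(hS y).1 hy, by linarith⟩
      linarith
    · rw [hT] at hx
      refine ⟨(hT _).2 (h.apply_mem_Ξ.2 hx), by linarith [h.apply_lt hx], fun y hy hxy => ?_⟩
      have := (h.prev_Ξ x hx).2 ⟨(hT y).1 hy, by linarith⟩
      linarith
    · rw [hS] at hxS
      rw [hT] at hxT
      exact absurd (h.mem_or x) (by tauto)
  have hne : (a : ZMod n) ≠ b := fun hab' => by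
    obtain ⟨k, hk⟩ := (ZMod.intCast_eq_intCast_iff_dvd_sub _ _ _).1 hab'
    have h1 : 0 < k := by nlinarith
    have h2 : k < 1 := by nlinarith
    omega
  have hcardS : ({(a : ZMod n), (b : ZMod n)} : Finset (ZMod n)).card = 2 := Finset.card_pair hne
  have hn3 : 3 ≤ n := by
    have h1 : 2 ≤ S.card := by
      rw [← hcardS]
      refine Finset.card_le_card ?_
      intro z hz
      rw [Finset.mem_insert, Finset.mem_singleton] at hz
      rcases hz with rfl | rfl
      · exact (hS a).2 ha
      · exact (hS b).2 hb
    have h2 : 0 < T.card := Finset.card_pos.2 ⟨_, (hT α).2 hα⟩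
    omega
  -- Erasing from the two cycles of `c` all residues but those of `a`, `b` and `α` takes `n - 3`
  -- reflections. As `c` has length `n`, the remainder `p` has length at least three.
  obtain ⟨p, hp, hlen⟩ := IsBicycle.exists_erase hn {(a : ZMod n), (b : ZMod n)} {(α : ZMod n)}
    ⟨_, Finset.mem_insert_self _ _⟩ ⟨_, Finset.mem_singleton_self _⟩ (n - 3) c S T hbic (by
      intro z hz
      rw [Finset.mem_insert, Finset.mem_singleton] at hz
      rcases hz with rfl | rfl
      · exact (hS a).2 ha
      · exact (hS b).2 hb) (by
      rw [Finset.singleton_subset_iff]; exact (hT α).2 hα) (by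
      rw [hcardS, Finset.card_singleton]; omega)
  have hpfix := hp.fix
  have hpup := hp.up
  have hpdown := hp.down
  have hmemS : ∀ x : ℤ, (x : ZMod n) ∈ ({(a : ZMod n), (b : ZMod n)} : Finset (ZMod n)) ↔
      (n : ℤ) ∣ x - a ∨ (n : ℤ) ∣ x - b := fun x => by
    rw [Finset.mem_insert, Finset.mem_singleton, eq_comm, ZMod.intCast_eq_intCast_iff_dvd_sub,
      eq_comm, ZMod.intCast_eq_intCast_iff_dvd_sub]
  have hmemT : ∀ x : ℤ, (x : ZMod n) ∈ ({(α : ZMod n)} : Finset (ZMod n)) ↔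
      (n : ℤ) ∣ x - α := fun x => by
    rw [Finset.mem_singleton, eq_comm, ZMod.intCast_eq_intCast_iff_dvd_sub]
  unfold IsNextOn at hpup hpdown
  simp only [hmemS, hmemT, one_mul, neg_one_mul, neg_lt_neg_iff, neg_le_neg_iff] at hpup hpdown hpfix
  have hpa : p.1 a = b := by
    obtain ⟨h1, h2, h3⟩ := hpup a (by simp)
    have h4 := h3 b (by simp) hab
    rcases h1 with ⟨k, hk⟩ | ⟨k, hk⟩
    · exfalso
      have h5 : 0 < k := by nlinarith
      nlinarith
    · have h5 : -1 < k := by nlinarith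
      have h6 : k ≤ 0 := by nlinarith
      obtain rfl : k = 0 := by omega
      linarith
  have hpb : p.1 b = a + n := by
    obtain ⟨h1, h2, h3⟩ := hpup b (by simp)
    have h4 := h3 (a + n) (by simp) hba
    rcases h1 with ⟨k, hk⟩ | ⟨k, hk⟩
    · have h5 : 0 < k := by nlinarith
      have h6 : k ≤ 1 := by nlinarith
      obtain rfl : k = 1 := by omega
      linarith
    · exfalso
      have h5 : 0 < k := by nlinarith
      nlinarith
  have hpα : p.1 α = α - n := by
    obtain ⟨⟨k, hk⟩, h2, h3⟩ := hpdown α (by simp)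
    have h4 := h3 (α - n) (by simp) (by linarith)
    have h5 : k < 0 := by nlinarith
    have h6 : -1 ≤ k := by nlinarith
    obtain rfl : k = -1 := by omega
    linarith
  have hR := isReflectionSet_reflections hn
  have h1 := hR.length_mul_le p (p⁻¹ * c)
  rw [mul_inv_cancel_left, hc.length_eq] at h1
  have hpα' : ¬ (n : ℤ) ∣ α - a := fun hd =>
    h.notMem_Ξ ha ((mem_congr_of_periodic h.add_mem_Ξ hd).1 hα)
  have hab' : ¬ (n : ℤ) ∣ b - a := fun hd =>
    hne ((ZMod.intCast_eq_intCast_iff_dvd_sub _ _ _).2 hd)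
  have hpfix' : ∀ x, ¬ (n : ℤ) ∣ x - a → ¬ (n : ℤ) ∣ x - b → ¬ (n : ℤ) ∣ x - α → p.1 x = x :=
    fun x h1 h2 h3 => hpfix x (by tauto) h3
  have hbα' : ¬ (n : ℤ) ∣ α - b := fun hd =>
    h.notMem_Ξ hb ((mem_congr_of_periodic h.add_mem_Ξ hd).1 hα)
  have htr : IsTriple p a b α := ⟨hab', hpα', hbα', hpa, hpb, hpα, hpfix'⟩
  have h2 := htr.length_le (hn := hn)
  have h3 : reflLength (reflections hn) p = 3 := by omega
  refine ⟨p, ?_, h3, htr⟩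
  rw [AbsLE, hc.length_eq, h3]
  omega

theorem exists_not_dvd_of_not_isSingletonMod {n : ℕ} {A : Set ℤ} (hA : A.Nonempty)
    (h : ¬ IsSingletonMod n A) : ∃ a ∈ A, ∃ b ∈ A, ¬ (n : ℤ) ∣ b - a := by
  by_contra! hall
  obtain ⟨a, ha⟩ := hA
  refine h (Set.ncard_eq_one.2 ⟨a, Set.eq_singleton_iff_unique_mem.2 ⟨⟨a, ha, rfl⟩, ?_⟩⟩)
  rintro _ ⟨b, hb, rfl⟩
  exact ((ZMod.intCast_eq_intCast_iff_dvd_sub _ _ _).2 (hall a ha b hb)).symm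

/-- A join of the two reflections in the monoid divides a generator, so it is itself a generator,
and `not_exists_between` applies to its value. -/
theorem IsCoxeterPartition.isSingletonMod_of_lattice (hc : IsCoxeterElement hn c)
    (h : IsCoxeterPartition c X Ξ)
    (hL : IsLatticeOrder (LeftDivides (M := DualMonoid (reflections hn) c))) :
    IsSingletonMod n X ∨ IsSingletonMod n Ξ := by
  by_contra! hs
  have : NeZero n := ⟨by omega⟩
  have hR := isReflectionSet_reflections hn
  obtain ⟨a, ha, b', hb', hab'⟩ := exists_not_dvd_of_not_isSingletonMod h.nonempty_X hs.1
  obtain ⟨α, hα, β, hβ, hαβ⟩ := exists_not_dvd_of_not_isSingletonMod h.nonempty_Ξ hs.2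
  obtain ⟨b, hbb, hab, hba⟩ := exists_congr_between b' a fun e =>
    hab' ((ZMod.intCast_eq_intCast_iff_dvd_sub _ _ _).1 e.symm)
  have hb : b ∈ X := (mem_congr_of_periodic h.add_mem_X
    ((ZMod.intCast_eq_intCast_iff_dvd_sub _ _ _).1 hbb.symm)).2 hb'
  obtain ⟨p, hpc, hpl, hp⟩ := h.exists_divisor hc ha hb hα hab hba
  obtain ⟨q, hqc, hql, hq⟩ := h.exists_divisor hc ha hb hβ hab hba
  have r1p := hp.transp_absLE hpl
  have r2p := hp.rotate.transp_absLE hpl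
  have r1q := hq.transp_absLE hql
  have r2q := hq.rotate.transp_absLE hql
  have r1c := hR.absLE_trans r1p hpc
  have r2c := hR.absLE_trans r2p hpc
  obtain ⟨m, h1, h2, h3⟩ := hL.sup (DualMonoid.gen r1c) (DualMonoid.gen r2c)
  have hmp := h3 (DualMonoid.gen hpc) ((DualMonoid.leftDivides_gen_iff hR _ _).2 r1p)
    ((DualMonoid.leftDivides_gen_iff hR _ _).2 r2p)
  have hmq := h3 (DualMonoid.gen hqc) ((DualMonoid.leftDivides_gen_iff hR _ _).2 r1q)
    ((DualMonoid.leftDivides_gen_iff hR _ _).2 r2q)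
  obtain ⟨m', hm'⟩ := hmp
  obtain ⟨hmc, e, -⟩ := DualMonoid.gen_of_mul_eq_gen hR hm'.symm
  rw [e] at h1 h2 hmq
  refine not_exists_between hp hq hαβ hpl hql ((DualMonoid.leftDivides_gen_iff hR _ _).1 h1)
    ((DualMonoid.leftDivides_gen_iff hR _ _).1 h2) ((DualMonoid.leftDivides_gen_iff hR hmc hpc).1 ?_)
    ((DualMonoid.leftDivides_gen_iff hR _ _).1 hmq)
  rw [← e]
  exact ⟨m', hm'⟩

theorem IsCoxeterPartition.isSingletonMod_of_lattice_right (hc : IsCoxeterElement hn c)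
    (h : IsCoxeterPartition c X Ξ)
    (hL : IsLatticeOrder (RightDivides (M := DualMonoid (reflections hn) c))) :
    IsSingletonMod n X ∨ IsSingletonMod n Ξ :=
  (h.inv.isSingletonMod_of_lattice hc.inv (DualMonoid.lattice_leftDivides_inv
    (isReflectionSet_reflections hn) hL)).symm

end NotLattice

/-! ### Diagram automorphisms -/

section Diagram

variable {n : ℕ}

/-- The permutation `x ↦ σ x + k` of `ℤ`, for `σ = ±1`. -/
def affPerm (σ k : ℤ) (hσ : σ * σ = 1) : Equiv.Perm ℤ where
  toFun x := σ * x + k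
  invFun x := σ * (x - k)
  left_inv x := by
    change σ * (σ * x + k - k) = x
    rw [add_sub_cancel_right, ← mul_assoc, hσ, one_mul]
  right_inv x := by
    change σ * (σ * (x - k)) + k = x
    rw [← mul_assoc, hσ, one_mul, sub_add_cancel]

variable {σ : ℤ} (k : ℤ) (hσ : σ * σ = 1)

theorem affPerm_apply (x : ℤ) : affPerm σ k hσ x = σ * x + k := rfl

theorem affPerm_inv : (affPerm σ k hσ)⁻¹ = affPerm σ (-(σ * k)) hσ := by
  ext x
  change σ * (x - k) = σ * x + -(σ * k)
  ring

include hσ in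
theorem dvd_mul_sub_iff (a b : ℤ) : (n : ℤ) ∣ σ * b - σ * a ↔ (n : ℤ) ∣ b - a := by
  rw [← mul_sub]
  refine ⟨fun h => ?_, fun h => h.mul_left σ⟩
  have := h.mul_left σ
  rwa [← mul_assoc, hσ, one_mul] at this

theorem not_dvd_affPerm {a b : ℤ} (h : ¬ (n : ℤ) ∣ b - a) :
    ¬ (n : ℤ) ∣ affPerm σ k hσ b - affPerm σ k hσ a := by
  rwa [affPerm_apply, affPerm_apply, add_sub_add_right_eq_sub, dvd_mul_sub_iff hσ]

theorem affPerm_conj_transp {a b : ℤ} (h : ¬ (n : ℤ) ∣ b - a) :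
    affPerm σ k hσ * (affineTransp n a b h).1 * (affPerm σ k hσ)⁻¹ =
      (affineTransp n (affPerm σ k hσ a) (affPerm σ k hσ b) (not_dvd_affPerm k hσ h)).1 := by
  rw [mul_inv_eq_iff_eq_mul]
  ext x
  rw [Equiv.Perm.mul_apply, Equiv.Perm.mul_apply]
  change affPerm σ k hσ (transpFun n a b x) = transpFun n _ _ (affPerm σ k hσ x)
  simp only [transpFun, affPerm_apply, add_sub_add_right_eq_sub, dvd_mul_sub_iff hσ]
  split_ifs <;> ring

variable (hn : 2 ≤ n)

-- Since reflections generate, it is enough that conjugation applies the affine map to the endpoints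
-- of a reflection.
include hn in
theorem affPerm_conj_mem (w : AffineW n) :
    affPerm σ k hσ * w.1 * (affPerm σ k hσ)⁻¹ ∈ AffineW n := by
  obtain ⟨l, -, hl, rfl⟩ := (isReflectionSet_reflections hn).exists_list w
  induction l with
  | nil => simp
  | cons r l ih =>
    obtain ⟨a, b, h, hr⟩ := exists_eq_transp hn (hl r (by simp))
    have h1 := ih fun x hx => hl x (by simp [hx])
    have h2 : affPerm σ k hσ * r.1 * (affPerm σ k hσ)⁻¹ ∈ AffineW n := by
      rw [hr, affPerm_conj_transp]
      exact Subtype.property _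
    have h3 := mul_mem h2 h1
    rw [List.prod_cons]
    convert h3 using 1
    rw [Subgroup.coe_mul]
    group

/-- Conjugation by `x ↦ σ x + k`. -/
def conjAut (σ k : ℤ) (hσ : σ * σ = 1) : AffineW n ≃* AffineW n where
  toFun w := ⟨affPerm σ k hσ * w.1 * (affPerm σ k hσ)⁻¹, affPerm_conj_mem k hσ hn w⟩
  invFun w := ⟨(affPerm σ k hσ)⁻¹ * w.1 * affPerm σ k hσ, by
    have := affPerm_conj_mem (-(σ * k)) hσ hn w
    rwa [← affPerm_inv, inv_inv] at this⟩
  left_inv w := Subtype.ext (by group)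
  right_inv w := Subtype.ext (by group)
  map_mul' v w := Subtype.ext (by
    simp only [Subgroup.coe_mul]
    group)

theorem conjAut_apply (w : AffineW n) (x : ℤ) :
    (conjAut hn σ k hσ w).1 (affPerm σ k hσ x) = affPerm σ k hσ (w.1 x) := by
  change (affPerm σ k hσ * w.1 * (affPerm σ k hσ)⁻¹) (affPerm σ k hσ x) = _
  simp

theorem simpleRefl_injective : Function.Injective (simpleRefl hn) := by
  intro i j h
  have h1 : (simpleRefl hn i).1 ((i : ℤ) + 1) = (i : ℤ) + 1 + 1 := transp_left' _
  rw [h] at h1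
  have hi := i.2
  have hj := j.2
  unfold simpleRefl at h1
  rcases transp_cases (not_dvd_succ_sub hn ((j : ℤ) + 1)) ((i : ℤ) + 1) with
    ⟨c, hc, -⟩ | ⟨c, hc, hc'⟩ | ⟨-, -, hx⟩
  · have h2 : c < 1 := by nlinarith
    have h3 : -1 < c := by nlinarith
    obtain rfl : c = 0 := by omega
    ext
    omega
  · rw [hc'] at h1
    omega
  · rw [hx] at h1
    omega

theorem isDiagramAut_conjAut : IsDiagramAut hn (conjAut hn σ k hσ) := by
  have hσ' : σ = 1 ∨ σ = -1 := Int.isUnit_iff.1 (IsUnit.of_mul_eq_one _ hσ)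
  have key : ∀ i, ∃ j, conjAut hn σ k hσ (simpleRefl hn i) = simpleRefl hn j := by
    intro i
    have h1 : conjAut hn σ k hσ (simpleRefl hn i) =
        affineTransp n (affPerm σ k hσ ((i : ℤ) + 1)) (affPerm σ k hσ ((i : ℤ) + 1 + 1))
          (not_dvd_affPerm k hσ (not_dvd_succ_sub hn _)) :=
      Subtype.ext (affPerm_conj_transp k hσ (not_dvd_succ_sub hn _))
    rw [h1]
    rcases hσ' with rfl | rfl
    · obtain ⟨j, hj⟩ := exists_eq_simpleRefl hn ((i : ℤ) + 1 + k)
      refine ⟨j, ?_⟩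
      rw [← hj]
      congr 1
      · rw [affPerm_apply]; ring
      · rw [affPerm_apply]; ring
    · obtain ⟨j, hj⟩ := exists_eq_simpleRefl hn (-((i : ℤ) + 1 + 1) + k)
      refine ⟨j, ?_⟩
      rw [← hj, ← transp_comm]
      congr 1
      · rw [affPerm_apply]; ring
      · rw [affPerm_apply]; ring
  choose ι hι using key
  have hinj : Function.Injective ι := fun i j h => by
    refine simpleRefl_injective hn ((conjAut hn σ k hσ).injective ?_)
    rw [hι, hι, h]
  exact ⟨Equiv.ofBijective ι (Finite.injective_iff_bijective.1 hinj), hι⟩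

theorem IsDiagramAut.mem_reflections_iff {φ : AffineW n ≃* AffineW n} (hφ : IsDiagramAut hn φ)
    (r : AffineW n) : r ∈ reflections hn ↔ φ r ∈ reflections hn := by
  obtain ⟨τ, hτ⟩ := hφ
  constructor
  · rintro ⟨i, g, rfl⟩
    exact ⟨τ i, φ g, by rw [map_mul, map_mul, map_inv, hτ]⟩
  · rintro ⟨i, g, hr⟩
    refine ⟨τ.symm i, φ.symm g, φ.injective ?_⟩
    rw [map_mul, map_mul, map_inv, hτ, hr, φ.apply_symm_apply, Equiv.apply_symm_apply]

variable {hn} {c : AffineW n} {X Ξ X' Ξ' : Set ℤ}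

theorem IsSingletonMod.eq_image {A B : Set ℤ} (hA : IsSingletonMod n A) (hB : IsSingletonMod n B)
    (hpA : ∀ x : ℤ, x + (n : ℤ) ∈ A ↔ x ∈ A) (hpB : ∀ x : ℤ, x + (n : ℤ) ∈ B ↔ x ∈ B)
    (hneA : A.Nonempty) (hneB : B.Nonempty) : ∃ k : ℤ, ∀ x, affPerm σ k hσ x ∈ B ↔ x ∈ A := by
  obtain ⟨a, ha⟩ := hneA
  obtain ⟨b, hb⟩ := hneB
  have key : ∀ {A : Set ℤ} {a : ℤ}, IsSingletonMod n A → (∀ x : ℤ, x + (n : ℤ) ∈ A ↔ x ∈ A) →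
      a ∈ A → ∀ x, x ∈ A ↔ (n : ℤ) ∣ x - a := fun hA hpA ha x =>
    ⟨fun hx => hA.dvd_sub hx ha, fun hd => (mem_congr_of_periodic hpA hd).2 ha⟩
  refine ⟨b - σ * a, fun x => ?_⟩
  rw [key hB hpB hb, key hA hpA ha, affPerm_apply,
    show σ * x + (b - σ * a) - b = σ * x - σ * a by ring, dvd_mul_sub_iff hσ]

theorem IsCoxeterPartition.mem_right_iff (h : IsCoxeterPartition c X Ξ) (x : ℤ) :
    x ∈ Ξ ↔ x ∉ X := ⟨h.notMem_X, (h.mem_or x).resolve_left⟩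

/-- A Coxeter element is determined by its partition, and an increasing affine map preserves next
larger and next smaller elements. -/
theorem IsCoxeterPartition.conj_one (h : IsCoxeterPartition c X Ξ)
    (hσ1 : σ = 1) {d : AffineW n} (h' : IsCoxeterPartition d X' Ξ')
    (hk : ∀ x, affPerm σ k hσ x ∈ X' ↔ x ∈ X) : conjAut hn σ k hσ c = d := by
  subst hσ1
  have hkΞ : ∀ x, affPerm 1 k hσ x ∈ Ξ' ↔ x ∈ Ξ := fun x => by
    rw [h.mem_right_iff, h'.mem_right_iff, hk]
  refine AffineW.ext_apply fun y => ?_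
  obtain ⟨x, rfl⟩ := (affPerm 1 k hσ).surjective y
  rw [conjAut_apply]
  rcases h.mem_or x with hx | hx
  · refine ((h'.next_X _ ((hk x).2 hx)).unique ?_).symm
    refine ⟨⟨(hk _).2 (h.apply_mem_X.2 hx), ?_⟩, ?_⟩
    · have := h.lt_apply hx
      simp only [affPerm_apply]; linarith
    · rintro y ⟨hy, hxy⟩
      obtain ⟨y, rfl⟩ := (affPerm 1 k hσ).surjective y
      simp only [affPerm_apply] at hxy ⊢
      have := (h.next_X x hx).2 ⟨(hk y).1 hy, by linarith⟩
      linarith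
  · refine ((h'.prev_Ξ _ ((hkΞ x).2 hx)).unique ?_).symm
    refine ⟨⟨(hkΞ _).2 (h.apply_mem_Ξ.2 hx), ?_⟩, ?_⟩
    · have := h.apply_lt hx
      simp only [affPerm_apply]; linarith
    · rintro y ⟨hy, hxy⟩
      obtain ⟨y, rfl⟩ := (affPerm 1 k hσ).surjective y
      simp only [affPerm_apply] at hxy ⊢
      have := (h.prev_Ξ x hx).2 ⟨(hkΞ y).1 hy, by linarith⟩
      linarith

/-- A decreasing affine map exchanges next larger and next smaller elements, hence the roles of X
and Ξ. -/
theorem IsCoxeterPartition.conj_neg_one (h : IsCoxeterPartition c X Ξ)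
    (hσ1 : σ = -1) {d : AffineW n} (h' : IsCoxeterPartition d X' Ξ')
    (hk : ∀ x, affPerm σ k hσ x ∈ X' ↔ x ∈ Ξ) : conjAut hn σ k hσ c = d := by
  subst hσ1
  have hkX : ∀ x, affPerm (-1) k hσ x ∈ Ξ' ↔ x ∈ X := fun x => by
    rw [h'.mem_right_iff, hk, h.mem_right_iff, not_not]
  refine AffineW.ext_apply fun y => ?_
  obtain ⟨x, rfl⟩ := (affPerm (-1) k hσ).surjective y
  rw [conjAut_apply]
  rcases h.mem_or x with hx | hx
  · refine ((h'.prev_Ξ _ ((hkX x).2 hx)).unique ?_).symm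
    refine ⟨⟨(hkX _).2 (h.apply_mem_X.2 hx), ?_⟩, ?_⟩
    · have := h.lt_apply hx
      simp only [affPerm_apply]; linarith
    · rintro y ⟨hy, hxy⟩
      obtain ⟨y, rfl⟩ := (affPerm (-1) k hσ).surjective y
      simp only [affPerm_apply] at hxy ⊢
      have := (h.next_X x hx).2 ⟨(hkX y).1 hy, by linarith⟩
      linarith
  · refine ((h'.next_X _ ((hk x).2 hx)).unique ?_).symm
    refine ⟨⟨(hk _).2 (h.apply_mem_Ξ.2 hx), ?_⟩, ?_⟩
    · have := h.apply_lt hx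
      simp only [affPerm_apply]; linarith
    · rintro y ⟨hy, hxy⟩
      obtain ⟨y, rfl⟩ := (affPerm (-1) k hσ).surjective y
      simp only [affPerm_apply] at hxy ⊢
      have := (h.prev_Ξ x hx).2 ⟨(hk y).1 hy, by linarith⟩
      linarith

/-- For `standardCoxeter` it is Ξ that is a single class. A translation moves it to Ξ for `c`, and a
map x ↦ -x + k moves it to X. -/
theorem IsCoxeterPartition.exists_isDiagramAut (h : IsCoxeterPartition c X Ξ)
    (hs : IsSingletonMod n X ∨ IsSingletonMod n Ξ) :
    ∃ φ : AffineW n ≃* AffineW n, IsDiagramAut hn φ ∧ φ (standardCoxeter hn) = c := by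
  obtain ⟨X₀, Ξ₀, h₀, hs₀⟩ := isSingletonMod_standard hn
  rcases hs with hs | hs
  · obtain ⟨k, hk⟩ := hs₀.eq_image (σ := -1) rfl hs h₀.add_mem_Ξ h.add_mem_X h₀.nonempty_Ξ
      h.nonempty_X
    exact ⟨_, isDiagramAut_conjAut k rfl hn, h₀.conj_neg_one k _ rfl h hk⟩
  · obtain ⟨k, hk⟩ := hs₀.eq_image (σ := 1) rfl hs h₀.add_mem_Ξ h.add_mem_Ξ h₀.nonempty_Ξ
      h.nonempty_Ξ
    refine ⟨_, isDiagramAut_conjAut k rfl hn, h₀.conj_one k _ rfl h fun x => ?_⟩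
    rw [← not_iff_not, ← h.mem_right_iff, ← h₀.mem_right_iff, hk]

end Diagram

theorem isCoxeterElement_standardCoxeter {n : ℕ} (hn : 2 ≤ n) :
    IsCoxeterElement hn (standardCoxeter hn) := ⟨_, List.Perm.refl _, rfl⟩

theorem mainTheorem3 (n : ℕ) (hn : 2 ≤ n) :
    -- for every Coxeter element the sets `X` and `Ξ` exist and are unique, and the equivalence
    (∀ c : AffineW n, IsCoxeterElement hn c →
      ∃ X Ξ : Set ℤ, IsCoxeterPartition c X Ξ ∧
        (∀ X' Ξ' : Set ℤ, IsCoxeterPartition c X' Ξ' → X' = X ∧ Ξ' = Ξ) ∧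
        (IsLatticeOrder (LeftDivides (M := DualMonoid (reflections hn) c)) ↔
          IsSingletonMod n X ∨ IsSingletonMod n Ξ) ∧
        (IsLatticeOrder (RightDivides (M := DualMonoid (reflections hn) c)) ↔
          IsSingletonMod n X ∨ IsSingletonMod n Ξ) ∧
        ((∃ Δ, IsQuasiGarside (DualMonoid (reflections hn) c) Δ) ↔
          IsSingletonMod n X ∨ IsSingletonMod n Ξ) ∧
        (IsQuasiGarside (DualMonoid (reflections hn) c)
            (DualMonoid.delta (reflections hn) c) ↔
          IsSingletonMod n X ∨ IsSingletonMod n Ξ)) ∧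
    -- the Coxeter element `s_1 ⋯ s_n`
    (IsCoxeterElement hn (standardCoxeter hn) ∧
      IsQuasiGarside (DualMonoid (reflections hn) (standardCoxeter hn))
        (DualMonoid.delta (reflections hn) (standardCoxeter hn))) ∧
    -- uniqueness up to diagram automorphism
    (∀ c : AffineW n, IsCoxeterElement hn c →
      ((∃ Δ, IsQuasiGarside (DualMonoid (reflections hn) c) Δ) ↔
        ∃ φ : AffineW n ≃* AffineW n, IsDiagramAut hn φ ∧ φ (standardCoxeter hn) = c)) := by

  have hR := isReflectionSet_reflections hn
  have hstd : IsQuasiGarside (DualMonoid (reflections hn) (standardCoxeter hn))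
      (DualMonoid.delta (reflections hn) (standardCoxeter hn)) := by
    obtain ⟨X₀, Ξ₀, h₀, hs₀⟩ := isSingletonMod_standard hn
    exact ((isCoxeterElement_standardCoxeter hn).isDivisorLattice h₀ (Or.inr hs₀)).isQuasiGarside hR
  refine ⟨fun c hc => ?_, ⟨isCoxeterElement_standardCoxeter hn, hstd⟩, fun c hc => ⟨?_, ?_⟩⟩
  · obtain ⟨X, Ξ, h⟩ := hc.exists_partition
    have hG := fun hs => (hc.isDivisorLattice h hs).isQuasiGarside hR
    exact ⟨X, Ξ, h, fun _ _ h' => h.unique h',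
      ⟨h.isSingletonMod_of_lattice hc, fun hs => (hG hs).lattice_left⟩,
      ⟨h.isSingletonMod_of_lattice_right hc, fun hs => (hG hs).lattice_right⟩,
      ⟨fun ⟨_, hΔ⟩ => h.isSingletonMod_of_lattice hc hΔ.lattice_left, fun hs => ⟨_, hG hs⟩⟩,
      ⟨fun hΔ => h.isSingletonMod_of_lattice hc hΔ.lattice_left, hG⟩⟩
  · rintro ⟨_, hΔ⟩
    obtain ⟨X, Ξ, h⟩ := hc.exists_partition
    exact h.exists_isDiagramAut (h.isSingletonMod_of_lattice hc hΔ.lattice_left)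
  · rintro ⟨φ, hφ, hφc⟩
    exact ⟨_, hstd.of_mulEquiv (DualMonoid.mapEquiv φ (hφ.mem_reflections_iff hn) hφc)⟩
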